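/- Let $T(s,t,u)$ be the Tornheim double zeta function: the function that is holomorphic in $(s,t,u)\in\mathbb C^3$ off the hyperplanes $s+u\in\mathbb Z_{\le 1}$, $t+u\in\mathbb Z_{\le 1}$, $s+t+u=2$, and equal to the absolutely convergent series $\sum_{m,n\ge 1} m^{-s}n^{-t}(m+n)^{-u}$ when $\Re(s+u)>1$, $\Re(t+u)>1$, $\Re(s+t+u)>2$ (this continuation exists and is unique). Put \[ S_1(s,t,u)=(1+e^{-\pi i(s+t+u)})T(s,t,u)+(e^{-\pi i s}+e^{-\pi i(u+t)})T(u,s,t)+(e^{-\pi i t}+e^{-\pi i(u+s)})T(t,u,s), \] \[ S_2(s,t,u)=(e^{-\pi i u}+e^{-\pi i(s+t)})T(s,t,u)+(e^{-\pi i t}+e^{-\pi i(u+s)})T(u,s,t)+(e^{-\pi i s}+e^{-\pi i(t+u)})T(t,u,s), \] as meromorphic functions, $S_1$ being extended holomorphically across its removable singularities, and \[ G(s,t,u)=\frac{e^{-\pi i(s+t+u)/2}(2\pi)^{s+t+u}}{\Gamma(s)\Gamma(t)\Gamma(u)},\qquad \eta_k^{\pm}(s)=(\pm2)^{-k}\binom{k-s}{k}\zeta(k+1-s),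 \] where for $k\ge1$ the removable singularity of $\eta_k^\pm$ at $s=k$ is filled in by the limit. Let $\kappa_{l,m,n}=1$ if $l+m+n$ is even and $\kappa_{l,m,n}=0$ otherwise. (1) The function $S_1$ is holomorphic on the set where $s+t\notin\mathbb Z_{\le1}$ and unbounded near every other point, and on this set \[ S_1(s,t,u)=G(s,t,u)\Bigl\{\sum_{l,m,n\ge0}\frac{\kappa_{l,m,n}\eta_l^+(s)\eta_m^+(t)\eta_n^-(u)}{l+m+n+1}+\sum_{n\ge0}\frac{2^{1-s-t}\eta_n^+(u)}{s+t+n-1} +\sum_{m,n\ge0}\frac{\eta_m^-(t)\eta_n^+(u)}{2^s(s+m+n)}+\sum_{l,n\ge0}\frac{\eta_l^-(s)\eta_n^+(u)}{2^t(t+l+n)}+\sum_{l,m\ge0}\frac{\eta_l^+(s)\eta_m^+(t)}{2^u(u+l+m)}\Bigr\}. \] (2) The function $S_2$ is holomorphic on the set where $s+t,\ t+u,\ u+s\notin\mathbb Z_{\le1}$ and $s+t+u\ne2$, and unbounded near every other point, and on this set \[ S_2(s,t,u)=G(s,t,u)\Bigl\{\frac{2^{2-s-t-u}}{s+t+u-2}+\sum_{l,m,n\ge0}\frac{\kappa_{l,m,n}\eta_l^+(s)\eta_m^+(t)\eta_n^+(u)}{l+m+n+1}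 +\sum_{l,m\ge0}\frac{\eta_l^-(s)\eta_m^-(t)}{2^u(u+l+m)}+\sum_{m,n\ge0}\frac{\eta_m^-(t)\eta_n^-(u)}{2^s(s+m+n)}+\sum_{n,l\ge0}\frac{\eta_n^-(u)\eta_l^-(s)}{2^t(t+n+l)} \] \[ +\sum_{l\ge0}\frac{2^{1-t-u}\eta_l^-(s)}{t+u+l-1}+\sum_{m\ge0}\frac{2^{1-u-s}\eta_m^-(t)}{u+s+m-1}+\sum_{n\ge0}\frac{2^{1-s-t}\eta_n^-(u)}{s+t+n-1}\Bigr\}. \] If none of $s,t,u$ is a non-positive integer, every term in the braces is finite and the identities hold as written. At the other points of the two sets, $G$ is multiplied into the series term by term, each product $G\cdot(\text{term})$ being replaced by its holomorphic extension to the respective set, which exists. All the series converge absolutely and rapidly: at every point of the respective set and for every $r>1/2$, the products $G\cdot(\text{term})$ are bounded by a constant times $r^{d}$, where $d$ is the sum of the summation indices. -/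

import Mathlib

open scoped Topology

noncomputable section

namespace Tornheim

/-- `z` is an integer that is at most `1`. -/
def IsIntLeOne (z : ℂ) : Prop := ∃ n : ℤ, n ≤ 1 ∧ z = n

/-! ### The Tornheim double zeta function -/

/-- The term `1 / (m ^ s n ^ t (m + n) ^ u)` with `m = i.1 + 1` and `n = i.2 + 1`. -/
def seriesTerm (s t u : ℂ) (i : ℕ × ℕ) : ℂ :=
  1 / (((i.1 + 1 : ℕ) : ℂ) ^ s * ((i.2 + 1 : ℕ) : ℂ) ^ t
    * (((i.1 + 1) + (i.2 + 1) : ℕ) : ℂ) ^ u)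

/-- The region of absolute convergence of the Tornheim series. -/
def convergenceRegion : Set (ℂ × ℂ × ℂ) :=
  {(s, t, u) | 1 < (s + u).re ∧ 1 < (t + u).re ∧ 2 < (s + t + u).re}

/-- The complement of the singular hyperplanes of the Tornheim function. -/
def domT : Set (ℂ × ℂ × ℂ) :=
  {(s, t, u) | ¬ IsIntLeOne (s + u) ∧ ¬ IsIntLeOne (t + u) ∧ s + t + u ≠ 2}

/-- `F` is holomorphic off the singular hyperplanes and is the sum of the Tornheim series in its
region of absolute convergence. As `domT` is open and connected, this fixes `F` on `domT`. -/
structure IsContinuation (F : ℂ × ℂ × ℂ → ℂ) : Prop where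
  differentiableOn : DifferentiableOn ℂ F domT
  hasSum : ∀ s t u : ℂ, (s, t, u) ∈ convergenceRegion → HasSum (seriesTerm s t u) (F (s, t, u))

/-- The Tornheim double zeta function: the continuation of the Tornheim series to `domT`
(the values outside `domT` are irrelevant). -/
def T (s t u : ℂ) : ℂ := Classical.epsilon IsContinuation (s, t, u)

/-! ### The symmetric Tornheim functions -/

/-- `e ^ (-π i z)` -/
def e (z : ℂ) : ℂ := Complex.exp (-(Real.pi * Complex.I * z))

/-- The domain `s + t ∉ ℤ_{≤ 1}`. -/
def D₁ : Set (ℂ × ℂ × ℂ) := {(s, t, _u) | ¬ IsIntLeOne (s + t)}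

/-- The domain `s + t, t + u, u + s ∉ ℤ_{≤ 1}`, `s + t + u ≠ 2`, on which each of
`T s t u`, `T u s t`, `T t u s` is holomorphic. -/
def D₂ : Set (ℂ × ℂ × ℂ) :=
  {(s, t, u) | ¬ IsIntLeOne (s + t) ∧ ¬ IsIntLeOne (t + u) ∧ ¬ IsIntLeOne (u + s)
    ∧ s + t + u ≠ 2}

/-- The linear combination of Tornheim functions that defines `S₁`; it makes sense on `D₂`. -/
def comb₁ (s t u : ℂ) : ℂ :=
  (1 + e (s + t + u)) * T s t u + (e s + e (u + t)) * T u s t + (e t + e (u + s)) * T t u s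

/-- `S₁`: the extension by continuity of `comb₁`, from `D₂` across the hyperplanes where the
singularities of the individual summands cancel. -/
def S₁ (s t u : ℂ) : ℂ := extendFrom D₂ (fun (s, t, u) => comb₁ s t u) (s, t, u)

/-- `S₂`, on its domain `D₂`. -/
def S₂ (s t u : ℂ) : ℂ :=
  (e u + e (s + t)) * T s t u + (e t + e (u + s)) * T u s t + (e s + e (t + u)) * T t u s

/-! ### The ingredients of the expansions -/

/-- `G(s,t,u) = e^{-π i (s+t+u)/2} (2π)^{s+t+u} / (Γ(s) Γ(t) Γ(u))`, an entire function
(in Mathlib `Γ` is `0` at its poles, so that the quotient is `0` there, as it should be). -/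
def G (s t u : ℂ) : ℂ :=
  Complex.exp (-(Real.pi * Complex.I * (s + t + u) / 2)) * (2 * Real.pi : ℂ) ^ (s + t + u)
    / (Complex.Gamma s * Complex.Gamma t * Complex.Gamma u)

/-- `c ^ (-k) * binom(k - s, k) * ζ(k + 1 - s)`. For `k ≥ 1` the singularity at `s = k` is
removable and the value there is the limit; `k = 0`, `s = 0` is a pole. -/
def eta (c : ℂ) (k : ℕ) : ℂ → ℂ :=
  extendFrom {(k : ℂ)}ᶜ fun s => c ^ (-(k : ℤ)) * Ring.choose ((k : ℂ) - s) k
    * riemannZeta (k + 1 - s)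

/-- `η_k^+` -/
def etaP (k : ℕ) (s : ℂ) : ℂ := eta 2 k s

/-- `η_k^-` -/
def etaM (k : ℕ) (s : ℂ) : ℂ := eta (-2) k s

/-- The parity weight `κ_{l,m,n}`. -/
def kappa (l m n : ℕ) : ℂ := if Even (l + m + n) then 1 else 0

/-- General term of the triple series. -/
def triple (a b c : ℕ → ℂ → ℂ) (s t u : ℂ) (i : ℕ × ℕ × ℕ) : ℂ :=
  kappa i.1 i.2.1 i.2.2 * a i.1 s * b i.2.1 t * c i.2.2 u / (i.1 + i.2.1 + i.2.2 + 1)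

/-- General term of a double series. -/
def double (a b : ℕ → ℂ → ℂ) (s t u : ℂ) (i : ℕ × ℕ) : ℂ :=
  a i.1 t * b i.2 u / ((2 : ℂ) ^ s * (s + i.1 + i.2))

/-- General term of a single series. -/
def single (a : ℕ → ℂ → ℂ) (s t u : ℂ) (n : ℕ) : ℂ :=
  (2 : ℂ) ^ (1 - s - t) * a n u / (s + t + n - 1)

/-! ### Points where a factor of a term has a pole that is cancelled by a zero of `G` -/

/-- The points with `s, t, u ∉ ℤ_{≤ 0}`; here `G` has no zeros, and a term of one of the series
has no pole other than the singularities that the domains `D₁`, `D₂` exclude. -/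
def regularPoints : Set (ℂ × ℂ × ℂ) :=
  {(s, t, u) | ∀ n : ℕ, s ≠ -(n : ℂ) ∧ t ≠ -(n : ℂ) ∧ u ≠ -(n : ℂ)}

/-- The product `G(s,t,u) * a(s,t,u)`, extended by continuity from the regular points. -/
def regG (a : ℂ → ℂ → ℂ → ℂ) (s t u : ℂ) : ℂ :=
  extendFrom regularPoints (fun (s, t, u) => G s t u * a s t u) (s, t, u)

/-- The series `∑ i, G * a i` is meaningful and converges rapidly on `D`: each term extends
holomorphically from the regular points to `D`, and at each point of `D` the terms decay
geometrically in the total degree `deg i`, with every ratio `r > 1/2`. -/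
structure RapidOn {ι : Type} (D : Set (ℂ × ℂ × ℂ)) (deg : ι → ℕ) (a : ℂ → ℂ → ℂ → ι → ℂ) :
    Prop where
  holomorphic : ∀ i, DifferentiableOn ℂ
    (fun (s, t, u) => regG (fun s t u => a s t u i) s t u) D
  eq_of_regular : ∀ i s t u, (s, t, u) ∈ D → (s, t, u) ∈ regularPoints →
    regG (fun s t u => a s t u i) s t u = G s t u * a s t u i
  decay : ∀ s t u, (s, t, u) ∈ D → ∀ r : ℝ, 1 / 2 < r → ∃ C : ℝ, ∀ i,
    ‖regG (fun s t u => a s t u i) s t u‖ ≤ C * r ^ deg i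
  summable : ∀ s t u, (s, t, u) ∈ D → Summable fun i => regG (fun s t u => a s t u i) s t u

/-- The total degree of a double index. -/
def deg₂ (i : ℕ × ℕ) : ℕ := i.1 + i.2

/-- The total degree of a triple index. -/
def deg₃ (i : ℕ × ℕ × ℕ) : ℕ := i.1 + i.2.1 + i.2.2

/-- `∑ i, G(s,t,u) * a(s,t,u,i)`, with the terms extended by continuity. -/
def sumG {ι : Type} (a : ℂ → ℂ → ℂ → ι → ℂ) (s t u : ℂ) : ℂ :=
  ∑' i, regG (fun s t u => a s t u i) s t u

/-- Every point outside `D` is a true singularity of `f`: `f` is unbounded near it. -/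
def SingularOff (D : Set (ℂ × ℂ × ℂ)) (f : ℂ → ℂ → ℂ → ℂ) : Prop :=
  ∀ p ∉ D, ∀ U ∈ 𝓝 p, ∀ C : ℝ, ∃ s t u, (s, t, u) ∈ U ∩ D ∧ C < ‖f s t u‖

end Tornheim

end

/-!
Write `ζ(1 - s, x) / Γ(s)` by Hurwitz's formula as a combination of the periodic zeta functions
`∑ e^{±2π i m x} / m^s`. When the real parts of `s`, `t`, `u` exceed `1`, integrate over a period
the product of three such functions, at `x`, `x`, `x` or at `x`, `x`, `-x`. Orthogonality of the
exponentials turns the integral into the combination `S₂` or `S₁` of three Tornheim series.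

On the other hand, split the period into the two halves adjacent to `0`. On each half `ζ(1 - s, x)`
is a power series in `2x` with coefficients `η_k^±(s)`, plus the singular term `x^{s-1}` on the
positive side; multiplying out and integrating gives the expansions.

With `G` multiplied in, each term of the series has poles at most on the hyperplanes that lie
outside the domain. The expansions at the cyclic permutations of `(s, t, u)` are linear relations
between the three Tornheim functions, and solving them continues
`(e^{-2π i s} - 1) (e^{-2π i t} - 1) (e^{-2π i u} - 1) T / Γ(s + t - 1)`. The zeros of the factors
in front of `T` are simple, and the product vanishes on them by the identity theorem on the complex
lines inside each hyperplane, so they can be divided out one at a time.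

All of these domains meet every complex line in a connected set, so the identity theorem on lines
extends the formulas from the region of large real parts. A point outside the domain of `S₁` or `S₂`
lies, up to a permutation of the variables, on a zero hyperplane of `1 / Γ(s + t - 1)` or
`s + t + u - 2`; the product of this factor with the expansion extends continuously to the
hyperplane and does not vanish identically there, so the expansion itself is unbounded.
-/

noncomputable section

namespace Tornheim

open Set Filter Metric

theorem exists_thickening_subset_forall_norm_le {E F : Type*} [PseudoMetricSpace E]
    [SeminormedAddCommGroup F] {K V : Set E} (hK : IsCompact K)
    (hV : IsOpen V) (hKV : K ⊆ V) {g : E → F} (hg : ContinuousOn g V) :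
    ∃ δ > 0, ∃ C, thickening δ K ⊆ V ∧ ∀ x ∈ thickening δ K, ‖g x‖ ≤ C := by
  obtain ⟨C, hC⟩ := hK.exists_bound_of_continuousOn (hg.mono hKV)
  obtain ⟨δ, hδ, hsub⟩ := hK.exists_thickening_subset_open
    (hg.norm.isOpen_inter_preimage hV isOpen_Iio) fun x hx =>
      ⟨hKV hx, (hC x hx).trans_lt (lt_add_one C)⟩
  exact ⟨δ, hδ, C + 1, fun x hx => (hsub hx).1, fun x hx => (hsub hx).2.le⟩

section SeveralVariables

variable {E F : Type*} [NormedAddCommGroup E] [NormedSpace ℂ E]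
  [NormedAddCommGroup F] [NormedSpace ℂ F]

theorem hasDerivAt_add_smul (p v : E) (z : ℂ) : HasDerivAt (fun z : ℂ => p + z • v) v z := by
  simpa using ((hasDerivAt_id z).smul_const v).const_add p

/-- Cauchy's estimate on the complex line through `p` in the direction of `v`. -/
theorem norm_fderiv_le_of_forall_closedBall {f : E → F} {p : E} {ρ C : ℝ} (hρ : 0 < ρ)
    (hf : ∀ q ∈ closedBall p ρ, DifferentiableAt ℂ f q) (hC : ∀ q ∈ closedBall p ρ, ‖f q‖ ≤ C) :
    ‖fderiv ℂ f p‖ ≤ C / ρ := by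
  have hp : p ∈ closedBall p ρ := mem_closedBall_self hρ.le
  have hC₀ : 0 ≤ C := (norm_nonneg _).trans (hC p hp)
  refine ContinuousLinearMap.opNorm_le_bound _ (by positivity) fun v => ?_
  rcases eq_or_ne v 0 with rfl | hv
  · simp
  have hv₀ : 0 < ‖v‖ := norm_pos_iff.2 hv
  have hmem : ∀ z ∈ closedBall (0 : ℂ) (ρ / ‖v‖), p + z • v ∈ closedBall p ρ := by
    intro z hz
    rw [mem_closedBall_zero_iff, le_div_iff₀ hv₀, ← norm_smul] at hz
    rwa [mem_closedBall_iff_norm, add_sub_cancel_left]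
  have hline : DifferentiableOn ℂ (fun z : ℂ => f (p + z • v)) (closedBall 0 (ρ / ‖v‖)) :=
    fun z hz => ((hf _ (hmem z hz)).comp z
      (hasDerivAt_add_smul p v z).differentiableAt).differentiableWithinAt
  have hderiv : deriv (fun z : ℂ => f (p + z • v)) 0 = fderiv ℂ f p v := by
    have hp' : HasFDerivAt f (fderiv ℂ f p) (p + (0 : ℂ) • v) := by
      simpa using (hf p hp).hasFDerivAt
    exact (hp'.comp_hasDerivAt 0 (hasDerivAt_add_smul p v 0)).deriv
  calc ‖fderiv ℂ f p v‖ ≤ C / (ρ / ‖v‖) := hderiv ▸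
        Complex.norm_deriv_le_of_forall_mem_sphere_norm_le (by positivity)
          (hline.diffContOnCl_ball subset_rfl)
          fun z hz => hC _ (hmem z (sphere_subset_closedBall hz))
    _ = C / ρ * ‖v‖ := by field_simp

theorem differentiableOn_tsum_of_locally_bounded [CompleteSpace F] {ι : Type*} {U : Set E}
    (hU : IsOpen U) {f : ι → E → F} (hf : ∀ i, DifferentiableOn ℂ (f i) U)
    (hb : ∀ p ∈ U, ∃ u : ι → ℝ, Summable u ∧ ∀ᶠ q in 𝓝 p, ∀ i, ‖f i q‖ ≤ u i) :
    DifferentiableOn ℂ (fun p => ∑' i, f i p) U := by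
  intro p hp
  obtain ⟨u, hu, hb⟩ := hb p hp
  obtain ⟨ε, hε, hball⟩ := Metric.eventually_nhds_iff_ball.1 (hb.and (hU.mem_nhds hp))
  have hρ : 0 < ε / 2 := by positivity
  have hsub : ∀ q ∈ ball p (ε / 2), ∀ x ∈ closedBall q (ε / 2), x ∈ ball p ε := fun q hq x hx =>
    mem_ball.2 <| (dist_triangle x q p).trans_lt <| by
      linarith [mem_ball.1 hq, mem_closedBall.1 hx]
  have hdiff : ∀ i, ∀ x ∈ ball p ε, DifferentiableAt ℂ (f i) x := fun i x hx =>
    (hf i).differentiableAt (hU.mem_nhds (hball x hx).2)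
  have hp' : p ∈ ball p (ε / 2) := mem_ball_self hρ
  have hsum := hasFDerivAt_tsum_of_isPreconnected (hu.div_const (ε / 2)) isOpen_ball
    (convex_ball p (ε / 2)).isPreconnected
    (fun i q hq => (hdiff i q (hsub q hq q (mem_closedBall_self hρ.le))).hasFDerivAt)
    (fun i q hq => norm_fderiv_le_of_forall_closedBall hρ
      (fun x hx => hdiff i x (hsub q hq x hx)) fun x hx => (hball x (hsub q hq x hx)).1 i)
    hp' (Summable.of_norm_bounded hu (hball p (mem_ball_self hε)).1) hp'
  exact hsum.differentiableAt.differentiableWithinAt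

theorem eq_of_isPreconnected_preimage_lineMap [CompleteSpace F] {D : Set E} (hD : IsOpen D)
    {f g : E → F} (hf : DifferentiableOn ℂ f D) (hg : DifferentiableOn ℂ g D) {q p : E}
    (hq : q ∈ D) (hp : p ∈ D) (hline : IsPreconnected {z : ℂ | AffineMap.lineMap q p z ∈ D})
    (hfg : ∀ᶠ z : ℂ in 𝓝 0, f (AffineMap.lineMap q p z) = g (AffineMap.lineMap q p z)) :
    f p = g p := by
  set L : ℂ → E := ⇑(AffineMap.lineMap q p : ℂ →ᵃ[ℂ] E) with hL
  have hLdiff : Differentiable ℂ L := by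
    simp only [hL, AffineMap.coe_lineMap, vsub_eq_sub, vadd_eq_add]
    fun_prop
  have hL₀ : L 0 = q := AffineMap.lineMap_apply_zero (k := ℂ) q p
  have hL₁ : L 1 = p := AffineMap.lineMap_apply_one (k := ℂ) q p
  have hanalytic : ∀ {h : E → F}, DifferentiableOn ℂ h D → AnalyticOnNhd ℂ (h ∘ L) (L ⁻¹' D) :=
    fun hh => (hh.comp hLdiff.differentiableOn (mapsTo_preimage L D)).analyticOnNhd
      (hD.preimage hLdiff.continuous)
  have := (hanalytic hf).eqOn_of_preconnected_of_eventuallyEq (hanalytic hg) hline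
    (show L 0 ∈ D by rwa [hL₀]) hfg (show L 1 ∈ D by rwa [hL₁])
  simpa only [Function.comp_apply, hL₁] using this

theorem eqOn_of_isPreconnected_preimage_lineMap [CompleteSpace F] {D : Set E} (hD : IsOpen D)
    {f g : E → F} (hf : DifferentiableOn ℂ f D) (hg : DifferentiableOn ℂ g D) {q : E} (hq : q ∈ D)
    (hline : ∀ p, IsPreconnected {z : ℂ | AffineMap.lineMap q p z ∈ D})
    (hfg : f =ᶠ[𝓝 q] g) : EqOn f g D := fun p hp =>
  eq_of_isPreconnected_preimage_lineMap hD hf hg hq hp (hline p)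
    ((AffineMap.lineMap_continuous.tendsto' 0 q
      (AffineMap.lineMap_apply_zero (k := ℂ) q p)).eventually hfg)

theorem eqOn_of_convex [CompleteSpace F] [NormedSpace ℝ E] [IsScalarTower ℝ ℂ E] {D : Set E}
    (hconv : Convex ℝ D) (hD : IsOpen D) {f g : E → F} (hf : DifferentiableOn ℂ f D)
    (hg : DifferentiableOn ℂ g D) {q : E} (hq : q ∈ D) (hfg : f =ᶠ[𝓝 q] g) : EqOn f g D :=
  eqOn_of_isPreconnected_preimage_lineMap hD hf hg hq
    (fun p => by
      simp only [AffineMap.lineMap_apply_module']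
      exact ((hconv.translate_preimage_left q).linear_preimage
        ((LinearMap.toSpanSingleton ℂ E (p - q)).restrictScalars ℝ)).isPreconnected) hfg

/-- `D` meets every complex line through one of its points in a cocountable set. The complement of
countably many complex hyperplanes has this property, which is stable under intersections and makes
`D` dense and suitable for the identity theorem. -/
def LineCocountable (D : Set E) : Prop :=
  ∀ q ∈ D, ∀ p : E, {z : ℂ | AffineMap.lineMap q p z ∈ D}ᶜ.Countable

theorem lineCocountable_ne_zero [CompleteSpace F] {f : E → F} (hf : Differentiable ℂ f) :
    LineCocountable {p | f p ≠ 0} := by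
  intro q hq p
  have hline : AnalyticOnNhd ℂ (fun z : ℂ => f (AffineMap.lineMap q p z)) univ := by
    simp only [AffineMap.lineMap_apply_module']
    exact fun z _ => (by fun_prop : Differentiable ℂ fun z : ℂ => f (z • (p - q) + q)).analyticAt z
  have hq₀ : f (AffineMap.lineMap q p (0 : ℂ)) ≠ 0 := by
    rwa [AffineMap.lineMap_apply_zero]
  have hdiscrete : DiscreteTopology ↥{z : ℂ | AffineMap.lineMap q p z ∈ {p | f p ≠ 0}}ᶜ :=
    (mem_codiscrete'.1 (hline.preimage_zero_mem_codiscrete hq₀)).2.to_subtype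
  exact countable_coe_iff.1 countable_of_Lindelof_of_discrete

theorem lineCocountable_ne (ℓ : E →L[ℂ] ℂ) (c : ℂ) : LineCocountable {p | ℓ p ≠ c} := by
  simpa only [sub_ne_zero] using
    lineCocountable_ne_zero (f := fun p => ℓ p - c) (ℓ.differentiable.sub_const c)

namespace LineCocountable

variable {D : Set E}

theorem iInter {ι : Type*} [Countable ι] {D : ι → Set E}
    (h : ∀ i, LineCocountable (D i)) : LineCocountable (⋂ i, D i) := fun q hq p =>
  (countable_iUnion fun i => h i q (mem_iInter.1 hq i) p).mono fun z hz => by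
    simpa using hz

theorem inter {D' : Set E} (h : LineCocountable D) (h' : LineCocountable D') :
    LineCocountable (D ∩ D') := fun q hq p =>
  ((h q hq.1 p).union (h' q hq.2 p)).mono fun _ hz => not_and_or.1 hz

theorem mem_closure_inter_range_lineMap (h : LineCocountable D) {q : E} (hq : q ∈ D) (p : E) :
    p ∈ closure (D ∩ range (AffineMap.lineMap q p : ℂ → E)) := by
  have hline : Dense {z : ℂ | AffineMap.lineMap q p z ∈ D} := by
    simpa only [compl_compl] using (h q hq p).dense_compl ℂ
  have hmaps : MapsTo (AffineMap.lineMap q p : ℂ → E) {z | AffineMap.lineMap q p z ∈ D}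
      (D ∩ range (AffineMap.lineMap q p : ℂ → E)) := fun z hz => ⟨hz, mem_range_self z⟩
  simpa only [AffineMap.lineMap_apply_one] using
    map_mem_closure AffineMap.lineMap_continuous (hline 1) hmaps

theorem mem_closure_inter_preimage (h : LineCocountable D) (ℓ : E →L[ℂ] ℂ) {q p : E} (hq : q ∈ D)
    (hqp : ℓ q = ℓ p) : p ∈ closure (D ∩ ℓ ⁻¹' {ℓ p}) := by
  refine closure_mono (inter_subset_inter_right D ?_) (h.mem_closure_inter_range_lineMap hq p)
  rintro _ ⟨z, rfl⟩
  simp [AffineMap.lineMap_apply_module', hqp]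

theorem dense (h : LineCocountable D) (hne : D.Nonempty) : Dense D := fun p =>
  closure_mono inter_subset_left (h.mem_closure_inter_range_lineMap hne.some_mem p)

theorem isPreconnected_preimage_lineMap (h : LineCocountable D) {q : E} (hq : q ∈ D) (p : E) :
    IsPreconnected {z : ℂ | AffineMap.lineMap q p z ∈ D} := by
  have := (h q hq p).isPathConnected_compl_of_one_lt_rank (by
    rw [Complex.rank_real_complex]; norm_num)
  simpa only [compl_compl] using this.isConnected.isPreconnected

theorem eqOn [CompleteSpace F] (h : LineCocountable D) (hD : IsOpen D) {f g : E → F}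
    (hf : DifferentiableOn ℂ f D) (hg : DifferentiableOn ℂ g D) {q : E} (hq : q ∈ D)
    (hfg : f =ᶠ[𝓝 q] g) : EqOn f g D :=
  eqOn_of_isPreconnected_preimage_lineMap hD hf hg hq (h.isPreconnected_preimage_lineMap hq) hfg

end LineCocountable

theorem differentiableAt_circleAverage [FiniteDimensional ℂ E] [CompleteSpace F]
    [SecondCountableTopology F]
    {g : E → F} {V : Set E} (hV : IsOpen V) (hg : DifferentiableOn ℂ g V) {p v : E} {r : ℝ}
    (hr : ∀ z ∈ sphere (0 : ℂ) |r|, p + z • v ∈ V) :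
    DifferentiableAt ℂ (fun q => Real.circleAverage (fun z => g (q + z • v)) 0 r) p := by
  borelize E
  obtain ⟨δ, hδ, C, hδV, hC⟩ := exists_thickening_subset_forall_norm_le
    (K := (fun z : ℂ => p + z • v) '' sphere 0 |r|) ((isCompact_sphere _ _).image (by fun_prop)) hV
    (image_subset_iff.2 hr) hg.continuousOn
  have hρ : 0 < δ / 2 := by positivity
  have hsub : ∀ q ∈ ball p (δ / 2), ∀ θ : ℝ, ∀ x ∈ closedBall (q + circleMap 0 r θ • v) (δ / 2),
      x ∈ thickening δ ((fun z : ℂ => p + z • v) '' sphere 0 |r|) := by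
    intro q hq θ x hx
    refine mem_thickening_iff.2 ⟨_, mem_image_of_mem _ (circleMap_mem_sphere' 0 r θ), ?_⟩
    refine (dist_triangle x (q + circleMap 0 r θ • v) _).trans_lt ?_
    rw [dist_add_right]
    linarith [mem_ball.1 hq, mem_closedBall.1 hx]
  have hdiff : ∀ q ∈ ball p (δ / 2), ∀ θ : ℝ, ∀ x ∈ closedBall (q + circleMap 0 r θ • v) (δ / 2),
      DifferentiableAt ℂ g x := fun q hq θ x hx =>
    hg.differentiableAt (hV.mem_nhds (hδV (hsub q hq θ x hx)))
  have hcurve : ∀ q, Continuous fun θ : ℝ => q + circleMap 0 r θ • v := fun q => by fun_prop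
  have hcont : ∀ q ∈ ball p (δ / 2), Continuous fun θ : ℝ => g (q + circleMap 0 r θ • v) :=
    fun q hq => continuous_iff_continuousAt.2 fun θ =>
      (hdiff q hq θ _ (mem_closedBall_self hρ.le)).continuousAt.comp (f := fun θ : ℝ =>
        q + circleMap 0 r θ • v) (hcurve q).continuousAt
  have hint := intervalIntegral.hasFDerivAt_integral_of_dominated_of_fderiv_le (𝕜 := ℂ)
    (F := fun q θ => g (q + circleMap 0 r θ • v))
    (F' := fun q θ => fderiv ℂ g (q + circleMap 0 r θ • v)) (x₀ := p)
    (bound := fun _ => C / (δ / 2)) (μ := MeasureTheory.volume) (a := 0) (b := 2 * Real.pi)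
    (ball_mem_nhds p hρ)
    (eventually_of_mem (ball_mem_nhds p hρ) fun q hq => (hcont q hq).aestronglyMeasurable)
    ((hcont p (mem_ball_self hρ)).intervalIntegrable _ _)
    ((measurable_fderiv ℂ g).comp (hcurve p).measurable).aestronglyMeasurable
    (.of_forall fun θ _ q hq => norm_fderiv_le_of_forall_closedBall hρ (hdiff q hq θ)
      fun x hx => hC x (hsub q hq θ x hx))
    intervalIntegrable_const
    (.of_forall fun θ _ q hq => (hasFDerivAt_comp_add_right (circleMap 0 r θ • v)).2
      (hdiff q hq θ _ (mem_closedBall_self hρ.le)).hasFDerivAt)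
  exact hint.differentiableAt.const_smul _

end SeveralVariables

section Division

variable {E : Type*} [NormedAddCommGroup E] [NormedSpace ℂ E]

/-- By the mean value property on the complex lines parallel to `v`, the function is near `p` an
average over circles that avoid `Z`. -/
theorem differentiableOn_of_differentiableOn_diff [FiniteDimensional ℂ E] {F : Type*}
    [NormedAddCommGroup F] [NormedSpace ℂ F] [CompleteSpace F] [SecondCountableTopology F]
    {U Z : Set E} (hU : IsOpen U) (hZ : IsClosed Z) {g : E → F} {v : E}
    (hg : DifferentiableOn ℂ g (U \ Z))
    (hline : ∀ p ∈ U, DifferentiableAt ℂ (fun z : ℂ => g (p + z • v)) 0)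
    (hpunct : ∀ p ∈ U, ∀ᶠ z in 𝓝[≠] (0 : ℂ), p + z • v ∉ Z) : DifferentiableOn ℂ g U := by
  intro p hp
  have hslice (q : E) (z : ℂ) (hz : q + z • v ∈ U) :
      DifferentiableAt ℂ (fun z : ℂ => g (q + z • v)) z := by
    have h := hline _ hz
    rw [← sub_self z] at h
    have hcomp := h.comp (f := fun w : ℂ => w - z) z (by fun_prop)
    refine hcomp.congr_of_eventuallyEq (.of_forall fun w => congrArg g ?_)
    simp only [sub_smul]
    abel
  have hcont : Tendsto (fun x : E × ℂ => x.1 + x.2 • v) (𝓝 p ×ˢ 𝓝 0) (𝓝 p) := by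
    rw [← nhds_prod_eq]
    exact (by fun_prop : Continuous fun x : E × ℂ => x.1 + x.2 • v).tendsto' _ _ (by simp)
  obtain ⟨P, hP, Q, hQ, hPQ⟩ := eventually_prod_iff.1 (hcont.eventually (hU.mem_nhds hp))
  obtain ⟨ε, hε, hball⟩ := Metric.eventually_nhds_iff_ball.1
    ((eventually_nhdsWithin_iff.1 (hpunct p hp)).and hQ)
  have hr : 0 < ε / 2 := by positivity
  have hsub : closedBall (0 : ℂ) |ε / 2| ⊆ ball 0 ε := by
    rw [abs_of_pos hr]
    exact closedBall_subset_ball (half_lt_self hε)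
  have havoid : ∀ z ∈ sphere (0 : ℂ) |ε / 2|, p + z • v ∈ U \ Z := fun z hz =>
    have hz' := hball z (hsub (sphere_subset_closedBall hz))
    ⟨hPQ hP.self_of_nhds hz'.2, hz'.1 (ne_of_mem_sphere hz (abs_pos.2 hr.ne').ne')⟩
  have hmean : ∀ q, P q → Real.circleAverage (fun z => g (q + z • v)) 0 (ε / 2) = g q := by
    intro q hq
    have hdiff : DifferentiableOn ℂ (fun z : ℂ => g (q + z • v)) (closedBall 0 |ε / 2|) :=
      fun z hz => (hslice q z (hPQ hq (hball z (hsub hz)).2)).differentiableWithinAt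
    simpa only [zero_smul, add_zero] using (hdiff.diffContOnCl_ball subset_rfl).circleAverage
  refine (differentiableAt_circleAverage (hU.sdiff hZ) hg havoid).congr_of_eventuallyEq ?_
    |>.differentiableWithinAt
  filter_upwards [hP] with q hq using (hmean q hq).symm

theorem differentiableAt_update_div {f φ : ℂ → ℂ} {c : ℂ} (hf : AnalyticAt ℂ f c)
    (hφ : AnalyticAt ℂ φ c) (hf₀ : f c = 0) (hφ₀ : φ c = 0) (hφ' : deriv φ c ≠ 0) :
    DifferentiableAt ℂ (Function.update (fun z => f z / φ z) c (deriv f c / deriv φ c)) c := by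
  have hdslope : ∀ {h : ℂ → ℂ}, AnalyticAt ℂ h c → DifferentiableAt ℂ (dslope h c) c := by
    intro h hh
    obtain ⟨s, hs, hd⟩ := hh.exists_mem_nhds_analyticOnNhd
    exact ((Complex.differentiableOn_dslope hs).2 hd.differentiableOn).differentiableAt hs
  refine ((hdslope hf).div (hdslope hφ) (by rwa [dslope_same])).congr_of_eventuallyEq
    (.of_forall fun z => ?_)
  rcases eq_or_ne z c with rfl | hz
  · simp
  · simp only [Pi.div_apply, Function.update_of_ne hz, dslope_of_ne _ hz, slope_def_field, hf₀, hφ₀,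
      sub_zero]
    rw [div_div_div_cancel_right₀ (sub_ne_zero.2 hz)]

theorem analyticAt_comp_add_smul {F : Type*} [NormedAddCommGroup F] [NormedSpace ℂ F]
    [CompleteSpace F] {U : Set E} (hU : IsOpen U) {f : E → F} (hf : DifferentiableOn ℂ f U) {p : E}
    (hp : p ∈ U) (v : E) : AnalyticAt ℂ (fun z : ℂ => f (p + z • v)) 0 := by
  have hline : Continuous fun z : ℂ => p + z • v := by fun_prop
  have hcomp := hf.comp (fun z _ => (hasDerivAt_add_smul p v z).differentiableAt
    |>.differentiableWithinAt) (mapsTo_preimage (fun z : ℂ => p + z • v) U)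
  exact hcomp.analyticAt ((hU.preimage hline).mem_nhds (by simpa using hp))

theorem eventually_nhdsNE_zero_apply_add_ne_zero {φ : ℂ → ℂ} {w : ℂ}
    (hφ : DifferentiableAt ℂ φ w) (hsimple : φ w = 0 → deriv φ w ≠ 0) :
    ∀ᶠ z in 𝓝[≠] (0 : ℂ), φ (w + z) ≠ 0 := by
  have hderiv : HasDerivAt (fun z => φ (w + z)) (deriv φ w) 0 :=
    HasDerivAt.comp_const_add w 0 (by simpa only [add_zero] using hφ.hasDerivAt)
  by_cases hw : φ w = 0
  · exact hderiv.eventually_ne (hsimple hw)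
  · exact (hderiv.continuousAt.eventually_ne (by simpa only [add_zero])).filter_mono
      nhdsWithin_le_nhds

theorem exists_differentiableOn_mul_eq [FiniteDimensional ℂ E] {U : Set E} (hU : IsOpen U)
    {f : E → ℂ} (hf : DifferentiableOn ℂ f U) {ℓ : E →L[ℂ] ℂ} (hℓ : ℓ ≠ 0) {φ : ℂ → ℂ}
    (hφ : Differentiable ℂ φ) (hsimple : ∀ w, φ w = 0 → deriv φ w ≠ 0)
    (hzero : ∀ p ∈ U, φ (ℓ p) = 0 → f p = 0) :
    ∃ g, DifferentiableOn ℂ g U ∧ ∀ p ∈ U, φ (ℓ p) * g p = f p := by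
  classical
  obtain ⟨v, hv⟩ : ∃ v, ℓ v = 1 := LinearMap.surjective (f := ℓ.toLinearMap)
    (fun h => hℓ (ContinuousLinearMap.coe_injective h)) 1
  set g : E → ℂ := fun p =>
    if φ (ℓ p) = 0 then deriv (fun z : ℂ => f (p + z • v)) 0 / deriv φ (ℓ p)
    else f p / φ (ℓ p) with hg
  have hφℓ : Differentiable ℂ fun p => φ (ℓ p) := hφ.comp ℓ.differentiable
  have hpunct : ∀ w, ∀ᶠ z in 𝓝[≠] (0 : ℂ), φ (w + z) ≠ 0 := fun w =>
    eventually_nhdsNE_zero_apply_add_ne_zero (hφ w) (hsimple w)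
  have hoff : DifferentiableOn ℂ g (U \ {p | φ (ℓ p) = 0}) := by
    refine DifferentiableOn.congr (f := fun p => f p / φ (ℓ p)) ?_ fun p hp => if_neg hp.2
    simp only [div_eq_mul_inv]
    exact (hf.mono sdiff_subset).fun_mul (hφℓ.differentiableOn.fun_inv fun p hp => hp.2)
  refine ⟨g, differentiableOn_of_differentiableOn_diff (v := v) hU
    (isClosed_eq hφℓ.continuous continuous_const) hoff (fun p hp => ?_)
    (fun p _ => by simpa [hv] using hpunct (ℓ p)), fun p hp => ?_⟩
  · have hslice := analyticAt_comp_add_smul hU hf hp v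
    have hφslice : AnalyticAt ℂ (fun z => φ (ℓ p + z)) 0 :=
      (by fun_prop : Differentiable ℂ fun z => φ (ℓ p + z)).analyticAt 0
    have hderiv : deriv (fun z => φ (ℓ p + z)) 0 = deriv φ (ℓ p) := by
      rw [deriv_comp_const_add, add_zero]
    by_cases hp₀ : φ (ℓ p) = 0
    · refine (differentiableAt_update_div hslice hφslice (by simpa using hzero p hp hp₀)
        (by simpa using hp₀) (hderiv ▸ hsimple _ hp₀)).congr_of_eventuallyEq ?_
      filter_upwards [eventually_nhdsWithin_iff.1 (hpunct (ℓ p))] with z hz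
      rcases eq_or_ne z 0 with rfl | hz₀
      · simp [hg, hp₀, hderiv]
      · simp [hg, hv, hz hz₀, hz₀]
    · refine (hslice.differentiableAt.div hφslice.differentiableAt
        (by simpa using hp₀)).congr_of_eventuallyEq ?_
      filter_upwards [hφslice.continuousAt.eventually_ne (by simpa using hp₀)] with z hz
      simp [hg, hv, hz]
  · by_cases hp₀ : φ (ℓ p) = 0
    · rw [hp₀, zero_mul, hzero p hp hp₀]
    · rw [hg]
      simp only [hp₀, if_false]
      field_simp

end Division

theorem exists_forall_norm_le_of_continuous {X F : Type*} [SeminormedAddCommGroup X] [ProperSpace X]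
    [SeminormedAddCommGroup F] {f : X → F} (hf : Continuous f) (R : ℝ) :
    ∃ C, 0 ≤ C ∧ ∀ x, ‖x‖ ≤ R → ‖f x‖ ≤ C := by
  obtain ⟨C, hC⟩ := (isCompact_closedBall (0 : X) R).exists_bound_of_continuousOn hf.continuousOn
  exact ⟨max C 0, le_max_right _ _, fun x hx => (hC x (by simpa using hx)).trans (le_max_left _ _)⟩

theorem exists_forall_norm_le_mul_pow_of_forall_ge {X F : Type*} [SeminormedAddCommGroup X]
    [ProperSpace X] [SeminormedAddCommGroup F] {f : ℕ → X → F} (hf : ∀ k, Continuous (f k))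
    {ρ : ℝ} (hρ : 1 ≤ ρ) {R C : ℝ} (hC : 0 ≤ C) {K : ℕ}
    (h : ∀ k ≥ K, ∀ x, ‖x‖ ≤ R → ‖f k x‖ ≤ C * ρ ^ k) :
    ∃ C, 0 ≤ C ∧ ∀ k x, ‖x‖ ≤ R → ‖f k x‖ ≤ C * ρ ^ k := by
  choose c hc₀ hc using fun k => exists_forall_norm_le_of_continuous (hf k) R
  have hsum : 0 ≤ ∑ k ∈ Finset.range K, c k := Finset.sum_nonneg fun k _ => hc₀ k
  refine ⟨C + ∑ k ∈ Finset.range K, c k, by positivity, fun k x hx => ?_⟩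
  rcases lt_or_ge k K with hk | hk
  · calc ‖f k x‖ ≤ c k := hc k x hx
      _ ≤ ∑ k ∈ Finset.range K, c k :=
        Finset.single_le_sum (fun k _ => hc₀ k) (Finset.mem_range.2 hk)
      _ ≤ C + ∑ k ∈ Finset.range K, c k := le_add_of_nonneg_left hC
      _ ≤ _ := le_mul_of_one_le_right (by positivity) (one_le_pow₀ hρ)
  · calc ‖f k x‖ ≤ C * ρ ^ k := h k hk x hx
      _ ≤ _ := by gcongr; exact le_add_of_nonneg_right hsum

theorem exists_prod_one_add_le_mul_pow {a : ℕ → ℝ} (ha : ∀ j, 0 ≤ a j)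
    (ha₀ : Tendsto a atTop (𝓝 0)) {ρ : ℝ} (hρ : 1 < ρ) :
    ∃ B, 0 ≤ B ∧ ∀ k, ∏ j ∈ Finset.range k, (1 + a j) ≤ B * ρ ^ k := by
  set p : ℕ → ℝ := fun k => ∏ j ∈ Finset.range k, (1 + a j)
  have hp₀ : ∀ k, 0 < p k := fun k => Finset.prod_pos fun j _ => by have := ha j; positivity
  have hratio : Tendsto (fun k => ‖p (k + 1) / ρ ^ (k + 1)‖ / ‖p k / ρ ^ k‖) atTop
      (𝓝 (1 / ρ)) := by
    have h := (ha₀.const_add 1).div_const ρ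
    rw [add_zero] at h
    refine h.congr fun k => ?_
    have h₀ := hp₀ k
    have h₁ := hp₀ (k + 1)
    rw [Real.norm_of_nonneg (by positivity), Real.norm_of_nonneg (by positivity),
      show p (k + 1) = p k * (1 + a k) from Finset.prod_range_succ _ _, pow_succ]
    field_simp
  have hsum : Summable fun k => p k / ρ ^ k := summable_of_ratio_test_tendsto_lt_one
    ((div_lt_one (by positivity)).2 hρ) (.of_forall fun k => by have := hp₀ k; positivity) hratio
  obtain ⟨B, hB⟩ := hsum.tendsto_atTop_zero.bddAbove_range
  have hle : ∀ k, p k ≤ B * ρ ^ k := fun k => (div_le_iff₀ (by positivity)).1 (hB ⟨k, rfl⟩)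
  exact ⟨B, by simpa using (hp₀ 0).le.trans (hle 0), hle⟩

section ZetaGamma

/-- The entire function `w ζ(1 + w)`, with value `1` at the pole of `ζ(1 + w)`. -/
def zetaReg : ℂ → ℂ := Function.update (fun w => w * riemannZeta (1 + w)) 0 1

theorem zetaReg_of_ne {w : ℂ} (hw : w ≠ 0) : zetaReg w = w * riemannZeta (1 + w) :=
  Function.update_of_ne hw _ _

theorem differentiable_zetaReg : Differentiable ℂ zetaReg := by
  rw [← differentiableOn_univ, ← Complex.differentiableOn_compl_singleton_and_continuousAt_iff
    (c := 0) univ_mem]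
  constructor
  · intro w hw
    have hw₀ : w ≠ 0 := by simpa using hw
    have hζ : DifferentiableAt ℂ (fun w => riemannZeta (1 + w)) w :=
      (differentiableAt_riemannZeta (by simpa using hw₀)).comp (f := fun w => 1 + w) w
        (by fun_prop)
    refine ((differentiableAt_id.mul hζ).congr_of_eventuallyEq ?_).differentiableWithinAt
    filter_upwards [isOpen_ne.mem_nhds hw₀] with x hx using zetaReg_of_ne hx
  · have hshift : Tendsto (fun w : ℂ => 1 + w) (𝓝[≠] 0) (𝓝[≠] 1) := by
      refine tendsto_nhdsWithin_of_tendsto_nhds_of_eventually_within _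
        (tendsto_nhdsWithin_of_tendsto_nhds ?_)
        (eventually_nhdsWithin_of_forall fun w hw => by simpa using hw)
      exact (by fun_prop : Continuous fun w : ℂ => 1 + w).tendsto' _ _ (add_zero 1)
    refine continuousAt_update_same.2 ?_
    simpa only [Function.comp_def, add_sub_cancel_left] using riemannZeta_residue_one.comp hshift

theorem norm_riemannZeta_le {σ : ℝ} (hσ : 1 < σ) {w : ℂ} (hw : σ ≤ w.re) :
    ‖riemannZeta w‖ ≤ ∑' n : ℕ, 1 / ((n + 1 : ℕ) : ℝ) ^ σ := by
  rw [zeta_eq_tsum_one_div_nat_add_one_cpow (hσ.trans_le hw)]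
  refine tsum_of_norm_bounded ((summable_nat_add_iff 1).2
    (Real.summable_one_div_nat_rpow.2 hσ)).hasSum fun n => ?_
  rw [norm_div, norm_one, ← Nat.cast_add_one, Complex.norm_natCast_cpow_of_pos n.succ_pos]
  gcongr
  exact_mod_cast Nat.le_add_left 1 n

theorem choose_sub_eq_prod (k : ℕ) (s : ℂ) :
    Ring.choose ((k : ℂ) - s) k = (∏ j ∈ Finset.range k, ((j + 1 : ℂ) - s)) / k.factorial := by
  have h := Ring.descPochhammer_eq_factorial_smul_choose ((k : ℂ) - s) k
  rw [Polynomial.descPochhammer_smeval_eq_ascPochhammer, Polynomial.ascPochhammer_smeval_eq_eval,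
    ← descPochhammer_eval_eq_ascPochhammer, descPochhammer_eval_eq_prod_range, nsmul_eq_mul,
    ← Finset.prod_range_reflect] at h
  rw [eq_div_iff (by exact_mod_cast k.factorial_ne_zero), mul_comm, ← h]
  refine Finset.prod_congr rfl fun j hj => ?_
  rw [Nat.cast_sub (by grind), Nat.cast_sub (by grind)]
  push_cast
  ring

theorem norm_choose_sub_le (k : ℕ) (s : ℂ) :
    ‖Ring.choose ((k : ℂ) - s) k‖ ≤ ∏ j ∈ Finset.range k, (1 + ‖s‖ / (j + 1)) := by
  rw [choose_sub_eq_prod, ← Finset.prod_range_add_one_eq_factorial, Nat.cast_prod,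
    ← Finset.prod_div_distrib, norm_prod]
  refine Finset.prod_le_prod (fun _ _ => norm_nonneg _) fun j _ => ?_
  have hj : ‖((j + 1 : ℕ) : ℂ)‖ = (j : ℝ) + 1 := by rw [Complex.norm_natCast, Nat.cast_add_one]
  calc ‖((j : ℂ) + 1 - s) / (j + 1 : ℕ)‖ = ‖(1 : ℂ) - s / (j + 1 : ℕ)‖ := by
        rw [← Nat.cast_add_one, sub_div, div_self (by exact_mod_cast j.succ_ne_zero)]
    _ ≤ ‖(1 : ℂ)‖ + ‖s / (j + 1 : ℕ)‖ := norm_sub_le _ _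
    _ = 1 + ‖s‖ / (j + 1) := by rw [norm_one, norm_div, hj]

/-- The function `binom(k - s, k) ζ(k + 1 - s)`, that is `η_k^±` without the factor `(±2) ^ (-k)`.
For `k ≥ 1` one factor of the binomial coefficient cancels the pole of `ζ` at `s = k`; for `k = 0`
there remains the pole at `s = 0`. -/
def etaBase : ℕ → ℂ → ℂ
  | 0, s => riemannZeta (1 - s)
  | k + 1, s => (∏ j ∈ Finset.range k, ((j + 1 : ℂ) - s)) / (k + 1).factorial
      * zetaReg ((k + 1 : ℕ) - s)

/-- The entire function `binom(k - s, k) ζ(k + 1 - s) / Γ(s)`. -/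
def etaGamma : ℕ → ℂ → ℂ
  | 0, s => -zetaReg (-s) * (Complex.Gamma (s + 1))⁻¹
  | k + 1, s => etaBase (k + 1) s * (Complex.Gamma s)⁻¹

theorem choose_mul_zeta_eq_etaBase {k : ℕ} {s : ℂ} (hs : s ≠ k) :
    Ring.choose ((k : ℂ) - s) k * riemannZeta (k + 1 - s) = etaBase k s := by
  cases k with
  | zero => simp [etaBase]
  | succ k =>
    have hne : ((k + 1 : ℕ) : ℂ) - s ≠ 0 := sub_ne_zero.2 (Ne.symm hs)
    rw [choose_sub_eq_prod, etaBase, zetaReg_of_ne hne, Finset.prod_range_succ,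
      show (1 : ℂ) + (((k + 1 : ℕ) : ℂ) - s) = ((k + 1 : ℕ) : ℂ) + 1 - s by ring]
    push_cast
    ring

theorem differentiable_etaBase_succ (k : ℕ) : Differentiable ℂ (etaBase (k + 1)) := by
  have := differentiable_zetaReg
  unfold etaBase
  fun_prop

theorem differentiableAt_etaBase {k : ℕ} {s : ℂ} (h : k ≠ 0 ∨ s ≠ 0) :
    DifferentiableAt ℂ (etaBase k) s := by
  cases k with
  | zero =>
    have hs : s ≠ 0 := h.resolve_left (not_not.2 rfl)
    exact (differentiableAt_riemannZeta (by simpa using hs)).comp (f := fun s : ℂ => 1 - s) s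
      (by fun_prop)
  | succ k => exact differentiable_etaBase_succ k s

theorem differentiable_etaGamma (k : ℕ) : Differentiable ℂ (etaGamma k) := by
  cases k with
  | zero =>
    have hζ := differentiable_zetaReg
    have hΓ : Differentiable ℂ fun s : ℂ => (Complex.Gamma (s + 1))⁻¹ :=
      Complex.differentiable_one_div_Gamma.comp (by fun_prop : Differentiable ℂ fun s : ℂ => s + 1)
    unfold etaGamma
    fun_prop
  | succ k =>
    exact (differentiable_etaBase_succ k).mul Complex.differentiable_one_div_Gamma

theorem etaBase_mul_gamma_inv {k : ℕ} {s : ℂ} (hs : s ≠ 0) :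
    etaBase k s * (Complex.Gamma s)⁻¹ = etaGamma k s := by
  cases k with
  | zero =>
    rw [etaBase, etaGamma, zetaReg_of_ne (neg_ne_zero.2 hs),
      Complex.one_div_Gamma_eq_self_mul_one_div_Gamma_add_one, ← sub_eq_add_neg]
    ring
  | succ k => rfl

theorem eta_eq {c : ℂ} {k : ℕ} {s : ℂ} (h : k ≠ 0 ∨ s ≠ 0) :
    eta c k s = c ^ (-(k : ℤ)) * etaBase k s := by
  refine extendFrom_eq (by rw [closure_compl_singleton]; trivial) ?_
  have hcont : Tendsto (fun s => c ^ (-(k : ℤ)) * etaBase k s) (𝓝 s)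
      (𝓝 (c ^ (-(k : ℤ)) * etaBase k s)) :=
    (differentiableAt_etaBase h).continuousAt.tendsto.const_mul _
  refine (hcont.mono_left nhdsWithin_le_nhds).congr' ?_
  filter_upwards [self_mem_nhdsWithin] with x hx
  rw [← choose_mul_zeta_eq_etaBase (by simpa using hx), mul_assoc]

theorem norm_etaBase_le {k : ℕ} {s : ℂ} {R : ℝ} (hs : ‖s‖ ≤ R) (hk : R + 1 ≤ k) :
    ‖etaBase k s‖ ≤ (∏ j ∈ Finset.range k, (1 + R / (j + 1)))
      * ∑' n : ℕ, 1 / ((n + 1 : ℕ) : ℝ) ^ (2 : ℝ) := by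
  have hsk : s ≠ k := by
    rintro rfl
    rw [Complex.norm_natCast] at hs
    linarith
  have hre : 2 ≤ ((k : ℂ) + 1 - s).re := by
    have := (abs_le.1 (Complex.abs_re_le_norm s)).2
    simp only [Complex.sub_re, Complex.add_re, Complex.natCast_re, Complex.one_re]
    linarith
  rw [← choose_mul_zeta_eq_etaBase hsk, norm_mul]
  have hR : 0 ≤ R := (norm_nonneg s).trans hs
  refine mul_le_mul ((norm_choose_sub_le k s).trans ?_) (norm_riemannZeta_le one_lt_two hre)
    (norm_nonneg _) (by positivity)
  gcongr

theorem exists_bound_etaGamma (R : ℝ) {ρ : ℝ} (hρ : 1 < ρ) :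
    ∃ C : ℝ, 0 ≤ C ∧ ∀ k : ℕ, ∀ s : ℂ, ‖s‖ ≤ R → ‖etaGamma k s‖ ≤ C * ρ ^ k := by
  wlog hR : 0 ≤ R
  · exact ⟨0, le_rfl, fun k s hs => absurd ((norm_nonneg s).trans hs) hR⟩
  obtain ⟨M, hM₀, hM⟩ := exists_forall_norm_le_of_continuous
    Complex.differentiable_one_div_Gamma.continuous R
  obtain ⟨B, hB₀, hB⟩ := exists_prod_one_add_le_mul_pow (a := fun j : ℕ => R / (j + 1))
    (fun j => by positivity)
    (tendsto_const_nhds.div_atTop (tendsto_natCast_atTop_atTop.atTop_add tendsto_const_nhds)) hρ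
  obtain ⟨Z, hZ₀, hZ⟩ : ∃ Z : ℝ, 0 ≤ Z ∧ Z = ∑' n : ℕ, 1 / ((n + 1 : ℕ) : ℝ) ^ (2 : ℝ) :=
    ⟨_, tsum_nonneg fun n => by positivity, rfl⟩
  obtain ⟨K, hK⟩ := exists_nat_ge (R + 1)
  refine exists_forall_norm_le_mul_pow_of_forall_ge
    (fun k => (differentiable_etaGamma k).continuous) hρ.le (C := B * Z * M) (by positivity)
    (K := K) fun k hk s hs => ?_
  have hkR : R + 1 ≤ k := hK.trans (by exact_mod_cast hk)
  obtain ⟨k, rfl⟩ : ∃ j, k = j + 1 := Nat.exists_eq_succ_of_ne_zero <| by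
    rintro rfl
    rw [Nat.cast_zero] at hkR
    linarith
  calc ‖etaGamma (k + 1) s‖ = ‖etaBase (k + 1) s‖ * ‖(Complex.Gamma s)⁻¹‖ := norm_mul _ _
    _ ≤ (B * ρ ^ (k + 1) * Z) * M := by
      have hbase := hZ ▸ norm_etaBase_le hs hkR
      have hprod := hB (k + 1)
      have hΓ := hM s hs
      gcongr
      exact hbase.trans (by gcongr)
    _ = B * Z * M * ρ ^ (k + 1) := by ring

/-- The entire function `1 / ((w + k) Γ(w))`. -/
def gammaInvDiv (k : ℕ) (w : ℂ) : ℂ :=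
  (∏ j ∈ Finset.range k, (w + j)) * (Complex.Gamma (w + k + 1))⁻¹

theorem gammaInvDiv_mul (k : ℕ) (w : ℂ) : (w + k) * gammaInvDiv k w = (Complex.Gamma w)⁻¹ := by
  have hprod : ∀ k : ℕ,
      (∏ j ∈ Finset.range k, (w + j)) * (Complex.Gamma (w + k))⁻¹ = (Complex.Gamma w)⁻¹ := by
    intro k
    induction k with
    | zero => simp
    | succ k ih =>
      rw [← ih, Finset.prod_range_succ, mul_assoc, Nat.cast_add_one, ← add_assoc,
        ← Complex.one_div_Gamma_eq_self_mul_one_div_Gamma_add_one]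
  rw [gammaInvDiv, mul_left_comm, ← Complex.one_div_Gamma_eq_self_mul_one_div_Gamma_add_one, hprod]

theorem gammaInvDiv_eq {k : ℕ} {w : ℂ} (h : w + k ≠ 0) :
    gammaInvDiv k w = (Complex.Gamma w)⁻¹ / (w + k) := by
  rw [← gammaInvDiv_mul k w, mul_div_cancel_left₀ _ h]

theorem gammaInvDiv_neg_ne_zero (k : ℕ) : gammaInvDiv k (-k) ≠ 0 := by
  simp only [gammaInvDiv, neg_add_cancel, zero_add, Complex.Gamma_one, inv_one, mul_one]
  refine Finset.prod_ne_zero_iff.2 fun j hj h => (Finset.mem_range.1 hj).ne ?_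
  exact_mod_cast (neg_add_eq_zero.1 h).symm

theorem differentiable_gammaInvDiv (k : ℕ) : Differentiable ℂ (gammaInvDiv k) := by
  have hΓ : Differentiable ℂ fun w : ℂ => (Complex.Gamma (w + k + 1))⁻¹ :=
    Complex.differentiable_one_div_Gamma.comp
      (by fun_prop : Differentiable ℂ fun w : ℂ => w + k + 1)
  unfold gammaInvDiv
  fun_prop

theorem deriv_gamma_inv_ne_zero {w : ℂ} (h : (Complex.Gamma w)⁻¹ = 0) :
    deriv (fun w => (Complex.Gamma w)⁻¹) w ≠ 0 := by
  obtain ⟨k, rfl⟩ := Complex.Gamma_eq_zero_iff w |>.1 (inv_eq_zero.1 h)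
  have hfactor : (fun w => (Complex.Gamma w)⁻¹) = fun w => (w + k) * gammaInvDiv k w :=
    funext fun w => (gammaInvDiv_mul k w).symm
  have hderiv := ((hasDerivAt_id (-k : ℂ)).add_const (k : ℂ)).fun_mul
    (differentiable_gammaInvDiv k (-k)).hasDerivAt
  rw [hfactor]
  refine hderiv.deriv.trans_ne ?_
  simpa using gammaInvDiv_neg_ne_zero k

theorem exists_bound_gammaInvDiv (R : ℝ) :
    ∃ C : ℝ, 0 ≤ C ∧ ∀ k : ℕ, ∀ w : ℂ, ‖w‖ ≤ R → ‖gammaInvDiv k w‖ ≤ C := by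
  obtain ⟨M, hM₀, hM⟩ := exists_forall_norm_le_of_continuous
    Complex.differentiable_one_div_Gamma.continuous R
  obtain ⟨K, hK⟩ := exists_nat_ge (R + 1)
  suffices h : ∀ k ≥ K, ∀ w : ℂ, ‖w‖ ≤ R → ‖gammaInvDiv k w‖ ≤ M * 1 ^ k by
    simpa only [one_pow, mul_one] using exists_forall_norm_le_mul_pow_of_forall_ge
      (fun k => (differentiable_gammaInvDiv k).continuous) le_rfl hM₀ h
  intro k hk w hw
  have hkR : R + 1 ≤ k := hK.trans (by exact_mod_cast hk)
  have hnorm : 1 ≤ ‖w + k‖ := by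
    have := norm_sub_le_norm_add (k : ℂ) w
    rw [Complex.norm_natCast, add_comm] at this
    linarith
  rw [gammaInvDiv_eq (norm_pos_iff.1 (one_pos.trans_le hnorm)), norm_div, one_pow, mul_one]
  exact (div_le_self (norm_nonneg _) hnorm).trans (hM w hw)

end ZetaGamma

/-- A family of holomorphic functions on `D` that decays geometrically in the degree, locally
uniformly, with every ratio `r > 1/2`. -/
structure RapidFamily {ι E : Type*} [NormedAddCommGroup E] [NormedSpace ℂ E] (D : Set E)
    (deg : ι → ℕ) (h : ι → E → ℂ) : Prop where
  differentiableOn : ∀ i, DifferentiableOn ℂ (h i) D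
  bound : ∀ p ∈ D, ∀ r : ℝ, 1 / 2 < r → ∃ C : ℝ, ∀ᶠ q in 𝓝 p, ∀ i, ‖h i q‖ ≤ C * r ^ deg i

namespace RapidFamily

variable {ι E : Type*} [NormedAddCommGroup E] [NormedSpace ℂ E] {D : Set E} {deg : ι → ℕ}
  {h : ι → E → ℂ}

theorem mono (hh : RapidFamily D deg h) {D' : Set E} (hD : D' ⊆ D) : RapidFamily D' deg h :=
  ⟨fun i => (hh.differentiableOn i).mono hD, fun p hp => hh.bound p (hD hp)⟩

theorem comp {E' : Type*} [NormedAddCommGroup E'] [NormedSpace ℂ E'] (hh : RapidFamily D deg h)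
    {σ : E' → E} (hσ : Differentiable ℂ σ) {D' : Set E'} (hD : MapsTo σ D' D) :
    RapidFamily D' deg fun i p => h i (σ p) := by
  refine ⟨fun i => (hh.differentiableOn i).comp hσ.differentiableOn hD, fun p hp r hr => ?_⟩
  obtain ⟨C, hC⟩ := hh.bound (σ p) (hD hp) r hr
  exact ⟨C, hσ.continuous.continuousAt.eventually hC⟩

theorem exists_summable_bound (hh : RapidFamily D deg h)
    (hdeg : Summable fun i => (3 / 4 : ℝ) ^ deg i) {p : E} (hp : p ∈ D) :
    ∃ b : ι → ℝ, Summable b ∧ ∀ᶠ q in 𝓝 p, ∀ i, ‖h i q‖ ≤ b i := by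
  obtain ⟨C, hC⟩ := hh.bound p hp (3 / 4) (by norm_num)
  exact ⟨_, hdeg.mul_left C, hC⟩

theorem summable (hh : RapidFamily D deg h) (hdeg : Summable fun i => (3 / 4 : ℝ) ^ deg i)
    {p : E} (hp : p ∈ D) : Summable fun i => h i p :=
  have ⟨_, hb, hle⟩ := hh.exists_summable_bound hdeg hp
  .of_norm_bounded hb hle.self_of_nhds

theorem differentiableOn_tsum (hh : RapidFamily D deg h) (hD : IsOpen D)
    (hdeg : Summable fun i => (3 / 4 : ℝ) ^ deg i) :
    DifferentiableOn ℂ (fun p => ∑' i, h i p) D :=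
  differentiableOn_tsum_of_locally_bounded hD hh.differentiableOn
    fun _ hp => hh.exists_summable_bound hdeg hp

end RapidFamily

theorem summable_pow_id : Summable fun n : ℕ => (3 / 4 : ℝ) ^ id n :=
  summable_geometric_of_lt_one (by norm_num) (by norm_num)

theorem summable_pow_deg₂ : Summable fun i : ℕ × ℕ => (3 / 4 : ℝ) ^ deg₂ i := by
  simpa only [deg₂, pow_add, id_eq] using summable_pow_id.mul_of_nonneg summable_pow_id
    (fun _ => by positivity) (fun _ => by positivity)

theorem summable_pow_deg₃ : Summable fun i : ℕ × ℕ × ℕ => (3 / 4 : ℝ) ^ deg₃ i := by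
  simpa only [deg₂, deg₃, pow_add, mul_assoc, id_eq] using summable_pow_id.mul_of_nonneg
    summable_pow_deg₂ (fun _ => by positivity) (fun _ => by positivity)

section RegularPoints

/-- The first coordinate of `ℂ³`, as a linear form. -/
def coordS : ℂ × ℂ × ℂ →L[ℂ] ℂ := ContinuousLinearMap.fst ℂ ℂ (ℂ × ℂ)

/-- The second coordinate of `ℂ³`, as a linear form. -/
def coordT : ℂ × ℂ × ℂ →L[ℂ] ℂ :=
  (ContinuousLinearMap.fst ℂ ℂ ℂ).comp (ContinuousLinearMap.snd ℂ ℂ (ℂ × ℂ))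

/-- The third coordinate of `ℂ³`, as a linear form. -/
def coordU : ℂ × ℂ × ℂ →L[ℂ] ℂ :=
  (ContinuousLinearMap.snd ℂ ℂ ℂ).comp (ContinuousLinearMap.snd ℂ ℂ (ℂ × ℂ))

theorem lineCocountable_regularPoints : LineCocountable regularPoints := by
  have h : regularPoints = ⋂ n : ℕ, ({p | coordS p ≠ -(n : ℂ)} ∩ {p | coordT p ≠ -(n : ℂ)}) ∩
      {p | coordU p ≠ -(n : ℂ)} := by
    ext ⟨s, t, u⟩
    simp [regularPoints, coordS, coordT, coordU, and_assoc]
  rw [h]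
  exact .iInter fun n => ((lineCocountable_ne _ _).inter (lineCocountable_ne _ _)).inter
    (lineCocountable_ne _ _)

theorem one_mem_regularPoints : ((1, 1, 1) : ℂ × ℂ × ℂ) ∈ regularPoints := by
  intro n
  have h : (1 : ℂ) ≠ -n := fun h => by
    have := congrArg Complex.re h
    rw [Complex.one_re, Complex.neg_re, Complex.natCast_re] at this
    linarith [(n.cast_nonneg : (0 : ℝ) ≤ n)]
  exact ⟨h, h, h⟩

theorem dense_regularPoints : Dense regularPoints :=
  lineCocountable_regularPoints.dense ⟨_, one_mem_regularPoints⟩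

variable {ι : Type} {D : Set (ℂ × ℂ × ℂ)} {deg : ι → ℕ} {h : ι → ℂ × ℂ × ℂ → ℂ}
  {a : ℂ → ℂ → ℂ → ι → ℂ}

theorem regG_eq (hD : IsOpen D) {b : ℂ → ℂ → ℂ → ℂ} {f : ℂ × ℂ × ℂ → ℂ} (hf : ContinuousOn f D)
    (hb : ∀ s t u, (s, t, u) ∈ D → (s, t, u) ∈ regularPoints → G s t u * b s t u = f (s, t, u))
    {s t u : ℂ} (hp : (s, t, u) ∈ D) : regG b s t u = f (s, t, u) := by
  refine extendFrom_eq (dense_regularPoints _) ?_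
  have hlim : Tendsto f (𝓝[regularPoints] (s, t, u)) (𝓝 (f (s, t, u))) :=
    (hf.continuousAt (hD.mem_nhds hp)).tendsto.mono_left nhdsWithin_le_nhds
  refine hlim.congr' ?_
  filter_upwards [self_mem_nhdsWithin, mem_nhdsWithin_of_mem_nhds (hD.mem_nhds hp)]
    with ⟨s', t', u'⟩ hq hqD
  exact (hb s' t' u' hqD hq).symm

theorem RapidFamily.rapidOn (hh : RapidFamily D deg h) (hD : IsOpen D)
    (hdeg : Summable fun i => (3 / 4 : ℝ) ^ deg i)
    (ha : ∀ i s t u, (s, t, u) ∈ D → (s, t, u) ∈ regularPoints →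
      G s t u * a s t u i = h i (s, t, u)) : RapidOn D deg a := by
  have hreg : ∀ i {s t u}, (s, t, u) ∈ D →
      regG (fun s t u => a s t u i) s t u = h i (s, t, u) := fun i _ _ _ hp =>
    regG_eq hD (hh.differentiableOn i).continuousOn (ha i) hp
  refine ⟨fun i => ?_, fun i s t u hp hr => ?_, fun s t u hp r hr => ?_, fun s t u hp => ?_⟩
  · exact (hh.differentiableOn i).congr fun ⟨s, t, u⟩ hp => hreg i hp
  · rw [hreg i hp, ha i s t u hp hr]
  · obtain ⟨C, hC⟩ := hh.bound _ hp r hr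
    exact ⟨C, fun i => (hreg i hp).symm ▸ hC.self_of_nhds i⟩
  · exact (hh.summable hdeg hp).congr fun i => (hreg i hp).symm

theorem RapidFamily.sumG_eq (hh : RapidFamily D deg h) (hD : IsOpen D)
    (ha : ∀ i s t u, (s, t, u) ∈ D → (s, t, u) ∈ regularPoints →
      G s t u * a s t u i = h i (s, t, u)) {s t u : ℂ} (hp : (s, t, u) ∈ D) :
    sumG a s t u = ∑' i, h i (s, t, u) :=
  tsum_congr fun i => regG_eq hD (hh.differentiableOn i).continuousOn (ha i) hp

theorem G_mul_tsum_eq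
    (ha : ∀ i s t u, (s, t, u) ∈ D → (s, t, u) ∈ regularPoints →
      G s t u * a s t u i = h i (s, t, u)) {s t u : ℂ} (hp : (s, t, u) ∈ D)
    (hr : (s, t, u) ∈ regularPoints) :
    G s t u * ∑' i, a s t u i = ∑' i, h i (s, t, u) := by
  rw [← tsum_mul_left]
  exact tsum_congr fun i => ha i s t u hp hr

end RegularPoints

namespace RapidFamily

variable {ι E : Type*} [NormedAddCommGroup E] [NormedSpace ℂ E] {D : Set E}

theorem of_locally_bounded {h : ι → E → ℂ} (hd : ∀ i, DifferentiableOn ℂ (h i) D)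
    (hb : ∀ p ∈ D, ∃ C : ℝ, ∀ᶠ q in 𝓝 p, ∀ i, ‖h i q‖ ≤ C) : RapidFamily D 0 h :=
  ⟨hd, fun p hp _ _ => by simpa only [Pi.zero_apply, pow_zero, mul_one] using hb p hp⟩

theorem of_differentiable {f : E → ℂ} (hf : Differentiable ℂ f) :
    RapidFamily univ (0 : ι → ℕ) fun _ => f :=
  of_locally_bounded (fun _ => hf.differentiableOn) fun p _ => ⟨‖f p‖ + 1, by
    filter_upwards [hf.continuous.norm.continuousAt.eventually (gt_mem_nhds (lt_add_one ‖f p‖))]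
      with q hq _ using hq.le⟩

theorem of_forall_norm_le {deg : ι → ℕ} {h : ι → E → ℂ} (hd : ∀ i, Differentiable ℂ (h i))
    (hb : ∀ R r : ℝ, 1 / 2 < r → ∃ C : ℝ, ∀ i x, ‖x‖ ≤ R → ‖h i x‖ ≤ C * r ^ deg i) :
    RapidFamily univ deg h := by
  refine ⟨fun i => (hd i).differentiableOn, fun p _ r hr => ?_⟩
  obtain ⟨C, hC⟩ := hb (‖p‖ + 1) r hr
  refine ⟨C, ?_⟩
  filter_upwards [continuous_norm.continuousAt.eventually (gt_mem_nhds (lt_add_one ‖p‖))]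
    with q hq i using hC i q hq.le

theorem mul {deg d₁ d₂ : ι → ℕ} {f g : ι → E → ℂ} (hf : RapidFamily D d₁ f)
    (hg : RapidFamily D d₂ g) (hdeg : ∀ i, deg i = d₁ i + d₂ i) :
    RapidFamily D deg fun i p => f i p * g i p := by
  refine ⟨fun i => (hf.differentiableOn i).mul (hg.differentiableOn i), fun p hp r hr => ?_⟩
  obtain ⟨A, hA⟩ := hf.bound p hp r hr
  obtain ⟨B, hB⟩ := hg.bound p hp r hr
  refine ⟨A * B, ?_⟩
  filter_upwards [hA, hB] with q hqA hqB i
  calc ‖f i q * g i q‖ = ‖f i q‖ * ‖g i q‖ := norm_mul _ _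
    _ ≤ (A * r ^ d₁ i) * (B * r ^ d₂ i) :=
      mul_le_mul (hqA i) (hqB i) (norm_nonneg _) ((norm_nonneg _).trans (hqA i))
    _ = A * B * r ^ deg i := by rw [hdeg, pow_add]; ring

theorem reindex {κ : Type*} {deg : ι → ℕ} {h : ι → E → ℂ} (hh : RapidFamily D deg h)
    (φ : κ → ι) : RapidFamily D (deg ∘ φ) fun j => h (φ j) := by
  refine ⟨fun j => hh.differentiableOn (φ j), fun p hp r hr => ?_⟩
  obtain ⟨C, hC⟩ := hh.bound p hp r hr
  exact ⟨C, hC.mono fun q hq j => hq (φ j)⟩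

end RapidFamily

theorem rapidFamily_zpow_mul_etaGamma {a : ℂ} (ha : ‖a‖ = 2) :
    RapidFamily univ id fun (k : ℕ) s => a ^ (-(k : ℤ)) * etaGamma k s := by
  refine .of_forall_norm_le (fun k => (differentiable_etaGamma k).const_mul _) fun R r hr => ?_
  obtain ⟨C, -, hC⟩ := exists_bound_etaGamma R (ρ := 2 * r) (by linarith)
  refine ⟨C, fun k s hs => ?_⟩
  calc ‖a ^ (-(k : ℤ)) * etaGamma k s‖ = ((2 : ℝ) ^ k)⁻¹ * ‖etaGamma k s‖ := by
        rw [norm_mul, norm_zpow, ha, zpow_neg, zpow_natCast]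
    _ ≤ ((2 : ℝ) ^ k)⁻¹ * (C * (2 * r) ^ k) := by gcongr; exact hC k s hs
    _ = C * r ^ k := by rw [mul_pow]; field_simp

theorem rapidFamily_gammaInvDiv : RapidFamily univ 0 gammaInvDiv :=
  .of_forall_norm_le differentiable_gammaInvDiv fun R _ _ => by
    obtain ⟨C, -, hC⟩ := exists_bound_gammaInvDiv R
    exact ⟨C, by simpa using hC⟩

theorem norm_kappa_div_le (l m n : ℕ) : ‖kappa l m n / (l + m + n + 1)‖ ≤ 1 := by
  have hκ : ‖kappa l m n‖ ≤ 1 := by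
    unfold kappa
    split <;> simp
  have hcast : (l + m + n + 1 : ℂ) = (l + m + n + 1 : ℕ) := by push_cast; ring
  rw [norm_div, hcast, Complex.norm_natCast]
  exact div_le_one_of_le₀ (hκ.trans (by exact_mod_cast Nat.le_add_left 1 _)) (Nat.cast_nonneg _)

theorem isClosed_setOf_isIntLeOne : IsClosed {z : ℂ | IsIntLeOne z} := by
  have h : {z : ℂ | IsIntLeOne z} = (fun n : ℤ => (n : ℂ)) '' {n | n ≤ 1} := by
    ext z
    simp only [IsIntLeOne, mem_ofPred_eq, mem_image, eq_comm]
  rw [h]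
  exact Complex.isClosedEmbedding_intCast.isClosedMap _ (isClosed_discrete _)

theorem isOpen_setOf_not_isIntLeOne {X : Type*} [TopologicalSpace X] {f : X → ℂ}
    (hf : Continuous f) : IsOpen {x | ¬ IsIntLeOne (f x)} :=
  isClosed_setOf_isIntLeOne.isOpen_compl.preimage hf

theorem isOpen_D₁ : IsOpen D₁ :=
  isOpen_setOf_not_isIntLeOne (f := fun p : ℂ × ℂ × ℂ => p.1 + p.2.1) (by fun_prop)

theorem isIntLeOne_one_sub_natCast (n : ℕ) : IsIntLeOne (1 - n) :=
  ⟨1 - n, by omega, by push_cast; ring⟩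

theorem add_natCast_sub_one_ne_zero {z : ℂ} (hz : ¬ IsIntLeOne z) (n : ℕ) : z + n - 1 ≠ 0 :=
  fun h => hz <| by
    have hz' : z = 1 - n := by linear_combination h
    exact hz' ▸ isIntLeOne_one_sub_natCast n

theorem rapidFamily_inv_add_natCast_sub_one :
    RapidFamily {z : ℂ | ¬ IsIntLeOne z} 0 fun (n : ℕ) z => (z + n - 1)⁻¹ := by
  refine .of_locally_bounded (fun n z hz => ?_) fun z hz => ?_
  · have h : DifferentiableAt ℂ (fun z : ℂ => (z + n - 1)⁻¹) z :=
      DifferentiableAt.fun_inv (by fun_prop) (add_natCast_sub_one_ne_zero hz n)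
    exact h.differentiableWithinAt
  · obtain ⟨ε, hε, hball⟩ := Metric.isOpen_iff.1 isClosed_setOf_isIntLeOne.isOpen_compl z hz
    refine ⟨(ε / 2)⁻¹, ?_⟩
    filter_upwards [ball_mem_nhds z (half_pos hε)] with q hq n
    have hfar : ε ≤ dist (1 - n : ℂ) z := not_lt.1 fun h =>
      hball (mem_ball.2 h) (isIntLeOne_one_sub_natCast n)
    have htri := dist_triangle (1 - n : ℂ) q z
    have hq' : ‖q + n - 1‖ = dist (1 - n : ℂ) q := by
      rw [dist_comm, dist_eq_norm]
      congr 1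
      ring
    rw [norm_inv, hq']
    gcongr
    linarith [mem_ball.1 hq]

section Terms

/-- The numerator `e^{-π i (s+t+u)/2} (2π)^{s+t+u}` of `G`. -/
def gNum (p : ℂ × ℂ × ℂ) : ℂ :=
  Complex.exp (-(Real.pi * Complex.I * (p.1 + p.2.1 + p.2.2) / 2))
    * (2 * Real.pi : ℂ) ^ (p.1 + p.2.1 + p.2.2)

theorem G_eq (s t u : ℂ) : G s t u = gNum (s, t, u) * (Complex.Gamma s)⁻¹ * (Complex.Gamma t)⁻¹
    * (Complex.Gamma u)⁻¹ := by
  simp only [G, gNum, div_eq_mul_inv, mul_inv]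
  ring

theorem complex_two_pi_ne_zero : (2 * Real.pi : ℂ) ≠ 0 := by
  exact_mod_cast Real.two_pi_pos.ne'

theorem differentiable_gNum : Differentiable ℂ gNum :=
  Differentiable.mul (by fun_prop)
    (Differentiable.const_cpow (by fun_prop) (Or.inl complex_two_pi_ne_zero))

/-- The entire extension of `G` times the general term of a triple series. -/
def tripleTerm (a b c : ℂ) (i : ℕ × ℕ × ℕ) (p : ℂ × ℂ × ℂ) : ℂ :=
  gNum p * (kappa i.1 i.2.1 i.2.2 / (i.1 + i.2.1 + i.2.2 + 1))
    * (a ^ (-(i.1 : ℤ)) * etaGamma i.1 p.1) * (b ^ (-(i.2.1 : ℤ)) * etaGamma i.2.1 p.2.1)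
    * (c ^ (-(i.2.2 : ℤ)) * etaGamma i.2.2 p.2.2)

/-- The entire extension of `G` times the general term of a double series. -/
def doubleTerm (a b : ℂ) (i : ℕ × ℕ) (p : ℂ × ℂ × ℂ) : ℂ :=
  gNum p * (2 : ℂ) ^ (-p.1) * gammaInvDiv (i.1 + i.2) p.1
    * (a ^ (-(i.1 : ℤ)) * etaGamma i.1 p.2.1) * (b ^ (-(i.2 : ℤ)) * etaGamma i.2 p.2.2)

/-- The entire extension of `G` times the numerator of the general term of a single series, which
lacks the factor `1 / (s + t + n - 1)`. -/
def singleNum (a : ℂ) (n : ℕ) (p : ℂ × ℂ × ℂ) : ℂ :=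
  gNum p * (2 : ℂ) ^ (1 - p.1 - p.2.1) * (Complex.Gamma p.1)⁻¹ * (Complex.Gamma p.2.1)⁻¹
    * (a ^ (-(n : ℤ)) * etaGamma n p.2.2)

/-- The extension to `D₁` of `G` times the general term of a single series. -/
def singleTerm (a : ℂ) (n : ℕ) (p : ℂ × ℂ × ℂ) : ℂ :=
  singleNum a n p / (p.1 + p.2.1 + n - 1)

/-- The entire extension of `G / Γ(s + t - 1)` times the general term of a single series. -/
def singleTermReg (a : ℂ) (n : ℕ) (p : ℂ × ℂ × ℂ) : ℂ :=
  singleNum a n p * gammaInvDiv n (p.1 + p.2.1 - 1)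

theorem rapidFamily_tripleTerm {a b c : ℂ} (ha : ‖a‖ = 2) (hb : ‖b‖ = 2) (hc : ‖c‖ = 2) :
    RapidFamily univ deg₃ (tripleTerm a b c) := by
  have hκ : RapidFamily (univ : Set (ℂ × ℂ × ℂ)) 0 fun (i : ℕ × ℕ × ℕ) _ =>
      kappa i.1 i.2.1 i.2.2 / (i.1 + i.2.1 + i.2.2 + 1) :=
    .of_locally_bounded (fun _ => differentiableOn_const _)
      fun _ _ => ⟨1, .of_forall fun _ i => norm_kappa_div_le _ _ _⟩
  have h₁ := ((rapidFamily_zpow_mul_etaGamma ha).comp (σ := fun p : ℂ × ℂ × ℂ => p.1)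
    (by fun_prop) (mapsTo_univ _ univ)).reindex fun i : ℕ × ℕ × ℕ => i.1
  have h₂ := ((rapidFamily_zpow_mul_etaGamma hb).comp (σ := fun p : ℂ × ℂ × ℂ => p.2.1)
    (by fun_prop) (mapsTo_univ _ univ)).reindex fun i : ℕ × ℕ × ℕ => i.2.1
  have h₃ := ((rapidFamily_zpow_mul_etaGamma hc).comp (σ := fun p : ℂ × ℂ × ℂ => p.2.2)
    (by fun_prop) (mapsTo_univ _ univ)).reindex fun i : ℕ × ℕ × ℕ => i.2.2
  exact ((((RapidFamily.of_differentiable differentiable_gNum).mul hκ fun _ => rfl).mul h₁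
    fun _ => rfl).mul h₂ fun _ => rfl).mul h₃ fun _ => by simp [deg₃]

theorem differentiable_two_cpow {E : Type*} [NormedAddCommGroup E] [NormedSpace ℂ E] {f : E → ℂ}
    (hf : Differentiable ℂ f) : Differentiable ℂ fun p => (2 : ℂ) ^ f p :=
  hf.const_cpow (Or.inl two_ne_zero)

theorem rapidFamily_doubleTerm {a b : ℂ} (ha : ‖a‖ = 2) (hb : ‖b‖ = 2) :
    RapidFamily univ deg₂ (doubleTerm a b) := by
  have hfactor : Differentiable ℂ fun p : ℂ × ℂ × ℂ => gNum p * (2 : ℂ) ^ (-p.1) :=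
    differentiable_gNum.mul (differentiable_two_cpow (by fun_prop))
  have hΓ := (rapidFamily_gammaInvDiv.comp (σ := fun p : ℂ × ℂ × ℂ => p.1)
    (by fun_prop) (mapsTo_univ _ univ)).reindex fun i : ℕ × ℕ => i.1 + i.2
  have h₁ := ((rapidFamily_zpow_mul_etaGamma ha).comp (σ := fun p : ℂ × ℂ × ℂ => p.2.1)
    (by fun_prop) (mapsTo_univ _ univ)).reindex fun i : ℕ × ℕ => i.1
  have h₂ := ((rapidFamily_zpow_mul_etaGamma hb).comp (σ := fun p : ℂ × ℂ × ℂ => p.2.2)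
    (by fun_prop) (mapsTo_univ _ univ)).reindex fun i : ℕ × ℕ => i.2
  exact (((RapidFamily.of_differentiable hfactor).mul hΓ fun _ => rfl).mul h₁
    fun _ => rfl).mul h₂ fun _ => by simp [deg₂]

theorem rapidFamily_singleNum {a : ℂ} (ha : ‖a‖ = 2) : RapidFamily univ id (singleNum a) := by
  have hfactor : Differentiable ℂ fun p : ℂ × ℂ × ℂ => gNum p * (2 : ℂ) ^ (1 - p.1 - p.2.1)
      * (Complex.Gamma p.1)⁻¹ * (Complex.Gamma p.2.1)⁻¹ :=
    ((differentiable_gNum.mul (differentiable_two_cpow (by fun_prop))).mul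
      (Complex.differentiable_one_div_Gamma.comp differentiable_fst)).mul
      (Complex.differentiable_one_div_Gamma.comp (differentiable_fst.comp differentiable_snd))
  exact (RapidFamily.of_differentiable hfactor).mul
    ((rapidFamily_zpow_mul_etaGamma ha).comp (by fun_prop) (mapsTo_univ _ univ))
    fun _ => (zero_add _).symm

theorem rapidFamily_singleTermReg {a : ℂ} (ha : ‖a‖ = 2) :
    RapidFamily univ id (singleTermReg a) :=
  (rapidFamily_singleNum ha).mul
    (rapidFamily_gammaInvDiv.comp (by fun_prop) (mapsTo_univ _ univ)) fun _ => rfl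

theorem rapidFamily_singleTerm {a : ℂ} (ha : ‖a‖ = 2) : RapidFamily D₁ id (singleTerm a) := by
  have hinv : RapidFamily D₁ 0 fun (n : ℕ) p => (p.1 + p.2.1 + n - 1)⁻¹ :=
    rapidFamily_inv_add_natCast_sub_one.comp (σ := fun p : ℂ × ℂ × ℂ => p.1 + p.2.1)
      (by fun_prop) fun _ hp => hp
  exact ((rapidFamily_singleNum ha).mono (subset_univ D₁)).mul hinv fun _ => rfl

theorem singleTermReg_eq (a : ℂ) (n : ℕ) {p : ℂ × ℂ × ℂ} (hp : p ∈ D₁) :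
    singleTermReg a n p = (Complex.Gamma (p.1 + p.2.1 - 1))⁻¹ * singleTerm a n p := by
  have hne : p.1 + p.2.1 + n - 1 ≠ 0 := add_natCast_sub_one_ne_zero hp n
  rw [← sub_add_eq_add_sub] at hne
  rw [singleTermReg, singleTerm, gammaInvDiv_eq hne, sub_add_eq_add_sub]
  ring

theorem ne_zero_of_mem_regularPoints {s t u : ℂ} (h : (s, t, u) ∈ regularPoints) :
    s ≠ 0 ∧ t ≠ 0 ∧ u ≠ 0 := by
  simpa only [Nat.cast_zero, neg_zero] using h 0

theorem G_mul_triple (a b c : ℂ) (i : ℕ × ℕ × ℕ) {s t u : ℂ} (h : (s, t, u) ∈ regularPoints) :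
    G s t u * triple (eta a) (eta b) (eta c) s t u i = tripleTerm a b c i (s, t, u) := by
  obtain ⟨hs, ht, hu⟩ := ne_zero_of_mem_regularPoints h
  simp only [triple, tripleTerm, eta_eq (Or.inr hs), eta_eq (Or.inr ht), eta_eq (Or.inr hu),
    ← etaBase_mul_gamma_inv hs, ← etaBase_mul_gamma_inv ht, ← etaBase_mul_gamma_inv hu, G_eq]
  ring

theorem G_mul_double (a b : ℂ) (i : ℕ × ℕ) {s t u : ℂ} (h : (s, t, u) ∈ regularPoints) :
    G s t u * double (eta a) (eta b) s t u i = doubleTerm a b i (s, t, u) := by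
  obtain ⟨-, ht, hu⟩ := ne_zero_of_mem_regularPoints h
  have hne : s + ((i.1 + i.2 : ℕ) : ℂ) ≠ 0 := fun h₀ =>
    (h (i.1 + i.2)).1 (eq_neg_of_add_eq_zero_left h₀)
  simp only [double, doubleTerm, eta_eq (Or.inr ht), eta_eq (Or.inr hu), gammaInvDiv_eq hne,
    ← etaBase_mul_gamma_inv ht, ← etaBase_mul_gamma_inv hu, G_eq, Complex.cpow_neg,
    div_eq_mul_inv, mul_inv, Nat.cast_add, ← add_assoc]
  ring

theorem G_mul_single (a : ℂ) (n : ℕ) {s t u : ℂ} (h : (s, t, u) ∈ regularPoints) :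
    G s t u * single (eta a) s t u n = singleTerm a n (s, t, u) := by
  obtain ⟨-, -, hu⟩ := ne_zero_of_mem_regularPoints h
  simp only [single, singleTerm, singleNum, eta_eq (Or.inr hu), ← etaBase_mul_gamma_inv hu, G_eq]
  ring

end Terms

theorem hasSum_choose_mul_pow (w : ℂ) {x : ℂ} (hx : ‖x‖ < 1) :
    HasSum (fun k : ℕ => Ring.choose (w + k - 1) k * x ^ k) (1 / (1 - x) ^ w) := by
  have hx' : x ∈ Metric.eball (0 : ℂ) 1 := by
    rwa [Metric.mem_eball, edist_zero_right, ← ofReal_norm, ENNReal.ofReal_lt_one]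
  have h := (Complex.one_div_one_sub_cpow_hasFPowerSeriesOnBall_zero w).hasSum hx'
  simpa [FormalMultilinearSeries.ofScalars_apply_eq, mul_comm] using h

theorem hasSum_one_div_natCast_add_one_cpow {v : ℂ} (hv : 1 < v.re) :
    HasSum (fun n : ℕ => 1 / ((n : ℂ) + 1) ^ v) (riemannZeta v) := by
  rw [zeta_eq_tsum_one_div_nat_add_one_cpow hv]
  have h := (summable_nat_add_iff 1).2 (Complex.summable_one_div_nat_cpow.2 hv)
  exact Summable.hasSum (by simpa only [Nat.cast_add, Nat.cast_one] using h)

theorem norm_div_natCast_add_one (y : ℝ) (n : ℕ) : ‖(y : ℂ) / (n + 1)‖ = |y| / (n + 1) := by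
  rw [norm_div, Complex.norm_real, Real.norm_eq_abs]
  congr 1
  exact_mod_cast Complex.norm_natCast (n + 1)

theorem abs_div_natCast_add_one_le (y : ℝ) (n : ℕ) : |y| / (n + 1) ≤ |y| :=
  div_le_self (abs_nonneg y) (le_add_of_nonneg_left n.cast_nonneg)

section HurwitzExpansion

variable {w : ℂ} {y : ℝ}

theorem hasSum_one_div_cpow_mul_choose (w : ℂ) (hy : |y| < 1) (n : ℕ) :
    HasSum (fun k : ℕ => 1 / ((n : ℂ) + 1) ^ w *
        (Ring.choose (w + k - 1) k * ((y : ℂ) / (n + 1)) ^ k))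
      (1 / ((n : ℂ) + 1 - y) ^ w) := by
  have hle : ‖(y : ℂ) / (n + 1)‖ ≤ |y| :=
    (norm_div_natCast_add_one y n).trans_le (abs_div_natCast_add_one_le y n)
  have hfactor : (n : ℂ) + 1 - y = ((n + 1 : ℝ) : ℂ) * ((1 - y / (n + 1) : ℝ) : ℂ) := by
    have hn : (n : ℂ) + 1 ≠ 0 := n.cast_add_one_ne_zero
    push_cast
    field_simp
  have hnonneg : 0 ≤ 1 - y / ((n : ℝ) + 1) := by
    have h : y / ((n : ℝ) + 1) ≤ |y| / (n + 1) := by gcongr; exact le_abs_self y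
    linarith [abs_div_natCast_add_one_le y n]
  have h := (hasSum_choose_mul_pow w (hle.trans_lt hy)).mul_left (1 / ((n : ℂ) + 1) ^ w)
  rw [one_div_mul_one_div] at h
  rw [hfactor, Complex.mul_cpow_ofReal_nonneg (by positivity) hnonneg]
  push_cast
  exact h

theorem summable_one_div_cpow_mul_choose (hw : 1 < w.re) (hy : |y| < 1) :
    Summable fun i : ℕ × ℕ => 1 / ((i.1 : ℂ) + 1) ^ w *
      (Ring.choose (w + i.2 - 1) i.2 * ((y : ℂ) / (i.1 + 1)) ^ i.2) := by
  have hy' : ‖(y : ℂ)‖ < 1 := by rwa [Complex.norm_real]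
  have hprod := (hasSum_one_div_natCast_add_one_cpow hw).summable.norm.mul_of_nonneg
    (hasSum_choose_mul_pow w hy').summable.norm (fun _ => norm_nonneg _) fun _ => norm_nonneg _
  refine .of_norm_bounded hprod fun i => ?_
  rw [norm_mul, norm_mul (Ring.choose _ _), norm_mul (Ring.choose _ _), norm_pow, norm_pow]
  gcongr
  rw [norm_div_natCast_add_one, Complex.norm_real, Real.norm_eq_abs]
  exact abs_div_natCast_add_one_le y i.1

theorem hasSum_choose_mul_one_div_cpow (hw : 1 < w.re) (y : ℝ) (k : ℕ) :
    HasSum (fun n : ℕ => 1 / ((n : ℂ) + 1) ^ w *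
        (Ring.choose (w + k - 1) k * ((y : ℂ) / (n + 1)) ^ k))
      ((y : ℂ) ^ k * (Ring.choose (w + k - 1) k * riemannZeta (w + k))) := by
  have hk : 1 < (w + k).re := by
    rw [Complex.add_re, Complex.natCast_re]
    exact hw.trans_le (le_add_of_nonneg_right k.cast_nonneg)
  rw [← mul_assoc]
  refine ((hasSum_one_div_natCast_add_one_cpow hk).mul_left _).congr_fun fun n => ?_
  rw [Complex.cpow_add _ _ n.cast_add_one_ne_zero, Complex.cpow_natCast, div_pow]
  simp only [div_eq_mul_inv, mul_inv]
  ring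

/-- Expand `(n - y)^{s-1} = n^{s-1} (1 - y/n)^{s-1}` binomially and sum over `n` first. -/
theorem hasSum_one_div_natCast_add_sub_cpow {s : ℂ} (hs : s.re < 0) (hy : |y| < 1) :
    HasSum (fun n : ℕ => 1 / ((n : ℂ) + 1 - y) ^ (1 - s))
      (∑' k, (y : ℂ) ^ k * etaBase k s) := by
  have hw : 1 < (1 - s).re := by
    rw [Complex.sub_re, Complex.one_re]
    linarith
  have hsum := summable_one_div_cpow_mul_choose hw hy
  have hcol : ∀ k : ℕ, HasSum (fun n : ℕ => 1 / ((n : ℂ) + 1) ^ (1 - s) *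
      (Ring.choose (1 - s + k - 1) k * ((y : ℂ) / (n + 1)) ^ k))
      ((y : ℂ) ^ k * etaBase k s) := fun k => by
    have hsk : s ≠ k := by
      rintro rfl
      exact hs.not_ge (by rw [Complex.natCast_re]; exact k.cast_nonneg)
    have hval : Ring.choose (1 - s + k - 1) k * riemannZeta (1 - s + k) = etaBase k s := by
      rw [← choose_mul_zeta_eq_etaBase hsk, show 1 - s + k = k + 1 - s by ring,
        show (k : ℂ) + 1 - s - 1 = k - s by ring]
    exact hval ▸ hasSum_choose_mul_one_div_cpow hw y k
  have hswap := ((Equiv.prodComm ℕ ℕ).hasSum_iff.2 hsum.hasSum).prod_fiberwise hcol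
  rw [hswap.tsum_eq]
  exact hsum.hasSum.prod_fiberwise (hasSum_one_div_cpow_mul_choose (1 - s) hy)

end HurwitzExpansion

theorem exists_bound_pow_mul_etaGamma {y : ℂ} (hy : ‖y‖ < 1) (R : ℝ) :
    ∃ b : ℕ → ℝ, Summable b ∧ ∀ k : ℕ, ∀ s : ℂ, ‖s‖ ≤ R → ‖y ^ k * etaGamma k s‖ ≤ b k := by
  have hρ : 1 < 2 / (1 + ‖y‖) := by rw [lt_div_iff₀ (by positivity)]; linarith
  obtain ⟨C, -, hC⟩ := exists_bound_etaGamma R hρ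
  have hratio : 2 / (1 + ‖y‖) * ‖y‖ < 1 := by
    rw [div_mul_eq_mul_div, div_lt_one (by positivity)]
    linarith
  refine ⟨fun k => C * (2 / (1 + ‖y‖) * ‖y‖) ^ k,
    (summable_geometric_of_lt_one (by positivity) hratio).mul_left C, fun k s hs => ?_⟩
  calc ‖y ^ k * etaGamma k s‖ = ‖y‖ ^ k * ‖etaGamma k s‖ := by rw [norm_mul, norm_pow]
    _ ≤ ‖y‖ ^ k * (C * (2 / (1 + ‖y‖)) ^ k) := by gcongr; exact hC k s hs
    _ = C * (2 / (1 + ‖y‖) * ‖y‖) ^ k := by rw [mul_pow]; ring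

theorem differentiable_tsum_pow_mul_etaGamma {y : ℂ} (hy : ‖y‖ < 1) :
    Differentiable ℂ fun s => ∑' k, y ^ k * etaGamma k s := by
  rw [← differentiableOn_univ]
  refine differentiableOn_tsum_of_locally_bounded isOpen_univ
    (fun k => ((differentiable_etaGamma k).const_mul _).differentiableOn) fun s _ => ?_
  obtain ⟨b, hb, hle⟩ := exists_bound_pow_mul_etaGamma hy (‖s‖ + 1)
  refine ⟨b, hb, ?_⟩
  filter_upwards [continuous_norm.continuousAt.eventually (gt_mem_nhds (lt_add_one ‖s‖))]
    with q hq k using hle k q hq.le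

theorem eq_of_forall_re_neg {f g : ℂ → ℂ} (hf : ∀ s ≠ 0, DifferentiableAt ℂ f s)
    (hg : ∀ s ≠ 0, DifferentiableAt ℂ g s) (h : ∀ s : ℂ, s.re < 0 → f s = g s) {s : ℂ}
    (hs : s ≠ 0) : f s = g s := by
  have hD : LineCocountable {s : ℂ | s ≠ 0} := lineCocountable_ne (ContinuousLinearMap.id ℂ ℂ) 0
  refine hD.eqOn isOpen_ne (fun s hs => (hf s hs).differentiableWithinAt)
    (fun s hs => (hg s hs).differentiableWithinAt) (q := -1) (by simp) ?_ hs
  filter_upwards [(isOpen_lt Complex.continuous_re continuous_const).mem_nhds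
    (show (-1 : ℂ).re < 0 by simp)] with z hz using h z hz

theorem differentiableAt_gamma_inv_mul_hurwitzZeta (a : UnitAddCircle) {s : ℂ} (hs : s ≠ 0) :
    DifferentiableAt ℂ (fun s => (Complex.Gamma s)⁻¹ * HurwitzZeta.hurwitzZeta a (1 - s)) s :=
  (Complex.differentiable_one_div_Gamma s).mul <| DifferentiableAt.comp (f := fun s : ℂ => 1 - s) s
    (HurwitzZeta.differentiableAt_hurwitzZeta a (by simpa using hs)) (by fun_prop)

theorem hasSum_hurwitzZeta_one_sub {s : ℂ} (hs : s.re < 0) {x : ℝ} (hx : x ∈ Icc (0 : ℝ) 1) :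
    HasSum (fun n : ℕ => 1 / ((n : ℂ) + x) ^ (1 - s)) (HurwitzZeta.hurwitzZeta x (1 - s)) :=
  HurwitzZeta.hasSum_hurwitzZeta_of_one_lt_re hx (by rw [Complex.sub_re, Complex.one_re]; linarith)

theorem gamma_inv_mul_tsum_pow_mul_etaBase {s : ℂ} (hs : s.re < 0) (y : ℂ) :
    (Complex.Gamma s)⁻¹ * ∑' k, y ^ k * etaBase k s = ∑' k, y ^ k * etaGamma k s := by
  have hs₀ : s ≠ 0 := fun h => hs.ne (by rw [h, Complex.zero_re])
  rw [← tsum_mul_left]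
  refine tsum_congr fun k => ?_
  rw [← etaBase_mul_gamma_inv hs₀]
  ring

theorem gamma_inv_mul_hurwitzZeta_neg {s : ℂ} (hs : s ≠ 0) {y : ℝ} (hy₀ : 0 ≤ y) (hy₁ : y < 1) :
    (Complex.Gamma s)⁻¹ * HurwitzZeta.hurwitzZeta (-y : ℝ) (1 - s)
      = ∑' k, (y : ℂ) ^ k * etaGamma k s := by
  have hy : |y| < 1 := by rwa [abs_of_nonneg hy₀]
  refine eq_of_forall_re_neg (fun s hs => differentiableAt_gamma_inv_mul_hurwitzZeta _ hs)
    (fun s _ => differentiable_tsum_pow_mul_etaGamma (by simpa using hy) s) (fun s hs => ?_) hs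
  have hper : ((-y : ℝ) : UnitAddCircle) = ((1 - y : ℝ) : UnitAddCircle) := by
    rw [sub_eq_add_neg, AddCircle.coe_add, AddCircle.coe_period, zero_add]
  have hζ := hasSum_hurwitzZeta_one_sub hs (x := 1 - y) ⟨by linarith, by linarith⟩
  simp only [Complex.ofReal_sub, Complex.ofReal_one, ← add_sub_assoc] at hζ
  rw [hper, hζ.unique (hasSum_one_div_natCast_add_sub_cpow hs hy),
    gamma_inv_mul_tsum_pow_mul_etaBase hs]

theorem gamma_inv_mul_hurwitzZeta {s : ℂ} (hs : s ≠ 0) {x : ℝ} (hx₀ : 0 < x) (hx₁ : x < 1) :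
    (Complex.Gamma s)⁻¹ * HurwitzZeta.hurwitzZeta x (1 - s)
      = (x : ℂ) ^ (s - 1) * (Complex.Gamma s)⁻¹ + ∑' k, (-x : ℂ) ^ k * etaGamma k s := by
  have hx : |(-x)| < 1 := by rwa [abs_neg, abs_of_pos hx₀]
  have hxc : (x : ℂ) ≠ 0 := by exact_mod_cast hx₀.ne'
  have hpow : Differentiable ℂ fun s : ℂ => (x : ℂ) ^ (s - 1) * (Complex.Gamma s)⁻¹ :=
    (Differentiable.const_cpow (by fun_prop) (Or.inl hxc)).mul Complex.differentiable_one_div_Gamma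
  refine eq_of_forall_re_neg (fun s hs => differentiableAt_gamma_inv_mul_hurwitzZeta _ hs)
    (g := fun s => (x : ℂ) ^ (s - 1) * (Complex.Gamma s)⁻¹ + ∑' k, (-x : ℂ) ^ k * etaGamma k s)
    (fun s _ => (hpow.add (differentiable_tsum_pow_mul_etaGamma (y := -x) (by simpa using hx))) s)
    (fun s hs => ?_) hs
  have htail := hasSum_one_div_natCast_add_sub_cpow hs hx
  simp only [Complex.ofReal_neg, sub_neg_eq_add] at htail
  have hζ := hasSum_hurwitzZeta_one_sub hs ⟨hx₀.le, hx₁.le⟩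
  have hhead : HurwitzZeta.hurwitzZeta x (1 - s)
      = (x : ℂ) ^ (s - 1) + ∑' k, (-x : ℂ) ^ k * etaBase k s := by
    rw [← hζ.tsum_eq, hζ.summable.tsum_eq_zero_add, ← htail.tsum_eq, ← neg_sub 1 s,
      Complex.cpow_neg, Nat.cast_zero, zero_add, one_div]
    simp only [Nat.cast_add, Nat.cast_one]
  rw [hhead, mul_add, gamma_inv_mul_tsum_pow_mul_etaBase hs, mul_comm]

section TornheimSeries

theorem rpow_neg_add_le {m n : ℝ} (c : ℝ) (hn : 0 ≤ n) (hm : 0 < m) (hnm : n ≤ m) :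
    (m + n) ^ (-c) ≤ 2 ^ |c| * m ^ (-c) := by
  rcases le_or_gt 0 c with hc | hc
  · calc (m + n) ^ (-c) ≤ m ^ (-c) :=
          Real.rpow_le_rpow_of_nonpos hm (by linarith) (by linarith)
      _ ≤ 2 ^ |c| * m ^ (-c) := le_mul_of_one_le_left (by positivity)
          (Real.one_le_rpow one_le_two (abs_nonneg c))
  · rw [abs_of_neg hc, ← Real.mul_rpow zero_le_two hm.le]
    exact Real.rpow_le_rpow (by positivity) (by linarith) (by linarith)

/-- On `n ≤ m` the sum `m + n` is comparable to `m`, and `(m / n) ^ δ ≥ 1` shifts surplus decay in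
`m` to `n`. -/
theorem exists_rpow_mul_rpow_add_le {a b c : ℝ} (hac : 1 < a + c) (habc : 2 < a + b + c) :
    ∃ K x y : ℝ, 0 ≤ K ∧ 1 < x ∧ 1 < y ∧ ∀ m n : ℝ, 0 < n → n ≤ m →
      m ^ (-a) * n ^ (-b) * (m + n) ^ (-c) ≤ K * (m ^ (-x) * n ^ (-y)) := by
  obtain ⟨δ, hδ, hδac⟩ : ∃ δ, max 0 (1 - b) < δ ∧ δ < a + c - 1 :=
    exists_between (max_lt (by linarith) (by linarith))
  obtain ⟨hδ₀, hδb⟩ := max_lt_iff.1 hδ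
  refine ⟨2 ^ |c|, a + c - δ, b + δ, by positivity, by linarith, by linarith, fun m n hn hnm => ?_⟩
  have hm : 0 < m := hn.trans_le hnm
  have hsum := rpow_neg_add_le c hn.le hm hnm
  have hδmn : n ^ δ ≤ m ^ δ := Real.rpow_le_rpow hn.le hnm hδ₀.le
  have hsplit : n ^ (-b) = n ^ (-(b + δ)) * n ^ δ := by rw [← Real.rpow_add hn]; ring_nf
  have hmerge : m ^ (-a) * m ^ (-c) * m ^ δ = m ^ (-(a + c - δ)) := by
    rw [← Real.rpow_add hm, ← Real.rpow_add hm]; ring_nf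
  calc m ^ (-a) * n ^ (-b) * (m + n) ^ (-c)
      ≤ m ^ (-a) * (n ^ (-(b + δ)) * m ^ δ) * (2 ^ |c| * m ^ (-c)) := by
        rw [hsplit]; gcongr
    _ = 2 ^ |c| * (m ^ (-a) * m ^ (-c) * m ^ δ * n ^ (-(b + δ))) := by ring
    _ = 2 ^ |c| * (m ^ (-(a + c - δ)) * n ^ (-(b + δ))) := by rw [hmerge]

theorem summable_natCast_add_one_rpow_neg {x : ℝ} (hx : 1 < x) :
    Summable fun n : ℕ => ((n : ℝ) + 1) ^ (-x) := by
  have h := (summable_nat_add_iff 1).2 (Real.summable_nat_rpow.2 (by linarith : -x < -1))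
  simpa only [Nat.cast_add, Nat.cast_one] using h

theorem summable_rpow_mul_rpow_mul_rpow_add {a b c : ℝ} (hac : 1 < a + c) (hbc : 1 < b + c)
    (habc : 2 < a + b + c) : Summable fun i : ℕ × ℕ =>
      ((i.1 : ℝ) + 1) ^ (-a) * ((i.2 : ℝ) + 1) ^ (-b)
        * (((i.1 : ℝ) + 1) + ((i.2 : ℝ) + 1)) ^ (-c) := by
  have hprod : ∀ K x y : ℝ, 1 < x → 1 < y → Summable fun i : ℕ × ℕ =>
      K * (((i.1 : ℝ) + 1) ^ (-x) * ((i.2 : ℝ) + 1) ^ (-y)) := fun K x y hx hy =>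
    ((summable_natCast_add_one_rpow_neg hx).mul_of_nonneg (summable_natCast_add_one_rpow_neg hy)
      (fun _ => by positivity) fun _ => by positivity).mul_left K
  obtain ⟨K, x, y, hK, hx, hy, hle⟩ := exists_rpow_mul_rpow_add_le hac habc
  obtain ⟨K', x', y', hK', hx', hy', hle'⟩ :=
    exists_rpow_mul_rpow_add_le (a := b) (b := a) hbc (by linarith)
  refine .of_nonneg_of_le (fun _ => by positivity) (fun i => ?_)
    ((hprod K x y hx hy).add (hprod K' y' x' hy' hx'))
  rcases le_total ((i.2 : ℝ) + 1) ((i.1 : ℝ) + 1) with h | h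
  · exact (hle _ _ (by positivity) h).trans (le_add_of_nonneg_right (by positivity))
  · have hswap := hle' _ _ (by positivity) h
    rw [add_comm ((i.2 : ℝ) + 1), mul_comm (((i.2 : ℝ) + 1) ^ (-b)),
      mul_comm (((i.2 : ℝ) + 1) ^ (-x'))] at hswap
    exact hswap.trans (le_add_of_nonneg_left (by positivity))

theorem seriesTerm_eq (s t u : ℂ) (i : ℕ × ℕ) : seriesTerm s t u i =
    ((i.1 + 1 : ℕ) : ℂ) ^ (-s) * ((i.2 + 1 : ℕ) : ℂ) ^ (-t)
      * (((i.1 + 1) + (i.2 + 1) : ℕ) : ℂ) ^ (-u) := by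
  simp only [seriesTerm, Complex.cpow_neg, one_div, mul_inv]

theorem norm_seriesTerm (s t u : ℂ) (i : ℕ × ℕ) : ‖seriesTerm s t u i‖ =
    ((i.1 : ℝ) + 1) ^ (-s.re) * ((i.2 : ℝ) + 1) ^ (-t.re)
        * (((i.1 : ℝ) + 1) + ((i.2 : ℝ) + 1)) ^ (-u.re) := by
  rw [seriesTerm_eq, norm_mul, norm_mul, Complex.norm_natCast_cpow_of_pos (by omega),
    Complex.norm_natCast_cpow_of_pos (by omega), Complex.norm_natCast_cpow_of_pos (by omega)]
  push_cast
  rfl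

/-- The sum of the Tornheim series. -/
def seriesSum (p : ℂ × ℂ × ℂ) : ℂ := ∑' i, seriesTerm p.1 p.2.1 p.2.2 i

theorem mem_convergenceRegion {p : ℂ × ℂ × ℂ} : p ∈ convergenceRegion ↔
    1 < p.1.re + p.2.2.re ∧ 1 < p.2.1.re + p.2.2.re ∧ 2 < p.1.re + p.2.1.re + p.2.2.re :=
  Iff.rfl

theorem hasSum_seriesTerm {p : ℂ × ℂ × ℂ} (hp : p ∈ convergenceRegion) :
    HasSum (seriesTerm p.1 p.2.1 p.2.2) (seriesSum p) := by
  obtain ⟨hsu, htu, hstu⟩ := mem_convergenceRegion.1 hp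
  refine (Summable.of_norm ?_).hasSum
  simpa only [norm_seriesTerm] using summable_rpow_mul_rpow_mul_rpow_add hsu htu hstu

theorem isOpen_convergenceRegion : IsOpen convergenceRegion :=
  have hhalf : ∀ (f : ℂ × ℂ × ℂ → ℂ) (r : ℝ), Continuous f → IsOpen {p | r < (f p).re} :=
    fun _ _ hf => isOpen_lt continuous_const (Complex.continuous_re.comp hf)
  (hhalf (fun p => p.1 + p.2.2) 1 (by fun_prop)).inter
    ((hhalf (fun p => p.2.1 + p.2.2) 1 (by fun_prop)).inter
      (hhalf (fun p => p.1 + p.2.1 + p.2.2) 2 (by fun_prop)))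

theorem convex_convergenceRegion : Convex ℝ convergenceRegion := by
  have hhalf : ∀ (ℓ : ℂ × ℂ × ℂ →ₗ[ℝ] ℂ) (r : ℝ), Convex ℝ {p | r < (ℓ p).re} := fun ℓ r =>
    convex_halfSpace_gt (Complex.reLm.comp ℓ).isLinear r
  let s : ℂ × ℂ × ℂ →ₗ[ℝ] ℂ := .fst ℝ ℂ (ℂ × ℂ)
  let t : ℂ × ℂ × ℂ →ₗ[ℝ] ℂ := .comp (.fst ℝ ℂ ℂ) (.snd ℝ ℂ (ℂ × ℂ))
  let u : ℂ × ℂ × ℂ →ₗ[ℝ] ℂ := .comp (.snd ℝ ℂ ℂ) (.snd ℝ ℂ (ℂ × ℂ))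
  exact (hhalf (s + u) 1).inter ((hhalf (t + u) 1).inter (hhalf (s + t + u) 2))

theorem exists_summable_bound_seriesTerm {p : ℂ × ℂ × ℂ} (hp : p ∈ convergenceRegion) :
    ∃ b : ℕ × ℕ → ℝ, Summable b ∧ ∀ᶠ q : ℂ × ℂ × ℂ in 𝓝 p, ∀ i,
      ‖seriesTerm q.1 q.2.1 q.2.2 i‖ ≤ b i := by
  obtain ⟨ε, hshift, hε⟩ : ∃ ε : ℝ, p - (ε : ℂ) • (1, 1, 1) ∈ convergenceRegion ∧ 0 < ε := by
    have hcont : Continuous fun ε : ℝ => p - (ε : ℂ) • ((1, 1, 1) : ℂ × ℂ × ℂ) := by fun_prop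
    have hnear : ∀ᶠ ε : ℝ in 𝓝 0, p - (ε : ℂ) • (1, 1, 1) ∈ convergenceRegion :=
      hcont.continuousAt.eventually_mem (isOpen_convergenceRegion.mem_nhds (by simpa using hp))
    exact ((hnear.filter_mono nhdsWithin_le_nhds).and
      (self_mem_nhdsWithin : ∀ᶠ ε in 𝓝[>] (0 : ℝ), 0 < ε)).exists
  obtain ⟨hsu, htu, hstu⟩ := mem_convergenceRegion.1 hshift
  refine ⟨_, summable_rpow_mul_rpow_mul_rpow_add (a := p.1.re - ε) (b := p.2.1.re - ε)
    (c := p.2.2.re - ε) (by simpa using hsu) (by simpa using htu) (by simpa using hstu), ?_⟩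
  have hlt : ∀ f : ℂ × ℂ × ℂ → ℂ, Continuous f → ∀ᶠ q in 𝓝 p, (f p).re - ε < (f q).re :=
    fun f hf => (Complex.continuous_re.comp hf).continuousAt.eventually
      (lt_mem_nhds (sub_lt_self _ hε))
  filter_upwards [hlt (fun q => q.1) (by fun_prop), hlt (fun q => q.2.1) (by fun_prop),
    hlt (fun q => q.2.2) (by fun_prop)] with q hs ht hu i
  rw [norm_seriesTerm]
  have h₁ : (1 : ℝ) ≤ (i.1 : ℝ) + 1 := le_add_of_nonneg_left i.1.cast_nonneg
  have h₂ : (1 : ℝ) ≤ (i.2 : ℝ) + 1 := le_add_of_nonneg_left i.2.cast_nonneg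
  have h₁₂ : (1 : ℝ) ≤ ((i.1 : ℝ) + 1) + ((i.2 : ℝ) + 1) := by linarith
  gcongr

theorem differentiableOn_seriesSum : DifferentiableOn ℂ seriesSum convergenceRegion := by
  have hcpow : ∀ {n : ℕ} {f : ℂ × ℂ × ℂ → ℂ}, n ≠ 0 → Differentiable ℂ f →
      Differentiable ℂ fun p => (n : ℂ) ^ f p := fun hn hf =>
    hf.const_cpow (Or.inl (Nat.cast_ne_zero.2 hn))
  refine differentiableOn_tsum_of_locally_bounded isOpen_convergenceRegion (fun i => ?_)
    fun p hp => exists_summable_bound_seriesTerm hp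
  simp only [seriesTerm_eq]
  exact (((hcpow (by omega) (by fun_prop)).mul (hcpow (by omega) (by fun_prop))).mul
    (hcpow (by omega) (by fun_prop))).differentiableOn

end TornheimSeries

section PeriodicZeta

/-- The term `e^{2π i (n+1) x} / (n+1)^s` of the periodic zeta function. -/
def perTerm (s : ℂ) (x : ℝ) (n : ℕ) : ℂ :=
  Complex.exp (2 * Real.pi * Complex.I * x * (n + 1 : ℕ)) / ((n + 1 : ℕ) : ℂ) ^ s

/-- The periodic zeta function `∑ e^{2π i m x} / m^s`. It is used for `Re s > 1`, where it agrees
with `HurwitzZeta.expZeta`. -/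
def perZeta (s : ℂ) (x : ℝ) : ℂ := ∑' n, perTerm s x n

theorem norm_perTerm (s : ℂ) (x : ℝ) (n : ℕ) : ‖perTerm s x n‖ = ((n : ℝ) + 1) ^ (-s.re) := by
  have h : 2 * Real.pi * Complex.I * x * (n + 1 : ℕ)
      = ((2 * Real.pi * x * (n + 1 : ℕ) : ℝ) : ℂ) * Complex.I := by
    push_cast
    ring
  rw [perTerm, norm_div, h, Complex.norm_exp_ofReal_mul_I,
    Complex.norm_natCast_cpow_of_pos n.succ_pos, Real.rpow_neg (by positivity), one_div]
  push_cast
  rfl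

theorem summable_norm_perTerm {s : ℂ} (hs : 1 < s.re) (x : ℝ) :
    Summable fun n => ‖perTerm s x n‖ := by
  simpa only [norm_perTerm] using summable_natCast_add_one_rpow_neg hs

theorem continuous_perTerm (s : ℂ) (n : ℕ) : Continuous fun x => perTerm s x n := by
  unfold perTerm
  fun_prop

theorem continuous_perZeta {s : ℂ} (hs : 1 < s.re) : Continuous (perZeta s) :=
  continuous_tsum (continuous_perTerm s) (summable_natCast_add_one_rpow_neg hs)
    fun n x => (norm_perTerm s x n).le

theorem expZeta_eq_perZeta {s : ℂ} (hs : 1 < s.re) (x : ℝ) :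
    HurwitzZeta.expZeta x s = perZeta s x := by
  have h := HurwitzZeta.hasSum_expZeta_of_one_lt_re x hs
  have hs₀ : s ≠ 0 := by
    rintro rfl
    exact absurd hs (by norm_num)
  rw [← h.tsum_eq, h.summable.tsum_eq_zero_add, perZeta, Nat.cast_zero, Complex.zero_cpow hs₀,
    div_zero, zero_add]
  rfl

theorem perZeta_add_one (s : ℂ) (x : ℝ) : perZeta s (x + 1) = perZeta s x := by
  refine tsum_congr fun n => ?_
  have h : 2 * Real.pi * Complex.I * ((x + 1 : ℝ) : ℂ) * (n + 1 : ℕ)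
      = 2 * Real.pi * Complex.I * x * (n + 1 : ℕ)
        + ((n + 1 : ℕ) : ℂ) * (2 * Real.pi * Complex.I) := by
    push_cast
    ring
  rw [perTerm, perTerm, h, Complex.exp_add, Complex.exp_nat_mul_two_pi_mul_I, mul_one]

theorem integral_exp_two_pi_mul_I_mul_intCast (N : ℤ) :
    ∫ x in (0 : ℝ)..1, Complex.exp (2 * Real.pi * Complex.I * N * x) = if N = 0 then 1 else 0 := by
  split_ifs with h
  · simp [h]
  · have hc : 2 * Real.pi * Complex.I * N ≠ 0 :=
      mul_ne_zero Complex.two_pi_I_ne_zero (Int.cast_ne_zero.2 h)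
    rw [integral_exp_mul_complex hc, Complex.ofReal_one, mul_one, Complex.ofReal_zero, mul_zero,
      mul_comm, Complex.exp_int_mul_two_pi_mul_I, Complex.exp_zero, sub_self, zero_div]

variable {s t u : ℂ}

theorem perTerm_mul_mul (s t u : ℂ) (a b c : ℤ) (i : ℕ × ℕ × ℕ) (x : ℝ) :
    perTerm s (a * x) i.1 * (perTerm t (b * x) i.2.1 * perTerm u (c * x) i.2.2) =
      1 / (((i.1 + 1 : ℕ) : ℂ) ^ s * ((i.2.1 + 1 : ℕ) : ℂ) ^ t * ((i.2.2 + 1 : ℕ) : ℂ) ^ u)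
        * Complex.exp (2 * Real.pi * Complex.I
          * ((a * (i.1 + 1) + b * (i.2.1 + 1) + c * (i.2.2 + 1) : ℤ) : ℂ) * x) := by
  have hexp : 2 * Real.pi * Complex.I
        * ((a * (i.1 + 1) + b * (i.2.1 + 1) + c * (i.2.2 + 1) : ℤ) : ℂ) * x =
      2 * Real.pi * Complex.I * ((a * x : ℝ) : ℂ) * (i.1 + 1 : ℕ) +
      (2 * Real.pi * Complex.I * ((b * x : ℝ) : ℂ) * (i.2.1 + 1 : ℕ) +
      2 * Real.pi * Complex.I * ((c * x : ℝ) : ℂ) * (i.2.2 + 1 : ℕ)) := by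
    push_cast
    ring
  simp only [hexp, Complex.exp_add, perTerm, div_eq_mul_inv, mul_inv]
  ring

theorem norm_perTerm_mul_mul (s t u : ℂ) (x y z : ℝ) (i : ℕ × ℕ × ℕ) :
    ‖perTerm s x i.1 * (perTerm t y i.2.1 * perTerm u z i.2.2)‖ =
      ((i.1 : ℝ) + 1) ^ (-s.re) * (((i.2.1 : ℝ) + 1) ^ (-t.re) * ((i.2.2 : ℝ) + 1) ^ (-u.re)) := by
  rw [norm_mul, norm_mul, norm_perTerm, norm_perTerm, norm_perTerm]

theorem summable_norm_perTerm_mul_mul (hs : 1 < s.re) (ht : 1 < t.re) (hu : 1 < u.re)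
    (x y z : ℝ) : Summable fun i : ℕ × ℕ × ℕ =>
      ‖perTerm s x i.1 * (perTerm t y i.2.1 * perTerm u z i.2.2)‖ :=
  Summable.mul_norm (f := perTerm s x)
    (g := fun j : ℕ × ℕ => perTerm t y j.1 * perTerm u z j.2) (summable_norm_perTerm hs x)
    ((summable_norm_perTerm ht y).mul_norm (summable_norm_perTerm hu z))

theorem hasSum_perTerm_mul_mul (hs : 1 < s.re) (ht : 1 < t.re) (hu : 1 < u.re) (x y z : ℝ) :
    HasSum (fun i : ℕ × ℕ × ℕ => perTerm s x i.1 * (perTerm t y i.2.1 * perTerm u z i.2.2))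
      (perZeta s x * perZeta t y * perZeta u z) := by
  have hsum := summable_norm_perTerm_mul_mul hs ht hu x y z
  have heq : perZeta s x * perZeta t y * perZeta u z = ∑' i : ℕ × ℕ × ℕ,
      perTerm s x i.1 * (perTerm t y i.2.1 * perTerm u z i.2.2) := by
    rw [mul_assoc, perZeta, perZeta, perZeta,
      tsum_mul_tsum_of_summable_norm (summable_norm_perTerm ht y) (summable_norm_perTerm hu z),
      tsum_mul_tsum_of_summable_norm (summable_norm_perTerm hs x)
        ((summable_norm_perTerm ht y).mul_norm (summable_norm_perTerm hu z))]
  exact heq ▸ hsum.of_norm.hasSum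

theorem integral_perZeta_mul_mul (hs : 1 < s.re) (ht : 1 < t.re) (hu : 1 < u.re) (a b c : ℤ) :
    ∫ x in (0 : ℝ)..1, perZeta s (a * x) * perZeta t (b * x) * perZeta u (c * x) =
      ∑' i : ℕ × ℕ × ℕ, if a * (i.1 + 1) + b * (i.2.1 + 1) + c * (i.2.2 + 1) = 0 then
        1 / (((i.1 + 1 : ℕ) : ℂ) ^ s * ((i.2.1 + 1 : ℕ) : ℂ) ^ t * ((i.2.2 + 1 : ℕ) : ℂ) ^ u)
      else 0 := by
  have hbound := summable_norm_perTerm_mul_mul hs ht hu 0 0 0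
  simp only [norm_perTerm_mul_mul] at hbound
  have hcont : ∀ i : ℕ × ℕ × ℕ, Continuous fun x : ℝ =>
      perTerm s (a * x) i.1 * (perTerm t (b * x) i.2.1 * perTerm u (c * x) i.2.2) := fun i => by
    simp only [perTerm_mul_mul]
    fun_prop
  have h := intervalIntegral.hasSum_integral_of_dominated_convergence (a := 0) (b := 1)
    (μ := MeasureTheory.volume) _ (fun i => (hcont i).aestronglyMeasurable)
    (fun i => .of_forall fun x _ => (norm_perTerm_mul_mul s t u _ _ _ i).le)
    (.of_forall fun _ _ => hbound) intervalIntegrable_const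
    (.of_forall fun x _ => hasSum_perTerm_mul_mul hs ht hu (a * x) (b * x) (c * x))
  rw [← h.tsum_eq]
  refine tsum_congr fun i => ?_
  simp only [perTerm_mul_mul]
  rw [intervalIntegral.integral_const_mul, integral_exp_two_pi_mul_I_mul_intCast, mul_ite, mul_one,
    mul_zero]

theorem integral_perZeta_eq_zero (hs : 1 < s.re) (ht : 1 < t.re) (hu : 1 < u.re) {ε : ℤ}
    (hε : ε ≠ 0) :
    ∫ x in (0 : ℝ)..1, perZeta s (ε * x) * perZeta t (ε * x) * perZeta u (ε * x) = 0 := by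
  rw [integral_perZeta_mul_mul hs ht hu]
  refine (tsum_congr fun i => if_neg ?_).trans tsum_zero
  rw [← mul_add, ← mul_add]
  exact mul_ne_zero hε (by omega)

theorem integral_perZeta_eq_seriesSum (hs : 1 < s.re) (ht : 1 < t.re) (hu : 1 < u.re) {ε : ℤ}
    (hε : ε ≠ 0) :
    ∫ x in (0 : ℝ)..1, perZeta s (ε * x) * perZeta t (ε * x) * perZeta u ((-ε : ℤ) * x)
      = seriesSum (s, t, u) := by
  rw [integral_perZeta_mul_mul hs ht hu, seriesSum]
  have hinj : Function.Injective fun i : ℕ × ℕ => (i.1, i.2, i.1 + i.2 + 1) := fun i j h => by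
    simp only [Prod.mk.injEq] at h
    exact Prod.ext h.1 h.2.1
  have hiff : ∀ i : ℕ × ℕ × ℕ, ε * ((i.1 : ℤ) + 1) + ε * (i.2.1 + 1) + -ε * (i.2.2 + 1) = 0 ↔
      i.2.2 = i.1 + i.2.1 + 1 := fun i => by
    have h : ε * ((i.1 : ℤ) + 1) + ε * (i.2.1 + 1) + -ε * (i.2.2 + 1)
        = ε * (i.1 + i.2.1 + 1 - i.2.2) := by ring
    rw [h, mul_eq_zero, or_iff_right hε]
    omega
  rw [← hinj.tsum_eq]
  · refine tsum_congr fun i => ?_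
    rw [if_pos ((hiff _).2 rfl), seriesTerm]
    congr 4
    push_cast
    ring
  · intro i hi
    have h : i.2.2 = i.1 + i.2.1 + 1 := (hiff i).1 (ite_ne_right_iff.1 hi).1
    exact ⟨(i.1, i.2.1), by simp [← h]⟩

/-- Of the eight products of signs, the two with equal signs integrate to `0`, and the others pair
up into the three Tornheim series. -/
theorem integral_triple_product (hs : 1 < s.re) (ht : 1 < t.re) (hu : 1 < u.re)
    (a a' b b' c c' : ℂ) :
    ∫ x in (0 : ℝ)..1, (a * perZeta s x + a' * perZeta s (-x)) *
        (b * perZeta t x + b' * perZeta t (-x)) * (c * perZeta u x + c' * perZeta u (-x)) =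
      (a * b * c' + a' * b' * c) * seriesSum (s, t, u)
        + (a * b' * c + a' * b * c') * seriesSum (u, s, t)
        + (a' * b * c + a * b' * c') * seriesSum (t, u, s) := by
  have hsc := continuous_perZeta hs
  have htc := continuous_perZeta ht
  have huc := continuous_perZeta hu
  have zero_pos := integral_perZeta_eq_zero hs ht hu (ε := 1) one_ne_zero
  have zero_neg := integral_perZeta_eq_zero hs ht hu (ε := -1) (by decide)
  have stu_pos := integral_perZeta_eq_seriesSum hs ht hu (ε := 1) one_ne_zero
  have stu_neg := integral_perZeta_eq_seriesSum hs ht hu (ε := -1) (by decide)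
  have ust_pos := integral_perZeta_eq_seriesSum hu hs ht (ε := 1) one_ne_zero
  have ust_neg := integral_perZeta_eq_seriesSum hu hs ht (ε := -1) (by decide)
  have tus_pos := integral_perZeta_eq_seriesSum ht hu hs (ε := 1) one_ne_zero
  have tus_neg := integral_perZeta_eq_seriesSum ht hu hs (ε := -1) (by decide)
  simp only [Int.cast_one, Int.cast_neg, one_mul, neg_mul, neg_neg]
    at zero_pos zero_neg stu_pos stu_neg ust_pos ust_neg tus_pos tus_neg
  have hexpand : ∀ x : ℝ, (a * perZeta s x + a' * perZeta s (-x)) *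
        (b * perZeta t x + b' * perZeta t (-x)) * (c * perZeta u x + c' * perZeta u (-x)) =
      a * b * c * (perZeta s x * perZeta t x * perZeta u x)
      + a' * b' * c' * (perZeta s (-x) * perZeta t (-x) * perZeta u (-x))
      + a * b * c' * (perZeta s x * perZeta t x * perZeta u (-x))
      + a' * b' * c * (perZeta s (-x) * perZeta t (-x) * perZeta u x)
      + a * b' * c * (perZeta u x * perZeta s x * perZeta t (-x))
      + a' * b * c' * (perZeta u (-x) * perZeta s (-x) * perZeta t x)
      + a' * b * c * (perZeta t x * perZeta u x * perZeta s (-x))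
      + a * b' * c' * (perZeta t (-x) * perZeta u (-x) * perZeta s x) := fun x => by ring
  simp only [hexpand]
  repeat rw [intervalIntegral.integral_add]
  · simp only [intervalIntegral.integral_const_mul, zero_pos, zero_neg, stu_pos, stu_neg, ust_pos,
      ust_neg, tus_pos, tus_neg]
    ring
  all_goals exact Continuous.intervalIntegrable (by fun_prop) _ _

end PeriodicZeta

section HurwitzProducts

/-- The function `ζ(1 - s, x) / Γ(s)` for `Re s > 1`, written through Hurwitz's formula. -/
def hurwitzNorm (s : ℂ) (x : ℝ) : ℂ :=
  (2 * Real.pi : ℂ) ^ (-s) * (Complex.exp (-(Real.pi * Complex.I * s / 2)) * perZeta s x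
    + Complex.exp (Real.pi * Complex.I * s / 2) * perZeta s (-x))

variable {s t u : ℂ}

theorem continuous_hurwitzNorm (hs : 1 < s.re) : Continuous (hurwitzNorm s) := by
  have hcont := continuous_perZeta hs
  unfold hurwitzNorm
  fun_prop

theorem hurwitzNorm_add_one (s : ℂ) (x : ℝ) : hurwitzNorm s (x + 1) = hurwitzNorm s x := by
  have h : perZeta s (-(x + 1)) = perZeta s (-x) := by
    rw [← perZeta_add_one s (-(x + 1)), neg_add, neg_add_cancel_right]
  rw [hurwitzNorm, hurwitzNorm, perZeta_add_one, h]

theorem ne_neg_natCast_of_one_lt_re (hs : 1 < s.re) (n : ℕ) : s ≠ -n := fun h => by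
  rw [h, Complex.neg_re, Complex.natCast_re] at hs
  linarith [(n.cast_nonneg : (0 : ℝ) ≤ n)]

theorem ne_zero_of_one_lt_re (hs : 1 < s.re) : s ≠ 0 := by
  simpa only [Nat.cast_zero, neg_zero] using ne_neg_natCast_of_one_lt_re hs 0

theorem hurwitzNorm_eq (hs : 1 < s.re) (x : ℝ) :
    hurwitzNorm s x = (Complex.Gamma s)⁻¹ * HurwitzZeta.hurwitzZeta x (1 - s) := by
  have hs₁ : s ≠ 1 := fun h => hs.ne' (by rw [h, Complex.one_re])
  have hΓ : Complex.Gamma s ≠ 0 := Complex.Gamma_ne_zero (ne_neg_natCast_of_one_lt_re hs)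
  rw [HurwitzZeta.hurwitzZeta_one_sub _ (ne_neg_natCast_of_one_lt_re hs) (Or.inr hs₁),
    ← AddCircle.coe_neg, expZeta_eq_perZeta hs, expZeta_eq_perZeta hs, hurwitzNorm]
  field_simp

theorem e_add (s t : ℂ) : e (s + t) = e s * e t := by
  rw [e, e, e, ← Complex.exp_add]
  congr 1
  ring

/-- The factor of `gNum` that belongs to one variable. -/
def gFactor (s : ℂ) : ℂ := Complex.exp (-(Real.pi * Complex.I * s / 2)) * (2 * Real.pi : ℂ) ^ s

theorem gNum_eq (s t u : ℂ) : gNum (s, t, u) = gFactor s * gFactor t * gFactor u := by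
  have hexp : Complex.exp (-(Real.pi * Complex.I * (s + t + u) / 2)) =
      Complex.exp (-(Real.pi * Complex.I * s / 2)) * Complex.exp (-(Real.pi * Complex.I * t / 2))
        * Complex.exp (-(Real.pi * Complex.I * u / 2)) := by
    rw [← Complex.exp_add, ← Complex.exp_add]
    congr 1
    ring
  simp only [gNum, gFactor, hexp, Complex.cpow_add _ _ complex_two_pi_ne_zero]
  ring

theorem gFactor_mul_hurwitzNorm (s : ℂ) (x : ℝ) :
    gFactor s * hurwitzNorm s x = e s * perZeta s x + perZeta s (-x) := by
  have he : e s = Complex.exp (-(Real.pi * Complex.I * s / 2))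
      * Complex.exp (-(Real.pi * Complex.I * s / 2)) := by
    rw [e, ← Complex.exp_add]
    congr 1
    ring
  have hexp : Complex.exp (-(Real.pi * Complex.I * s / 2))
      * Complex.exp (Real.pi * Complex.I * s / 2) = 1 := by
    rw [← Complex.exp_add, neg_add_cancel, Complex.exp_zero]
  have hpow : (2 * Real.pi : ℂ) ^ s * (2 * Real.pi : ℂ) ^ (-s) = 1 := by
    rw [← Complex.cpow_add _ _ complex_two_pi_ne_zero, add_neg_cancel, Complex.cpow_zero]
  rw [gFactor, hurwitzNorm, he]
  linear_combination (Complex.exp (-(Real.pi * Complex.I * s / 2))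
      * Complex.exp (-(Real.pi * Complex.I * s / 2)) * perZeta s x
      + Complex.exp (-(Real.pi * Complex.I * s / 2)) * Complex.exp (Real.pi * Complex.I * s / 2)
        * perZeta s (-x)) * hpow + perZeta s (-x) * hexp

theorem gNum_mul_integral_same (hs : 1 < s.re) (ht : 1 < t.re) (hu : 1 < u.re) :
    gNum (s, t, u) * ∫ x in (0 : ℝ)..1, hurwitzNorm s x * hurwitzNorm t x * hurwitzNorm u x =
      (e u + e (s + t)) * seriesSum (s, t, u) + (e t + e (u + s)) * seriesSum (u, s, t)
        + (e s + e (t + u)) * seriesSum (t, u, s) := by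
  have hprod : ∀ x, gNum (s, t, u) * (hurwitzNorm s x * hurwitzNorm t x * hurwitzNorm u x) =
      (e s * perZeta s x + 1 * perZeta s (-x)) * (e t * perZeta t x + 1 * perZeta t (-x))
        * (e u * perZeta u x + 1 * perZeta u (-x)) := fun x => by
    simp only [one_mul, ← gFactor_mul_hurwitzNorm, gNum_eq]
    ring
  rw [← intervalIntegral.integral_const_mul]
  simp only [hprod]
  rw [integral_triple_product hs ht hu]
  simp only [e_add]
  ring

theorem gNum_mul_integral_opposite (hs : 1 < s.re) (ht : 1 < t.re) (hu : 1 < u.re) :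
    gNum (s, t, u) * ∫ x in (0 : ℝ)..1, hurwitzNorm s x * hurwitzNorm t x * hurwitzNorm u (-x) =
      (1 + e (s + t + u)) * seriesSum (s, t, u) + (e s + e (u + t)) * seriesSum (u, s, t)
        + (e t + e (u + s)) * seriesSum (t, u, s) := by
  have hprod : ∀ x, gNum (s, t, u) * (hurwitzNorm s x * hurwitzNorm t x * hurwitzNorm u (-x)) =
      (e s * perZeta s x + 1 * perZeta s (-x)) * (e t * perZeta t x + 1 * perZeta t (-x))
        * (1 * perZeta u x + e u * perZeta u (-x)) := fun x => by
    have h := gFactor_mul_hurwitzNorm u (-x)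
    rw [neg_neg, add_comm] at h
    simp only [one_mul, ← gFactor_mul_hurwitzNorm, ← h, gNum_eq]
    ring
  rw [← intervalIntegral.integral_const_mul]
  simp only [hprod]
  rw [integral_triple_product hs ht hu]
  simp only [e_add]
  ring

theorem integral_zero_one_eq_half {f : ℝ → ℂ} (hf : Continuous f) (hp : ∀ x, f (x + 1) = f x) :
    ∫ x in (0 : ℝ)..1, f x = (∫ x in (0 : ℝ)..(1 / 2), f x) + ∫ x in (0 : ℝ)..(1 / 2), f (-x) := by
  rw [← intervalIntegral.integral_add_adjacent_intervals
    (hf.intervalIntegrable (μ := MeasureTheory.volume) 0 (1 / 2)) (hf.intervalIntegrable (1 / 2) 1)]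
  congr 1
  have hrefl : ∀ x, f (-x) = f (1 - x) := fun x => by rw [← hp (-x), neg_add_eq_sub]
  simp only [hrefl]
  rw [intervalIntegral.integral_comp_sub_left]
  norm_num

end HurwitzProducts

section HalfInterval

/-- The power series `∑ c^{-k} binom(k - s, k) ζ(k + 1 - s) / Γ(s) (2x)^k`: for `c = 2` and `c = -2`
it is the part of `hurwitzNorm s` that is analytic at `x = 0`, on either side of that point. -/
def tailSeries (c s : ℂ) (x : ℝ) : ℂ :=
  ∑' k : ℕ, c ^ (-(k : ℤ)) * etaGamma k s * ((2 * x : ℝ) : ℂ) ^ k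

/-- The part `x^{s-1} / Γ(s)` of `hurwitzNorm s` that is singular at `x = 0`. -/
def headTerm (s : ℂ) (x : ℝ) : ℂ := (x : ℂ) ^ (s - 1) * (Complex.Gamma s)⁻¹

theorem hurwitzNorm_neg_eq_tailSeries {s : ℂ} (hs : 1 < s.re) {x : ℝ} (hx₀ : 0 ≤ x) (hx₁ : x < 1) :
    hurwitzNorm s (-x) = tailSeries 2 s x := by
  rw [hurwitzNorm_eq hs, gamma_inv_mul_hurwitzZeta_neg (ne_zero_of_one_lt_re hs) hx₀ hx₁]
  refine tsum_congr fun k => ?_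
  push_cast
  rw [mul_pow, zpow_neg, zpow_natCast]
  field_simp

theorem hurwitzNorm_eq_headTerm_add {s : ℂ} (hs : 1 < s.re) {x : ℝ} (hx₀ : 0 < x) (hx₁ : x < 1) :
    hurwitzNorm s x = headTerm s x + tailSeries (-2) s x := by
  rw [hurwitzNorm_eq hs, gamma_inv_mul_hurwitzZeta (ne_zero_of_one_lt_re hs) hx₀ hx₁, headTerm]
  congr 1
  refine tsum_congr fun k => ?_
  have hneg : (-x : ℂ) = (-2 : ℂ)⁻¹ * (2 * x) := by ring
  push_cast
  rw [hneg, mul_pow, inv_pow, zpow_neg, zpow_natCast]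
  ring

theorem summable_norm_zpow_mul_etaGamma {c : ℂ} (hc : ‖c‖ = 2) (s : ℂ) :
    Summable fun k : ℕ => ‖c ^ (-(k : ℤ)) * etaGamma k s‖ :=
  ((rapidFamily_zpow_mul_etaGamma hc).summable summable_pow_id (mem_univ s)).norm

theorem norm_mul_two_mul_pow_le {x : ℝ} (hx : x ∈ Icc (0 : ℝ) (1 / 2)) (z : ℂ) (k : ℕ) :
    ‖z * ((2 * x : ℝ) : ℂ) ^ k‖ ≤ ‖z‖ := by
  have hx₀ : 0 ≤ 2 * x := by linarith [hx.1]
  rw [norm_mul, norm_pow, Complex.norm_real, Real.norm_of_nonneg hx₀]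
  exact mul_le_of_le_one_right (norm_nonneg _) (pow_le_one₀ hx₀ (by linarith [hx.2]))

theorem continuousOn_tailSeries {c : ℂ} (hc : ‖c‖ = 2) (s : ℂ) :
    ContinuousOn (tailSeries c s) (Icc 0 (1 / 2)) :=
  continuousOn_tsum (fun k => by fun_prop) (summable_norm_zpow_mul_etaGamma hc s)
    fun k _ hx => norm_mul_two_mul_pow_le hx _ k

theorem continuous_headTerm {s : ℂ} (hs : 1 < s.re) : Continuous (headTerm s) :=
  (Complex.continuous_ofReal_cpow_const (by simpa using hs)).mul continuous_const

theorem tsum_mul_pow_mul_tsum_mul_pow {ι ι' : Type*} {c : ι → ℂ} {c' : ι' → ℂ}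
    (hc : Summable fun i => ‖c i‖) (hc' : Summable fun i => ‖c' i‖) (d : ι → ℕ) (d' : ι' → ℕ)
    {x : ℝ} (hx : x ∈ Icc (0 : ℝ) (1 / 2)) :
    (∑' i, c i * ((2 * x : ℝ) : ℂ) ^ d i) * (∑' i, c' i * ((2 * x : ℝ) : ℂ) ^ d' i) =
      ∑' i : ι × ι', c i.1 * c' i.2 * ((2 * x : ℝ) : ℂ) ^ (d i.1 + d' i.2) := by
  rw [tsum_mul_tsum_of_summable_norm
    (.of_nonneg_of_le (fun _ => norm_nonneg _) (fun i => norm_mul_two_mul_pow_le hx _ _) hc)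
    (.of_nonneg_of_le (fun _ => norm_nonneg _) (fun i => norm_mul_two_mul_pow_le hx _ _) hc')]
  refine tsum_congr fun i => ?_
  rw [pow_add]
  ring

theorem tailSeries_mul_tailSeries {a b : ℂ} (ha : ‖a‖ = 2) (hb : ‖b‖ = 2) (s t : ℂ) {x : ℝ}
    (hx : x ∈ Icc (0 : ℝ) (1 / 2)) :
    tailSeries a s x * tailSeries b t x = ∑' i : ℕ × ℕ, (a ^ (-(i.1 : ℤ)) * etaGamma i.1 s) *
      (b ^ (-(i.2 : ℤ)) * etaGamma i.2 t) * ((2 * x : ℝ) : ℂ) ^ (i.1 + i.2) :=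
  tsum_mul_pow_mul_tsum_mul_pow (summable_norm_zpow_mul_etaGamma ha s)
    (summable_norm_zpow_mul_etaGamma hb t) (fun k => k) (fun k => k) hx

theorem norm_cpow_mul_mul_pow_le {α : ℂ} (hα : 0 ≤ α.re) {x : ℝ} (hx : x ∈ Ioc (0 : ℝ) (1 / 2))
    (z : ℂ) (k : ℕ) : ‖(x : ℂ) ^ α * (z * ((2 * x : ℝ) : ℂ) ^ k)‖ ≤ ‖z‖ := by
  have hpow : ‖(x : ℂ) ^ α‖ ≤ 1 := by
    rw [Complex.norm_cpow_eq_rpow_re_of_pos hx.1]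
    exact Real.rpow_le_one hx.1.le (by linarith [hx.2]) hα
  rw [norm_mul]
  exact (mul_le_of_le_one_left (norm_nonneg _) hpow).trans
    (norm_mul_two_mul_pow_le (Ioc_subset_Icc_self hx) z k)

theorem ofReal_half_cpow (α : ℂ) : ((1 / 2 : ℝ) : ℂ) ^ α = 2 ^ (-α) := by
  have harg : Complex.arg 2 ≠ Real.pi := by
    rw [Complex.ofNat_arg]
    exact Real.pi_pos.ne
  rw [one_div, Complex.ofReal_inv, Complex.ofReal_ofNat, Complex.inv_cpow _ _ harg,
    ← Complex.cpow_neg]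

theorem integral_cpow_mul_mul_pow {α : ℂ} (hα : -1 < α.re) (c : ℂ) (k : ℕ) :
    ∫ x in (0 : ℝ)..(1 / 2), (x : ℂ) ^ α * (c * ((2 * x : ℝ) : ℂ) ^ k) =
      c * 2 ^ (-α - 1) / (α + 1 + k) := by
  have hre : -1 < (α + k).re := by
    rw [Complex.add_re, Complex.natCast_re]
    linarith [(k.cast_nonneg : (0 : ℝ) ≤ k)]
  have hne : α + k + 1 ≠ 0 := fun h => by
    have := congrArg Complex.re h
    rw [Complex.add_re, Complex.one_re, Complex.zero_re] at this
    linarith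
  have hmonomial : ∀ x ∈ uIoc (0 : ℝ) (1 / 2),
      (x : ℂ) ^ α * (c * ((2 * x : ℝ) : ℂ) ^ k) = c * 2 ^ k * (x : ℂ) ^ (α + k) := fun x hx => by
    rw [uIoc_of_le (by norm_num)] at hx
    rw [Complex.cpow_add _ _ (by exact_mod_cast hx.1.ne'), Complex.cpow_natCast]
    push_cast
    ring
  have htwo : (2 : ℂ) ^ (-(α + k + 1)) = 2 ^ (-α - 1) * (2 ^ k)⁻¹ := by
    rw [← Complex.cpow_natCast, ← Complex.cpow_neg, ← Complex.cpow_add _ _ two_ne_zero]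
    congr 1
    ring
  rw [intervalIntegral.integral_congr_ae (.of_forall hmonomial),
    intervalIntegral.integral_const_mul, integral_cpow (Or.inl hre), ofReal_half_cpow, htwo,
    Complex.ofReal_zero, Complex.zero_cpow hne, sub_zero, add_right_comm α 1]
  field_simp

theorem integral_cpow_mul_tsum {ι : Type*} [Countable ι] {α : ℂ} (hα : 0 ≤ α.re) {c : ι → ℂ}
    (hc : Summable fun i => ‖c i‖) (d : ι → ℕ) {f : ℝ → ℂ}
    (hf : ∀ x ∈ Ioc (0 : ℝ) (1 / 2), f x = (x : ℂ) ^ α * ∑' i, c i * ((2 * x : ℝ) : ℂ) ^ d i) :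
    ∫ x in (0 : ℝ)..(1 / 2), f x = ∑' i, c i * (2 : ℂ) ^ (-α - 1) / (α + 1 + d i) := by
  have hI : uIoc (0 : ℝ) (1 / 2) = Ioc 0 (1 / 2) := uIoc_of_le (by norm_num)
  have hsum := intervalIntegral.hasSum_integral_of_dominated_convergence (a := 0) (b := 1 / 2)
    (μ := MeasureTheory.volume) (f := f)
    (F := fun i x => (x : ℂ) ^ α * (c i * ((2 * x : ℝ) : ℂ) ^ d i)) (fun i _ => ‖c i‖)
    (fun i => ((Complex.measurable_ofReal.pow_const α).mul (by fun_prop)).aestronglyMeasurable)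
    (fun i => .of_forall fun x hx => norm_cpow_mul_mul_pow_le hα (hI ▸ hx) (c i) (d i))
    (.of_forall fun _ _ => hc) intervalIntegrable_const
    (.of_forall fun x hx => by
      rw [hI] at hx
      rw [hf x hx]
      exact (Summable.of_norm_bounded hc fun i =>
        norm_mul_two_mul_pow_le (Ioc_subset_Icc_self hx) _ _).hasSum.mul_left _)
  rw [← hsum.tsum_eq]
  exact tsum_congr fun i => integral_cpow_mul_mul_pow (by linarith) (c i) (d i)

theorem integral_tailSeries_triple {a b c : ℂ} (ha : ‖a‖ = 2) (hb : ‖b‖ = 2) (hc : ‖c‖ = 2)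
    (s t u : ℂ) :
    ∫ x in (0 : ℝ)..(1 / 2), tailSeries a s x * tailSeries b t x * tailSeries c u x =
      ∑' i : ℕ × ℕ × ℕ, (a ^ (-(i.1 : ℤ)) * etaGamma i.1 s) *
        ((b ^ (-(i.2.1 : ℤ)) * etaGamma i.2.1 t) * (c ^ (-(i.2.2 : ℤ)) * etaGamma i.2.2 u))
        / (2 * (i.1 + i.2.1 + i.2.2 + 1)) := by
  have hs := summable_norm_zpow_mul_etaGamma ha s
  have htu := (summable_norm_zpow_mul_etaGamma hb t).mul_norm (summable_norm_zpow_mul_etaGamma hc u)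
  rw [integral_cpow_mul_tsum (α := 0) le_rfl (hs.mul_norm htu) (fun i => i.1 + (i.2.1 + i.2.2))]
  · refine tsum_congr fun i => ?_
    have hden : (0 + 1 + ((i.1 + (i.2.1 + i.2.2) : ℕ) : ℂ)) = i.1 + i.2.1 + i.2.2 + 1 := by
      push_cast
      ring
    rw [neg_zero, zero_sub, Complex.cpow_neg_one, hden, mul_comm (2 : ℂ), ← div_div]
    ring
  · intro x hx
    have hx' := Ioc_subset_Icc_self hx
    rw [Complex.cpow_zero, one_mul, mul_assoc, tailSeries_mul_tailSeries hb hc t u hx', tailSeries,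
      tsum_mul_pow_mul_tsum_mul_pow hs htu (fun k => k) (fun i => i.1 + i.2) hx']

theorem gNum_mul_integral_double {a b : ℂ} (ha : ‖a‖ = 2) (hb : ‖b‖ = 2) {s : ℂ} (hs : 1 < s.re)
    (t u : ℂ) :
    gNum (s, t, u) * ∫ x in (0 : ℝ)..(1 / 2), headTerm s x * tailSeries a t x * tailSeries b u x =
      ∑' i, doubleTerm a b i (s, t, u) := by
  have htu := (summable_norm_zpow_mul_etaGamma ha t).mul_norm (summable_norm_zpow_mul_etaGamma hb u)
  rw [integral_cpow_mul_tsum (α := s - 1) (by simp only [Complex.sub_re, Complex.one_re]; linarith)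
    (htu.mul_left ‖(Complex.Gamma s)⁻¹‖ |>.congr fun i => (norm_mul _ _).symm)
    (fun i => i.1 + i.2), ← tsum_mul_left]
  · refine tsum_congr fun i => ?_
    have hne : s + ((i.1 + i.2 : ℕ) : ℂ) ≠ 0 := fun h =>
      ne_neg_natCast_of_one_lt_re hs _ (eq_neg_of_add_eq_zero_left h)
    have hexp : -(s - 1) - 1 = -s := by ring
    rw [doubleTerm, gammaInvDiv_eq hne, hexp, sub_add_cancel]
    ring
  · intro x hx
    rw [headTerm, mul_assoc, tailSeries_mul_tailSeries ha hb t u (Ioc_subset_Icc_self hx),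
      mul_assoc, ← tsum_mul_left]
    simp only [mul_assoc]

theorem gNum_mul_integral_single {a : ℂ} (ha : ‖a‖ = 2) {s t : ℂ} (hs : 1 < s.re) (ht : 1 < t.re)
    (u : ℂ) :
    gNum (s, t, u) * ∫ x in (0 : ℝ)..(1 / 2), headTerm s x * headTerm t x * tailSeries a u x =
      ∑' n, singleTerm a n (s, t, u) := by
  have hu := summable_norm_zpow_mul_etaGamma ha u
  rw [integral_cpow_mul_tsum (α := (s - 1) + (t - 1))
    (by simp only [Complex.add_re, Complex.sub_re, Complex.one_re]; linarith)
    (hu.mul_left ‖(Complex.Gamma s)⁻¹ * (Complex.Gamma t)⁻¹‖ |>.congr fun i => (norm_mul _ _).symm)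
    (fun i => i), ← tsum_mul_left]
  · refine tsum_congr fun i => ?_
    have hexp : -(s - 1 + (t - 1)) - 1 = 1 - s - t := by ring
    have hden : s - 1 + (t - 1) + 1 + (i : ℂ) = s + t + i - 1 := by ring
    rw [singleTerm, singleNum, hexp, hden]
    ring
  · intro x hx
    rw [headTerm, headTerm, tailSeries, Complex.cpow_add _ _ (by exact_mod_cast hx.1.ne')]
    simp only [mul_assoc ((Complex.Gamma s)⁻¹ * (Complex.Gamma t)⁻¹), tsum_mul_left]
    ring

theorem gNum_mul_integral_headTerm {s t u : ℂ} (hs : 1 < s.re) (ht : 1 < t.re) (hu : 1 < u.re) :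
    gNum (s, t, u) * ∫ x in (0 : ℝ)..(1 / 2), headTerm s x * headTerm t x * headTerm u x =
      G s t u * ((2 : ℂ) ^ (2 - s - t - u) / (s + t + u - 2)) := by
  have hre : -1 < ((s - 1) + (t - 1) + (u - 1)).re := by
    simp only [Complex.add_re, Complex.sub_re, Complex.one_re]
    linarith
  have hmonomial : ∀ x ∈ uIoc (0 : ℝ) (1 / 2), headTerm s x * headTerm t x * headTerm u x =
      (x : ℂ) ^ ((s - 1) + (t - 1) + (u - 1)) * (((Complex.Gamma s)⁻¹ * (Complex.Gamma t)⁻¹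
        * (Complex.Gamma u)⁻¹) * ((2 * x : ℝ) : ℂ) ^ 0) := fun x hx => by
    rw [uIoc_of_le (by norm_num)] at hx
    have hx₀ : (x : ℂ) ≠ 0 := by exact_mod_cast hx.1.ne'
    rw [headTerm, headTerm, headTerm, Complex.cpow_add _ _ hx₀, Complex.cpow_add _ _ hx₀]
    ring
  have hexp : -(s - 1 + (t - 1) + (u - 1)) - 1 = 2 - s - t - u := by ring
  have hden : s - 1 + (t - 1) + (u - 1) + 1 = s + t + u - 2 := by ring
  rw [intervalIntegral.integral_congr_ae (.of_forall hmonomial), integral_cpow_mul_mul_pow hre,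
    Nat.cast_zero, add_zero, hexp, hden, G_eq]
  ring

end HalfInterval

section Expansions

theorem kappa_eq (l m n : ℕ) : kappa l m n = (1 + (-1) ^ (l + m + n)) / 2 := by
  rw [kappa]
  split_ifs with h
  · rw [h.neg_one_pow]
    norm_num
  · rw [(Nat.not_even_iff_odd.1 h).neg_one_pow]
    norm_num

theorem neg_zpow_neg_natCast (a : ℂ) (k : ℕ) : (-a) ^ (-(k : ℤ)) = (-1) ^ k * a ^ (-(k : ℤ)) := by
  rw [neg_eq_neg_one_mul, mul_zpow, zpow_neg, zpow_natCast, ← inv_pow, inv_neg, inv_one]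

theorem summable_triple_div {a b c : ℂ} (ha : ‖a‖ = 2) (hb : ‖b‖ = 2) (hc : ‖c‖ = 2) (s t u : ℂ) :
    Summable fun i : ℕ × ℕ × ℕ => (a ^ (-(i.1 : ℤ)) * etaGamma i.1 s) *
      ((b ^ (-(i.2.1 : ℤ)) * etaGamma i.2.1 t) * (c ^ (-(i.2.2 : ℤ)) * etaGamma i.2.2 u))
      / (2 * (i.1 + i.2.1 + i.2.2 + 1)) := by
  refine .of_norm_bounded ((summable_norm_zpow_mul_etaGamma ha s).mul_norm
    ((summable_norm_zpow_mul_etaGamma hb t).mul_norm (summable_norm_zpow_mul_etaGamma hc u)))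
    fun i => ?_
  have hden : (2 * (i.1 + i.2.1 + i.2.2 + 1) : ℂ) = ((2 * (i.1 + i.2.1 + i.2.2 + 1) : ℕ) : ℂ) := by
    push_cast
    ring
  rw [norm_div, hden, Complex.norm_natCast]
  exact div_le_self (norm_nonneg _) (by exact_mod_cast (by omega : 1 ≤ 2 * (_ + _ + _ + 1)))

/-- The two half-intervals contribute series that differ by the sign `(-1) ^ (l + m + n)`; this is
where `κ` comes from. -/
theorem gNum_mul_integral_triple {a b c : ℂ} (ha : ‖a‖ = 2) (hb : ‖b‖ = 2) (hc : ‖c‖ = 2)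
    (s t u : ℂ) :
    gNum (s, t, u) *
      ((∫ x in (0 : ℝ)..(1 / 2), tailSeries (-a) s x * tailSeries (-b) t x * tailSeries (-c) u x)
      + ∫ x in (0 : ℝ)..(1 / 2), tailSeries a s x * tailSeries b t x * tailSeries c u x) =
      ∑' i, tripleTerm a b c i (s, t, u) := by
  have hneg : ∀ {z : ℂ}, ‖z‖ = 2 → ‖-z‖ = 2 := fun hz => by rwa [norm_neg]
  rw [integral_tailSeries_triple (hneg ha) (hneg hb) (hneg hc),
    integral_tailSeries_triple ha hb hc,
    ← (summable_triple_div (hneg ha) (hneg hb) (hneg hc) s t u).tsum_add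
      (summable_triple_div ha hb hc s t u), ← tsum_mul_left]
  refine tsum_congr fun i => ?_
  simp only [tripleTerm, kappa_eq, neg_zpow_neg_natCast, pow_add]
  rw [mul_comm (2 : ℂ), ← div_div, ← div_div]
  ring

/-- The expansion of `S₁` without its single series, with `G` multiplied in. -/
def expansion₁Entire (p : ℂ × ℂ × ℂ) : ℂ :=
  ∑' i, tripleTerm 2 2 (-2) i p + ∑' i, doubleTerm (-2) 2 i p
    + ∑' i, doubleTerm (-2) 2 i (p.2.1, p.1, p.2.2) + ∑' i, doubleTerm 2 2 i (p.2.2, p.1, p.2.1)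

/-- The expansion of `S₁`, with `G` multiplied in. -/
def expansion₁ (p : ℂ × ℂ × ℂ) : ℂ := expansion₁Entire p + ∑' n, singleTerm 2 n p

/-- The part of the expansion of `S₂` that involves neither the hyperplanes `s + t = 1 - n` nor
`s + t + u = 2`. -/
def expansion₂Core (p : ℂ × ℂ × ℂ) : ℂ :=
  ∑' i, tripleTerm 2 2 2 i p + ∑' i, doubleTerm (-2) (-2) i (p.2.2, p.1, p.2.1)
    + ∑' i, doubleTerm (-2) (-2) i p + ∑' i, doubleTerm (-2) (-2) i (p.2.1, p.2.2, p.1)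
    + ∑' n, singleTerm (-2) n (p.2.1, p.2.2, p.1) + ∑' n, singleTerm (-2) n (p.2.2, p.1, p.2.1)

/-- The numerator of the polar term of the expansion of `S₂` along `s + t + u = 2`. -/
def polarNum (p : ℂ × ℂ × ℂ) : ℂ := G p.1 p.2.1 p.2.2 * (2 : ℂ) ^ (2 - p.1 - p.2.1 - p.2.2)

/-- The part of the expansion of `S₂` that does not involve the hyperplanes `s + t = 1 - n`. -/
def expansion₂Main (p : ℂ × ℂ × ℂ) : ℂ :=
  polarNum p * (p.1 + p.2.1 + p.2.2 - 2)⁻¹ + expansion₂Core p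

/-- The expansion of `S₂`, with `G` multiplied in. -/
def expansion₂ (p : ℂ × ℂ × ℂ) : ℂ := expansion₂Main p + ∑' n, singleTerm (-2) n p

theorem norm_two : ‖(2 : ℂ)‖ = 2 := RCLike.norm_ofNat 2

theorem norm_neg_two : ‖(-2 : ℂ)‖ = 2 := by rw [norm_neg, norm_two]

theorem gNum_swap₁₂ (s t u : ℂ) : gNum (t, s, u) = gNum (s, t, u) := by
  rw [gNum_eq, gNum_eq, mul_comm (gFactor t)]

theorem gNum_rotate (s t u : ℂ) : gNum (u, s, t) = gNum (s, t, u) := by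
  rw [gNum_eq, gNum_eq, mul_rotate, mul_rotate]

theorem integral_mul_mul_rotate (f g h : ℝ → ℂ) (a b : ℝ) :
    ∫ x in a..b, f x * g x * h x = ∫ x in a..b, h x * f x * g x := by
  simp only [mul_comm, mul_left_comm]

section Expand

variable {f f' g g' h h' : ℝ → ℂ} {a b : ℝ}

theorem integral_add_mul_add_mul (hf : ContinuousOn f (uIcc a b)) (hf' : ContinuousOn f' (uIcc a b))
    (hg : ContinuousOn g (uIcc a b)) (hg' : ContinuousOn g' (uIcc a b))
    (hh : ContinuousOn h (uIcc a b)) :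
    ∫ x in a..b, (f x + f' x) * (g x + g' x) * h x =
      (∫ x in a..b, f x * g x * h x) + (∫ x in a..b, f x * g' x * h x)
        + (∫ x in a..b, f' x * g x * h x) + ∫ x in a..b, f' x * g' x * h x := by
  have hfg := ((hf.fun_mul hg).fun_mul hh).intervalIntegrable (μ := MeasureTheory.volume)
  have hfg' := ((hf.fun_mul hg').fun_mul hh).intervalIntegrable (μ := MeasureTheory.volume)
  have hf'g := ((hf'.fun_mul hg).fun_mul hh).intervalIntegrable (μ := MeasureTheory.volume)
  have hf'g' := ((hf'.fun_mul hg').fun_mul hh).intervalIntegrable (μ := MeasureTheory.volume)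
  rw [← intervalIntegral.integral_add hfg hfg', ← intervalIntegral.integral_add (hfg.add hfg') hf'g,
    ← intervalIntegral.integral_add ((hfg.add hfg').add hf'g) hf'g']
  refine intervalIntegral.integral_congr fun x _ => ?_
  ring

theorem integral_add_mul_add_mul_add (hf : ContinuousOn f (uIcc a b))
    (hf' : ContinuousOn f' (uIcc a b)) (hg : ContinuousOn g (uIcc a b))
    (hg' : ContinuousOn g' (uIcc a b)) (hh : ContinuousOn h (uIcc a b))
    (hh' : ContinuousOn h' (uIcc a b)) :
    ∫ x in a..b, (f x + f' x) * (g x + g' x) * (h x + h' x) =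
      ((∫ x in a..b, f x * g x * h x) + (∫ x in a..b, f x * g' x * h x)
        + (∫ x in a..b, f' x * g x * h x) + ∫ x in a..b, f' x * g' x * h x)
      + ((∫ x in a..b, f x * g x * h' x) + (∫ x in a..b, f x * g' x * h' x)
        + (∫ x in a..b, f' x * g x * h' x) + ∫ x in a..b, f' x * g' x * h' x) := by
  have hprod := (hf.fun_add hf').fun_mul (hg.fun_add hg')
  simp only [mul_add _ (h _)]
  rw [intervalIntegral.integral_add (hprod.fun_mul hh).intervalIntegrable
      (hprod.fun_mul hh').intervalIntegrable, integral_add_mul_add_mul hf hf' hg hg' hh,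
    integral_add_mul_add_mul hf hf' hg hg' hh']

end Expand

theorem continuousOn_tailSeries_uIcc {c : ℂ} (hc : ‖c‖ = 2) (s : ℂ) :
    ContinuousOn (tailSeries c s) (uIcc 0 (1 / 2)) := by
  rw [uIcc_of_le (by norm_num)]
  exact continuousOn_tailSeries hc s

theorem integral_half_congr {f g : ℝ → ℂ} (h : ∀ x, 0 < x → x < 1 → f x = g x) :
    ∫ x in (0 : ℝ)..(1 / 2), f x = ∫ x in (0 : ℝ)..(1 / 2), g x := by
  refine intervalIntegral.integral_congr_ae (.of_forall fun x hx => ?_)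
  rw [uIoc_of_le (by norm_num)] at hx
  exact h x hx.1 (by linarith [hx.2])

variable {s t u : ℂ}

theorem integral_hurwitzNorm_same (hs : 1 < s.re) (ht : 1 < t.re) (hu : 1 < u.re) :
    ∫ x in (0 : ℝ)..1, hurwitzNorm s x * hurwitzNorm t x * hurwitzNorm u x =
      (∫ x in (0 : ℝ)..(1 / 2), (headTerm s x + tailSeries (-2) s x)
        * (headTerm t x + tailSeries (-2) t x) * (headTerm u x + tailSeries (-2) u x))
      + ∫ x in (0 : ℝ)..(1 / 2), tailSeries 2 s x * tailSeries 2 t x * tailSeries 2 u x := by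
  have hcs := continuous_hurwitzNorm hs
  have hct := continuous_hurwitzNorm ht
  have hcu := continuous_hurwitzNorm hu
  rw [integral_zero_one_eq_half ((hcs.fun_mul hct).fun_mul hcu) fun x => by
    simp only [hurwitzNorm_add_one]]
  congr 1 <;> refine integral_half_congr fun x hx₀ hx₁ => ?_
  · simp only [hurwitzNorm_eq_headTerm_add hs hx₀ hx₁,
      hurwitzNorm_eq_headTerm_add ht hx₀ hx₁, hurwitzNorm_eq_headTerm_add hu hx₀ hx₁]
  · simp only [hurwitzNorm_neg_eq_tailSeries hs hx₀.le hx₁,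
      hurwitzNorm_neg_eq_tailSeries ht hx₀.le hx₁, hurwitzNorm_neg_eq_tailSeries hu hx₀.le hx₁]

theorem integral_hurwitzNorm_opposite (hs : 1 < s.re) (ht : 1 < t.re) (hu : 1 < u.re) :
    ∫ x in (0 : ℝ)..1, hurwitzNorm s x * hurwitzNorm t x * hurwitzNorm u (-x) =
      (∫ x in (0 : ℝ)..(1 / 2), (headTerm s x + tailSeries (-2) s x)
        * (headTerm t x + tailSeries (-2) t x) * tailSeries 2 u x)
      + ((∫ x in (0 : ℝ)..(1 / 2), headTerm u x * tailSeries 2 s x * tailSeries 2 t x)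
      + ∫ x in (0 : ℝ)..(1 / 2), tailSeries 2 s x * tailSeries 2 t x * tailSeries (-2) u x) := by
  have hcs := continuous_hurwitzNorm hs
  have hct := continuous_hurwitzNorm ht
  have hcu : Continuous fun x => hurwitzNorm u (-x) :=
    (continuous_hurwitzNorm hu).comp continuous_neg
  have hper : ∀ x, hurwitzNorm u (-(x + 1)) = hurwitzNorm u (-x) := fun x => by
    rw [← hurwitzNorm_add_one u (-(x + 1)), neg_add, neg_add_cancel_right]
  have hS := continuousOn_tailSeries_uIcc norm_two s
  have hT := continuousOn_tailSeries_uIcc norm_two t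
  have hU := continuousOn_tailSeries_uIcc norm_neg_two u
  have hH := (continuous_headTerm hu).continuousOn (s := uIcc 0 (1 / 2))
  rw [integral_zero_one_eq_half ((hcs.fun_mul hct).fun_mul hcu) fun x => by
    simp only [hurwitzNorm_add_one, hper],
    ← intervalIntegral.integral_add ((hH.fun_mul hS).fun_mul hT).intervalIntegrable
      ((hS.fun_mul hT).fun_mul hU).intervalIntegrable]
  congr 1 <;> refine integral_half_congr fun x hx₀ hx₁ => ?_
  · simp only [hurwitzNorm_eq_headTerm_add hs hx₀ hx₁,
      hurwitzNorm_eq_headTerm_add ht hx₀ hx₁, hurwitzNorm_neg_eq_tailSeries hu hx₀.le hx₁]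
  · simp only [neg_neg,
      hurwitzNorm_neg_eq_tailSeries hs hx₀.le hx₁, hurwitzNorm_neg_eq_tailSeries ht hx₀.le hx₁,
      hurwitzNorm_eq_headTerm_add hu hx₀ hx₁]
    ring

theorem gNum_mul_integral_opposite_eq_expansion₁ (hs : 1 < s.re) (ht : 1 < t.re) (hu : 1 < u.re) :
    gNum (s, t, u) * ∫ x in (0 : ℝ)..1, hurwitzNorm s x * hurwitzNorm t x * hurwitzNorm u (-x) =
      expansion₁ (s, t, u) := by
  have hu₀ := gNum_mul_integral_single norm_two hs ht u
  have hs₀ := gNum_mul_integral_double norm_neg_two norm_two hs t u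
  have ht₀ := gNum_mul_integral_double norm_neg_two norm_two ht s u
  have hst := gNum_mul_integral_double norm_two norm_two hu s t
  have htriple := gNum_mul_integral_triple norm_two norm_two norm_neg_two s t u
  rw [gNum_swap₁₂] at ht₀
  rw [gNum_rotate] at hst
  rw [neg_neg] at htriple
  simp only [mul_comm (headTerm t _)] at ht₀
  rw [integral_hurwitzNorm_opposite hs ht hu,
    integral_add_mul_add_mul (continuous_headTerm hs).continuousOn
      (continuousOn_tailSeries_uIcc norm_neg_two s) (continuous_headTerm ht).continuousOn
      (continuousOn_tailSeries_uIcc norm_neg_two t) (continuousOn_tailSeries_uIcc norm_two u),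
    expansion₁, expansion₁Entire]
  linear_combination hu₀ + hs₀ + ht₀ + hst + htriple

theorem gNum_mul_integral_same_eq_expansion₂ (hs : 1 < s.re) (ht : 1 < t.re) (hu : 1 < u.re) :
    gNum (s, t, u) * ∫ x in (0 : ℝ)..1, hurwitzNorm s x * hurwitzNorm t x * hurwitzNorm u x =
      expansion₂ (s, t, u) := by
  have hstu := gNum_mul_integral_headTerm hs ht hu
  have hst := gNum_mul_integral_single norm_neg_two hs ht u
  have htu := gNum_mul_integral_single norm_neg_two ht hu s
  have hus := gNum_mul_integral_single norm_neg_two hu hs t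
  have hs₀ := gNum_mul_integral_double norm_neg_two norm_neg_two hs t u
  have ht₀ := gNum_mul_integral_double norm_neg_two norm_neg_two ht u s
  have hu₀ := gNum_mul_integral_double norm_neg_two norm_neg_two hu s t
  have htriple := gNum_mul_integral_triple norm_two norm_two norm_two s t u
  rw [← gNum_rotate, integral_mul_mul_rotate] at htu ht₀
  rw [gNum_rotate, ← integral_mul_mul_rotate] at hus hu₀
  rw [integral_hurwitzNorm_same hs ht hu,
    integral_add_mul_add_mul_add (continuous_headTerm hs).continuousOn
      (continuousOn_tailSeries_uIcc norm_neg_two s) (continuous_headTerm ht).continuousOn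
      (continuousOn_tailSeries_uIcc norm_neg_two t) (continuous_headTerm hu).continuousOn
      (continuousOn_tailSeries_uIcc norm_neg_two u), expansion₂, expansion₂Main,
    expansion₂Core, polarNum]
  linear_combination hstu + hst + htu + hus + hs₀ + ht₀ + hu₀ + htriple

end Expansions

section Domains

theorem isIntLeOne_iff {z : ℂ} : IsIntLeOne z ↔ ∃ n : ℕ, z = 1 - n := by
  refine ⟨?_, fun ⟨n, hn⟩ => hn ▸ isIntLeOne_one_sub_natCast n⟩
  rintro ⟨n, hn, rfl⟩
  obtain ⟨k, hk⟩ := Int.eq_ofNat_of_zero_le (sub_nonneg.2 hn)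
  refine ⟨k, ?_⟩
  rw [eq_sub_iff_add_eq, ← eq_sub_iff_add_eq']
  exact_mod_cast hk.symm

theorem not_isIntLeOne_of_one_lt_re {z : ℂ} (h : 1 < z.re) : ¬ IsIntLeOne z := by
  rintro ⟨n, hn, rfl⟩
  rw [Complex.intCast_re] at h
  exact absurd (by exact_mod_cast h : (1 : ℤ) < n) hn.not_gt

theorem lineCocountable_not_isIntLeOne {E : Type*} [NormedAddCommGroup E] [NormedSpace ℂ E]
    (ℓ : E →L[ℂ] ℂ) : LineCocountable {p | ¬ IsIntLeOne (ℓ p)} := by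
  have h : {p | ¬ IsIntLeOne (ℓ p)} = ⋂ n : ℕ, {p | ℓ p ≠ 1 - (n : ℂ)} := by
    ext p
    simp [isIntLeOne_iff]
  rw [h]
  exact .iInter fun n => lineCocountable_ne _ _

theorem isOpen_domT : IsOpen domT :=
  (isOpen_setOf_not_isIntLeOne (coordS + coordU).continuous).inter
    ((isOpen_setOf_not_isIntLeOne (coordT + coordU).continuous).inter
      (isOpen_ne_fun (coordS + coordT + coordU).continuous continuous_const))

theorem isOpen_D₂ : IsOpen D₂ :=
  isOpen_D₁.inter ((isOpen_setOf_not_isIntLeOne (coordT + coordU).continuous).inter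
    ((isOpen_setOf_not_isIntLeOne (coordU + coordS).continuous).inter
      (isOpen_ne_fun (coordS + coordT + coordU).continuous continuous_const)))

theorem lineCocountable_domT : LineCocountable domT :=
  (lineCocountable_not_isIntLeOne (coordS + coordU)).inter
    ((lineCocountable_not_isIntLeOne (coordT + coordU)).inter
      (lineCocountable_ne (coordS + coordT + coordU) 2))

theorem lineCocountable_D₂ : LineCocountable D₂ :=
  (lineCocountable_not_isIntLeOne (coordS + coordT)).inter
    ((lineCocountable_not_isIntLeOne (coordT + coordU)).inter
      ((lineCocountable_not_isIntLeOne (coordU + coordS)).inter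
        (lineCocountable_ne (coordS + coordT + coordU) 2)))

theorem mem_D₂_iff {p : ℂ × ℂ × ℂ} : p ∈ D₂ ↔ p ∈ D₁ ∧ p ∈ domT := by
  obtain ⟨s, t, u⟩ := p
  simp only [D₁, D₂, domT, mem_ofPred_eq, add_comm u s]
  tauto

theorem D₂_subset_D₁ : D₂ ⊆ D₁ := fun _ h => (mem_D₂_iff.1 h).1

theorem D₂_subset_domT : D₂ ⊆ domT := fun _ h => (mem_D₂_iff.1 h).2

theorem rotate_mem_D₂ {s t u : ℂ} (h : (s, t, u) ∈ D₂) : (t, u, s) ∈ D₂ :=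
  ⟨h.2.1, h.2.2.1, h.1, fun heq => h.2.2.2 (by rw [← heq]; ring)⟩

theorem convergenceRegion_subset_domT : convergenceRegion ⊆ domT := fun p hp =>
  ⟨not_isIntLeOne_of_one_lt_re hp.1, not_isIntLeOne_of_one_lt_re hp.2.1, fun h => by
    have hre : 2 < (p.1 + p.2.1 + p.2.2).re := hp.2.2
    rw [h, Complex.re_ofNat] at hre
    exact lt_irrefl _ hre⟩

/-- The region in which all three real parts exceed `1`: there the Tornheim series is an integral of
products of Hurwitz zeta functions. -/
def largeRegion : Set (ℂ × ℂ × ℂ) := {p | 1 < p.1.re ∧ 1 < p.2.1.re ∧ 1 < p.2.2.re}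

theorem isOpen_largeRegion : IsOpen largeRegion :=
  (isOpen_lt continuous_const (Complex.continuous_re.comp coordS.continuous)).inter
    ((isOpen_lt continuous_const (Complex.continuous_re.comp coordT.continuous)).inter
      (isOpen_lt continuous_const (Complex.continuous_re.comp coordU.continuous)))

theorem two_mem_largeRegion : ((2, 2, 2) : ℂ × ℂ × ℂ) ∈ largeRegion := by
  have h : 1 < (2 : ℂ).re := by rw [Complex.re_ofNat]; exact one_lt_two
  exact ⟨h, h, h⟩

theorem largeRegion_subset_convergenceRegion : largeRegion ⊆ convergenceRegion := fun _ hp => by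
  rw [mem_convergenceRegion]
  exact ⟨by linarith [hp.1, hp.2.2], by linarith [hp.2.1, hp.2.2],
    by linarith [hp.1, hp.2.1, hp.2.2]⟩

theorem largeRegion_subset_D₂ : largeRegion ⊆ D₂ := fun p hp =>
  mem_D₂_iff.2 ⟨not_isIntLeOne_of_one_lt_re (by
    rw [Complex.add_re]
    linarith [hp.1, hp.2.1]),
      convergenceRegion_subset_domT (largeRegion_subset_convergenceRegion hp)⟩

theorem dense_D₂ : Dense D₂ :=
  lineCocountable_D₂.dense ⟨_, largeRegion_subset_D₂ two_mem_largeRegion⟩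

theorem dense_D₁ : Dense D₁ := dense_D₂.mono D₂_subset_D₁

end Domains

section HolomorphicExpansions

theorem differentiable_rotate : Differentiable ℂ fun p : ℂ × ℂ × ℂ => (p.2.1, p.2.2, p.1) := by
  fun_prop

theorem differentiable_rotate' : Differentiable ℂ fun p : ℂ × ℂ × ℂ => (p.2.2, p.1, p.2.1) := by
  fun_prop

theorem differentiable_swap : Differentiable ℂ fun p : ℂ × ℂ × ℂ => (p.2.1, p.1, p.2.2) := by
  fun_prop

theorem differentiable_tsum_tripleTerm {a b c : ℂ} (ha : ‖a‖ = 2) (hb : ‖b‖ = 2) (hc : ‖c‖ = 2) :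
    Differentiable ℂ fun p => ∑' i, tripleTerm a b c i p :=
  differentiableOn_univ.1
    ((rapidFamily_tripleTerm ha hb hc).differentiableOn_tsum isOpen_univ summable_pow_deg₃)

theorem differentiable_tsum_doubleTerm {a b : ℂ} (ha : ‖a‖ = 2) (hb : ‖b‖ = 2) :
    Differentiable ℂ fun p => ∑' i, doubleTerm a b i p :=
  differentiableOn_univ.1
    ((rapidFamily_doubleTerm ha hb).differentiableOn_tsum isOpen_univ summable_pow_deg₂)

theorem differentiable_tsum_singleTermReg {a : ℂ} (ha : ‖a‖ = 2) :
    Differentiable ℂ fun p => ∑' n, singleTermReg a n p :=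
  differentiableOn_univ.1
    ((rapidFamily_singleTermReg ha).differentiableOn_tsum isOpen_univ summable_pow_id)

theorem differentiableOn_tsum_singleTerm {a : ℂ} (ha : ‖a‖ = 2) :
    DifferentiableOn ℂ (fun p => ∑' n, singleTerm a n p) D₁ :=
  (rapidFamily_singleTerm ha).differentiableOn_tsum isOpen_D₁ summable_pow_id

theorem differentiable_expansion₁Entire : Differentiable ℂ expansion₁Entire := by
  have htriple := differentiable_tsum_tripleTerm norm_two norm_two norm_neg_two
  have hmixed := differentiable_tsum_doubleTerm norm_neg_two norm_two
  have hplus := differentiable_tsum_doubleTerm norm_two norm_two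
  exact ((htriple.add hmixed).add (hmixed.comp differentiable_swap)).add
    (hplus.comp differentiable_rotate')

theorem differentiableOn_expansion₁ : DifferentiableOn ℂ expansion₁ D₁ :=
  differentiable_expansion₁Entire.differentiableOn.add (differentiableOn_tsum_singleTerm norm_two)

/-- The domain on which `expansion₂Core` is holomorphic. -/
def coreDomain : Set (ℂ × ℂ × ℂ) :=
  {p | ¬ IsIntLeOne (p.2.1 + p.2.2) ∧ ¬ IsIntLeOne (p.2.2 + p.1)}

theorem isOpen_coreDomain : IsOpen coreDomain :=
  (isOpen_setOf_not_isIntLeOne (coordT + coordU).continuous).inter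
    (isOpen_setOf_not_isIntLeOne (coordU + coordS).continuous)

theorem domT_subset_coreDomain : domT ⊆ coreDomain := fun p hp =>
  ⟨hp.2.1, add_comm p.1 p.2.2 ▸ hp.1⟩

theorem differentiableOn_expansion₂Core : DifferentiableOn ℂ expansion₂Core coreDomain := by
  have htriple := differentiable_tsum_tripleTerm norm_two norm_two norm_two
  have hdouble := differentiable_tsum_doubleTerm norm_neg_two norm_neg_two
  have hsingle := differentiableOn_tsum_singleTerm norm_neg_two
  exact ((((htriple.add (hdouble.comp differentiable_rotate')).add hdouble).add
    (hdouble.comp differentiable_rotate)).differentiableOn.add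
    (hsingle.comp differentiable_rotate.differentiableOn fun _ hp => hp.1)).add
    (hsingle.comp differentiable_rotate'.differentiableOn fun _ hp => hp.2)

theorem differentiable_polarNum : Differentiable ℂ polarNum := by
  have hΓ := Complex.differentiable_one_div_Gamma
  have hG : Differentiable ℂ fun p : ℂ × ℂ × ℂ => G p.1 p.2.1 p.2.2 := by
    simp only [G_eq]
    exact ((differentiable_gNum.mul (hΓ.comp coordS.differentiable)).mul
      (hΓ.comp coordT.differentiable)).mul (hΓ.comp coordU.differentiable)
  exact hG.mul (differentiable_two_cpow (by fun_prop))

theorem differentiableOn_expansion₂Main : DifferentiableOn ℂ expansion₂Main domT :=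
  (differentiable_polarNum.differentiableOn.mul fun _ hp =>
    DifferentiableWithinAt.fun_inv (by fun_prop) (sub_ne_zero.2 hp.2.2)).add
    (differentiableOn_expansion₂Core.mono domT_subset_coreDomain)

theorem differentiableOn_expansion₂ : DifferentiableOn ℂ expansion₂ D₂ :=
  (differentiableOn_expansion₂Main.mono D₂_subset_domT).add
    ((differentiableOn_tsum_singleTerm norm_neg_two).mono D₂_subset_D₁)

/-- The entire function `1 / Γ(s + t - 1)`, which cancels the poles along `s + t = 1 - n`. -/
def gammaST (p : ℂ × ℂ × ℂ) : ℂ := (Complex.Gamma (p.1 + p.2.1 - 1))⁻¹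

theorem differentiable_gammaST : Differentiable ℂ gammaST :=
  Complex.differentiable_one_div_Gamma.comp (f := fun p : ℂ × ℂ × ℂ => p.1 + p.2.1 - 1)
    (by fun_prop)

/-- The entire continuation of `expansion₁ / Γ(s + t - 1)`. -/
def expansion₁Reg (p : ℂ × ℂ × ℂ) : ℂ :=
  gammaST p * expansion₁Entire p + ∑' n, singleTermReg 2 n p

/-- The holomorphic continuation of `expansion₂ / Γ(s + t - 1)` to `domT`. -/
def expansion₂Reg (p : ℂ × ℂ × ℂ) : ℂ :=
  gammaST p * expansion₂Main p + ∑' n, singleTermReg (-2) n p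

theorem tsum_singleTermReg_eq (a : ℂ) {p : ℂ × ℂ × ℂ} (hp : p ∈ D₁) :
    ∑' n, singleTermReg a n p = gammaST p * ∑' n, singleTerm a n p := by
  rw [← tsum_mul_left]
  exact tsum_congr fun n => singleTermReg_eq a n hp

theorem expansion₁Reg_eq {p : ℂ × ℂ × ℂ} (hp : p ∈ D₁) :
    expansion₁Reg p = gammaST p * expansion₁ p := by
  rw [expansion₁Reg, expansion₁, mul_add, tsum_singleTermReg_eq 2 hp]

theorem expansion₂Reg_eq {p : ℂ × ℂ × ℂ} (hp : p ∈ D₁) :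
    expansion₂Reg p = gammaST p * expansion₂ p := by
  rw [expansion₂Reg, expansion₂, mul_add, tsum_singleTermReg_eq (-2) hp]

theorem differentiable_expansion₁Reg : Differentiable ℂ expansion₁Reg :=
  (differentiable_gammaST.mul differentiable_expansion₁Entire).add
    (differentiable_tsum_singleTermReg norm_two)

theorem differentiableOn_expansion₂Reg : DifferentiableOn ℂ expansion₂Reg domT :=
  (differentiable_gammaST.differentiableOn.mul differentiableOn_expansion₂Main).add
    (differentiable_tsum_singleTermReg norm_neg_two).differentiableOn

theorem expansion₁_eq_of_mem_largeRegion {s t u : ℂ} (h : (s, t, u) ∈ largeRegion) :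
    expansion₁ (s, t, u) =
      (1 + e (s + t + u)) * seriesSum (s, t, u) + (e s + e (u + t)) * seriesSum (u, s, t)
        + (e t + e (u + s)) * seriesSum (t, u, s) := by
  rw [← gNum_mul_integral_opposite_eq_expansion₁ h.1 h.2.1 h.2.2,
    gNum_mul_integral_opposite h.1 h.2.1 h.2.2]

theorem expansion₂_eq_of_mem_largeRegion {s t u : ℂ} (h : (s, t, u) ∈ largeRegion) :
    expansion₂ (s, t, u) =
      (e u + e (s + t)) * seriesSum (s, t, u) + (e t + e (u + s)) * seriesSum (u, s, t)
        + (e s + e (t + u)) * seriesSum (t, u, s) := by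
  rw [← gNum_mul_integral_same_eq_expansion₂ h.1 h.2.1 h.2.2,
    gNum_mul_integral_same h.1 h.2.1 h.2.2]

end HolomorphicExpansions

section Extension

variable {E : Type*} [NormedAddCommGroup E] [NormedSpace ℂ E] {D R : Set E} {ℓ : E →L[ℂ] ℂ}
  {φ : ℂ → ℂ} {f k : E → ℂ}

theorem eq_zero_of_eqOn_mul (hD : IsOpen D) (hL : LineCocountable D) (hR : IsOpen R)
    (hRD : R ⊆ D) (hf : DifferentiableOn ℂ f D) (hfk : ∀ q ∈ R, f q = φ (ℓ q) * k q)
    (hsurj : SurjOn ℓ R univ) {p : E} (hp : p ∈ D) (hφp : φ (ℓ p) = 0) : f p = 0 := by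
  obtain ⟨q, hq, hqp⟩ := hsurj (mem_univ (ℓ p))
  refine eq_of_isPreconnected_preimage_lineMap hD hf (differentiableOn_const 0) (hRD hq) hp
    (hL.isPreconnected_preimage_lineMap (hRD hq) p) ?_
  filter_upwards [(AffineMap.lineMap_continuous.tendsto' 0 q
    (AffineMap.lineMap_apply_zero (k := ℂ) q p)).eventually (hR.mem_nhds hq)] with z hz
  have hconst : ℓ (AffineMap.lineMap q p z) = ℓ p := by
    simp only [AffineMap.lineMap_apply_module', map_add, map_smul, map_sub, hqp, sub_self,
      smul_zero, zero_add]
  rw [hfk _ hz, hconst, hφp, zero_mul]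

theorem eqOn_of_mul_eq_mul (hR : IsOpen R) (hℓ : ℓ ≠ 0) (hφ : Differentiable ℂ φ)
    (hsimple : ∀ w, φ w = 0 → deriv φ w ≠ 0) (hf : ContinuousOn f R) (hk : ContinuousOn k R)
    (h : ∀ q ∈ R, φ (ℓ q) * f q = φ (ℓ q) * k q) : EqOn f k R := by
  obtain ⟨v, hv⟩ : ∃ v, ℓ v = 1 := LinearMap.surjective (f := ℓ.toLinearMap)
    (fun h => hℓ (ContinuousLinearMap.coe_injective h)) 1
  intro p hp
  have hlim : Tendsto (fun z : ℂ => p + z • v) (𝓝[≠] 0) (𝓝 p) :=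
    ((by fun_prop : Continuous fun z : ℂ => p + z • v).tendsto' 0 p (by simp)).mono_left
      nhdsWithin_le_nhds
  refine tendsto_nhds_unique_of_eventuallyEq ((hf.continuousAt (hR.mem_nhds hp)).tendsto.comp hlim)
    ((hk.continuousAt (hR.mem_nhds hp)).tendsto.comp hlim) ?_
  filter_upwards [eventually_nhdsNE_zero_apply_add_ne_zero (hφ (ℓ p)) (hsimple (ℓ p)),
    hlim.eventually (hR.mem_nhds hp)] with z hz hmem
  exact mul_left_cancel₀ (by simpa [hv] using hz) (h _ hmem)

theorem exists_differentiableOn_eqOn_of_mul [FiniteDimensional ℂ E] (hD : IsOpen D)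
    (hL : LineCocountable D) (hR : IsOpen R) (hRD : R ⊆ D) (hφ : Differentiable ℂ φ)
    (hsimple : ∀ w, φ w = 0 → deriv φ w ≠ 0) (hsurj : SurjOn ℓ R univ)
    (hf : DifferentiableOn ℂ f D) (hk : ContinuousOn k R)
    (hfk : ∀ q ∈ R, f q = φ (ℓ q) * k q) : ∃ g, DifferentiableOn ℂ g D ∧ EqOn g k R := by
  have hℓ : ℓ ≠ 0 := by
    rintro rfl
    obtain ⟨q, -, hq⟩ := hsurj (mem_univ 1)
    exact zero_ne_one hq
  obtain ⟨g, hg, hgf⟩ := exists_differentiableOn_mul_eq hD hf hℓ hφ hsimple fun p =>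
    eq_zero_of_eqOn_mul hD hL hR hRD hf hfk hsurj
  exact ⟨g, hg, eqOn_of_mul_eq_mul hR hℓ hφ hsimple (hg.continuousOn.mono hRD) hk
    fun q hq => (hgf q (hRD hq)).trans (hfk q hq)⟩

end Extension

section Continuation

theorem differentiable_e : Differentiable ℂ e := by
  unfold e
  fun_prop

/-- The function `e ^ (-2πiw) - 1`, whose zeros are simple and lie at the integers. -/
def eSq (w : ℂ) : ℂ := e w ^ 2 - 1

theorem differentiable_eSq : Differentiable ℂ eSq :=
  (differentiable_e.pow 2).sub_const 1

theorem deriv_eSq_ne_zero (w : ℂ) : deriv eSq w ≠ 0 := by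
  have hlin : HasDerivAt (fun w : ℂ => -(Real.pi * Complex.I * w)) (-(Real.pi * Complex.I)) w := by
    simpa only [id, mul_one] using ((hasDerivAt_id w).const_mul (Real.pi * Complex.I : ℂ)).fun_neg
  have hderiv : HasDerivAt eSq (2 * e w ^ (2 - 1) * (e w * -(Real.pi * Complex.I))) w :=
    (hlin.cexp.pow 2).sub_const 1
  have he : e w ≠ 0 := Complex.exp_ne_zero _
  have hπ : (Real.pi : ℂ) ≠ 0 := Complex.ofReal_ne_zero.2 Real.pi_ne_zero
  rw [hderiv.deriv]
  simp [he, hπ]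

/-- The multiple `(e ^ (-2πis) - 1) (e ^ (-2πit) - 1) (e ^ (-2πiu) - 1) / Γ(s + t - 1)` of the
Tornheim function, written in terms of the expansions so that it makes sense on `domT`. The
expansions at `(s, t, u)`, `(u, s, t)` and `(t, u, s)` are linear combinations of the three Tornheim
functions, and this one eliminates two of them. -/
def contNum (p : ℂ × ℂ × ℂ) : ℂ :=
  (e p.1 * e p.2.1 * e p.2.2 - 1) * expansion₁Reg p
    - (e p.1 * e p.2.1 - e p.2.2) * expansion₂Reg p
    - gammaST p * ((e p.2.1 * e p.2.2 - e p.1) * expansion₁ (p.2.2, p.1, p.2.1)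
      + (e p.1 * e p.2.2 - e p.2.1) * expansion₁ (p.2.1, p.2.2, p.1))

theorem differentiableOn_contNum : DifferentiableOn ℂ contNum domT := by
  have hs : Differentiable ℂ fun p : ℂ × ℂ × ℂ => e p.1 :=
    differentiable_e.comp coordS.differentiable
  have ht : Differentiable ℂ fun p : ℂ × ℂ × ℂ => e p.2.1 :=
    differentiable_e.comp coordT.differentiable
  have hu : Differentiable ℂ fun p : ℂ × ℂ × ℂ => e p.2.2 :=
    differentiable_e.comp coordU.differentiable
  have hrotate : DifferentiableOn ℂ (fun p : ℂ × ℂ × ℂ => expansion₁ (p.2.1, p.2.2, p.1)) domT :=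
    differentiableOn_expansion₁.comp differentiable_rotate.differentiableOn fun p hp =>
      (domT_subset_coreDomain hp).1
  have hrotate' : DifferentiableOn ℂ (fun p : ℂ × ℂ × ℂ => expansion₁ (p.2.2, p.1, p.2.1)) domT :=
    differentiableOn_expansion₁.comp differentiable_rotate'.differentiableOn fun p hp =>
      (domT_subset_coreDomain hp).2
  refine ((((hs.mul ht).mul hu).sub_const 1).mul
    differentiable_expansion₁Reg).differentiableOn.sub ?_ |>.sub ?_
  · exact ((hs.mul ht).sub hu).differentiableOn.mul differentiableOn_expansion₂Reg
  · exact differentiable_gammaST.differentiableOn.mul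
      ((((ht.mul hu).sub hs).differentiableOn.mul hrotate').add
        (((hs.mul hu).sub ht).differentiableOn.mul hrotate))

theorem contNum_eq_of_mem_largeRegion {p : ℂ × ℂ × ℂ} (hp : p ∈ largeRegion) :
    contNum p = eSq p.1 * (eSq p.2.1 * (eSq p.2.2 * (gammaST p * seriesSum p))) := by
  obtain ⟨s, t, u⟩ := p
  have hD := D₂_subset_D₁ (largeRegion_subset_D₂ hp)
  have hrotate : (t, u, s) ∈ largeRegion := ⟨hp.2.1, hp.2.2, hp.1⟩
  have hrotate' : (u, s, t) ∈ largeRegion := ⟨hp.2.2, hp.1, hp.2.1⟩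
  simp only [contNum, eSq]
  rw [expansion₁Reg_eq hD, expansion₂Reg_eq hD, expansion₁_eq_of_mem_largeRegion hp,
    expansion₂_eq_of_mem_largeRegion hp, expansion₁_eq_of_mem_largeRegion hrotate,
    expansion₁_eq_of_mem_largeRegion hrotate']
  simp only [e_add]
  ring

theorem differentiable_eSq_comp (ℓ : ℂ × ℂ × ℂ →L[ℂ] ℂ) : Differentiable ℂ fun p => eSq (ℓ p) :=
  differentiable_eSq.comp ℓ.differentiable

theorem contNum_eq {p : ℂ × ℂ × ℂ} (hp : p ∈ convergenceRegion) :
    contNum p = eSq (coordS p) * (eSq (coordT p) * (eSq (coordU p) * (gammaST p * seriesSum p))) :=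
  eqOn_of_convex convex_convergenceRegion isOpen_convergenceRegion
    (differentiableOn_contNum.mono convergenceRegion_subset_domT)
    ((differentiable_eSq_comp coordS).differentiableOn.mul
      ((differentiable_eSq_comp coordT).differentiableOn.mul
        ((differentiable_eSq_comp coordU).differentiableOn.mul
          (differentiable_gammaST.differentiableOn.mul differentiableOn_seriesSum))))
    (largeRegion_subset_convergenceRegion two_mem_largeRegion)
    (eventually_of_mem (isOpen_largeRegion.mem_nhds two_mem_largeRegion) fun _ =>
      contNum_eq_of_mem_largeRegion) hp

theorem exists_differentiableOn_domT_eqOn_of_mul {ℓ : ℂ × ℂ × ℂ →L[ℂ] ℂ} {φ : ℂ → ℂ}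
    (hφ : Differentiable ℂ φ) (hsimple : ∀ w, φ w = 0 → deriv φ w ≠ 0)
    (hsurj : SurjOn ℓ convergenceRegion univ) {f k : ℂ × ℂ × ℂ → ℂ}
    (hf : DifferentiableOn ℂ f domT) (hk : ContinuousOn k convergenceRegion)
    (hfk : ∀ p ∈ convergenceRegion, f p = φ (ℓ p) * k p) :
    ∃ g, DifferentiableOn ℂ g domT ∧ EqOn g k convergenceRegion :=
  exists_differentiableOn_eqOn_of_mul isOpen_domT lineCocountable_domT isOpen_convergenceRegion
    convergenceRegion_subset_domT hφ hsimple hsurj hf hk hfk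

theorem exists_mem_convergenceRegion (s t : ℂ) : ∃ u, (s, t, u) ∈ convergenceRegion := by
  refine ⟨((3 + |s.re| + |t.re| : ℝ) : ℂ), mem_convergenceRegion.2 ?_⟩
  simp only [Complex.ofReal_re]
  refine ⟨?_, ?_, ?_⟩ <;>
    linarith [neg_abs_le s.re, neg_abs_le t.re, abs_nonneg s.re, abs_nonneg t.re]

theorem surjOn_coordS_convergenceRegion : SurjOn coordS convergenceRegion univ := fun w _ =>
  let ⟨u, hu⟩ := exists_mem_convergenceRegion w 0
  ⟨(w, 0, u), hu, rfl⟩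

theorem surjOn_coordT_convergenceRegion : SurjOn coordT convergenceRegion univ := fun w _ =>
  let ⟨u, hu⟩ := exists_mem_convergenceRegion 0 w
  ⟨(0, w, u), hu, rfl⟩

theorem surjOn_coordU_convergenceRegion : SurjOn coordU convergenceRegion univ := fun w _ => by
  refine ⟨(((3 + |w.re| : ℝ) : ℂ), ((3 + |w.re| : ℝ) : ℂ), w), mem_convergenceRegion.2 ?_, rfl⟩
  simp only [Complex.ofReal_re]
  refine ⟨?_, ?_, ?_⟩ <;> linarith [neg_abs_le w.re, abs_nonneg w.re]

theorem surjOn_coordS_add_coordT_convergenceRegion :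
    SurjOn (coordS + coordT) convergenceRegion univ := fun w _ =>
  let ⟨u, hu⟩ := exists_mem_convergenceRegion w 0
  ⟨(w, 0, u), hu, add_zero w⟩

theorem exists_differentiableOn_eqOn_gammaST_mul_seriesSum : ∃ g, DifferentiableOn ℂ g domT ∧
    EqOn g (fun p => gammaST p * seriesSum p) convergenceRegion := by
  have hsimple : ∀ w, eSq w = 0 → deriv eSq w ≠ 0 := fun w _ => deriv_eSq_ne_zero w
  have hmul : ∀ (ℓ : ℂ × ℂ × ℂ →L[ℂ] ℂ) {k : ℂ × ℂ × ℂ → ℂ}, ContinuousOn k convergenceRegion →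
      ContinuousOn (fun p => eSq (ℓ p) * k p) convergenceRegion := fun ℓ _ hk =>
    (differentiable_eSq_comp ℓ).continuous.continuousOn.mul hk
  have hcont : ContinuousOn (fun p => gammaST p * seriesSum p) convergenceRegion :=
    differentiable_gammaST.continuous.continuousOn.mul differentiableOn_seriesSum.continuousOn
  obtain ⟨gS, hgS, hS⟩ := exists_differentiableOn_domT_eqOn_of_mul differentiable_eSq hsimple
    surjOn_coordS_convergenceRegion differentiableOn_contNum (hmul coordT (hmul coordU hcont))
    fun p => contNum_eq
  obtain ⟨gT, hgT, hT⟩ := exists_differentiableOn_domT_eqOn_of_mul differentiable_eSq hsimple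
    surjOn_coordT_convergenceRegion hgS (hmul coordU hcont) hS
  exact exists_differentiableOn_domT_eqOn_of_mul differentiable_eSq hsimple
    surjOn_coordU_convergenceRegion hgT hcont hT

theorem exists_differentiableOn_eqOn_seriesSum :
    ∃ g, DifferentiableOn ℂ g domT ∧ EqOn g seriesSum convergenceRegion := by
  obtain ⟨f, hf, hfeq⟩ := exists_differentiableOn_eqOn_gammaST_mul_seriesSum
  refine exists_differentiableOn_domT_eqOn_of_mul (φ := fun w => (Complex.Gamma (w - 1))⁻¹)
    (Complex.differentiable_one_div_Gamma.comp (f := fun w : ℂ => w - 1) (by fun_prop))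
    (fun w hw => ?_) surjOn_coordS_add_coordT_convergenceRegion hf
    differentiableOn_seriesSum.continuousOn hfeq
  rw [deriv_comp_sub_const (f := fun w => (Complex.Gamma w)⁻¹)]
  exact deriv_gamma_inv_ne_zero hw

theorem isContinuation_T : IsContinuation fun (s, t, u) => T s t u := by
  refine Classical.epsilon_spec (p := IsContinuation) ?_
  obtain ⟨f, hf, hfeq⟩ := exists_differentiableOn_eqOn_seriesSum
  refine ⟨f, hf, fun s t u h => ?_⟩
  rw [hfeq h]
  exact hasSum_seriesTerm (p := (s, t, u)) h

theorem T_eq_seriesSum {s t u : ℂ} (h : (s, t, u) ∈ convergenceRegion) :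
    T s t u = seriesSum (s, t, u) :=
  (isContinuation_T.hasSum s t u h).unique (hasSum_seriesTerm (p := (s, t, u)) h)

end Continuation

section Identification

theorem T_eq_of_mem_largeRegion {s t u : ℂ} (h : (s, t, u) ∈ largeRegion) :
    T s t u = seriesSum (s, t, u) ∧ T u s t = seriesSum (u, s, t) ∧
      T t u s = seriesSum (t, u, s) :=
  ⟨T_eq_seriesSum (largeRegion_subset_convergenceRegion h),
    T_eq_seriesSum (largeRegion_subset_convergenceRegion ⟨h.2.2, h.1, h.2.1⟩),
    T_eq_seriesSum (largeRegion_subset_convergenceRegion ⟨h.2.1, h.2.2, h.1⟩)⟩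

theorem differentiableOn_add_mul_T {a b c : ℂ × ℂ × ℂ → ℂ} (ha : Differentiable ℂ a)
    (hb : Differentiable ℂ b) (hc : Differentiable ℂ c) :
    DifferentiableOn ℂ (fun p : ℂ × ℂ × ℂ => a p * T p.1 p.2.1 p.2.2 + b p * T p.2.2 p.1 p.2.1
      + c p * T p.2.1 p.2.2 p.1) D₂ := by
  have hT : DifferentiableOn ℂ (fun p : ℂ × ℂ × ℂ => T p.1 p.2.1 p.2.2) domT :=
    isContinuation_T.differentiableOn
  have hrotate : DifferentiableOn ℂ (fun p : ℂ × ℂ × ℂ => T p.2.1 p.2.2 p.1) D₂ :=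
    hT.comp differentiable_rotate.differentiableOn fun _ hp => D₂_subset_domT (rotate_mem_D₂ hp)
  have hrotate' : DifferentiableOn ℂ (fun p : ℂ × ℂ × ℂ => T p.2.2 p.1 p.2.1) D₂ :=
    hT.comp differentiable_rotate'.differentiableOn fun _ hp =>
      D₂_subset_domT (rotate_mem_D₂ (rotate_mem_D₂ hp))
  exact ((ha.differentiableOn.mul (hT.mono D₂_subset_domT)).add
    (hb.differentiableOn.mul hrotate')).add (hc.differentiableOn.mul hrotate)

theorem differentiableOn_comb₁ :
    DifferentiableOn ℂ (fun p : ℂ × ℂ × ℂ => comb₁ p.1 p.2.1 p.2.2) D₂ := by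
  unfold comb₁ e
  exact differentiableOn_add_mul_T (by fun_prop) (by fun_prop) (by fun_prop)

theorem differentiableOn_S₂ : DifferentiableOn ℂ (fun p : ℂ × ℂ × ℂ => S₂ p.1 p.2.1 p.2.2) D₂ := by
  unfold S₂ e
  exact differentiableOn_add_mul_T (by fun_prop) (by fun_prop) (by fun_prop)

theorem comb₁_eq_expansion₁ {p : ℂ × ℂ × ℂ} (hp : p ∈ D₂) :
    comb₁ p.1 p.2.1 p.2.2 = expansion₁ p := by
  refine lineCocountable_D₂.eqOn isOpen_D₂ differentiableOn_comb₁
    (differentiableOn_expansion₁.mono D₂_subset_D₁) (largeRegion_subset_D₂ two_mem_largeRegion)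
    ?_ hp
  filter_upwards [isOpen_largeRegion.mem_nhds two_mem_largeRegion] with q hq
  obtain ⟨hstu, hust, htus⟩ := T_eq_of_mem_largeRegion hq
  rw [comb₁, hstu, hust, htus]
  exact (expansion₁_eq_of_mem_largeRegion hq).symm

theorem S₂_eq_expansion₂ {p : ℂ × ℂ × ℂ} (hp : p ∈ D₂) : S₂ p.1 p.2.1 p.2.2 = expansion₂ p := by
  refine lineCocountable_D₂.eqOn isOpen_D₂ differentiableOn_S₂ differentiableOn_expansion₂
    (largeRegion_subset_D₂ two_mem_largeRegion) ?_ hp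
  filter_upwards [isOpen_largeRegion.mem_nhds two_mem_largeRegion] with q hq
  obtain ⟨hstu, hust, htus⟩ := T_eq_of_mem_largeRegion hq
  rw [S₂, hstu, hust, htus]
  exact (expansion₂_eq_of_mem_largeRegion hq).symm

theorem S₁_eq_expansion₁ {p : ℂ × ℂ × ℂ} (hp : p ∈ D₁) : S₁ p.1 p.2.1 p.2.2 = expansion₁ p := by
  refine extendFrom_eq (dense_D₂ p) ?_
  refine ((differentiableOn_expansion₁.continuousOn.continuousAt
    (isOpen_D₁.mem_nhds hp)).tendsto.mono_left nhdsWithin_le_nhds).congr' ?_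
  filter_upwards [self_mem_nhdsWithin] with q hq
  exact (comb₁_eq_expansion₁ hq).symm

theorem S₂_rotate (s t u : ℂ) : S₂ t u s = S₂ s t u := by
  rw [S₂, S₂]
  ring

end Identification

section Singularities

theorem exists_lt_norm_of_eq_mul {X 𝕜 : Type*} [TopologicalSpace X] [NormedDivisionRing 𝕜]
    {D : Set X} {f g φ : X → 𝕜} {p : X} (hp : p ∈ closure D) (hg : ContinuousAt g p)
    (hφ : ContinuousAt φ p) (hφp : φ p = 0) (hgp : g p ≠ 0) (hgf : ∀ q ∈ D, g q = φ q * f q)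
    {U : Set X} (hU : U ∈ 𝓝 p) (C : ℝ) : ∃ q ∈ U ∩ D, C < ‖f q‖ := by
  by_contra! hC
  have := mem_closure_iff_nhdsWithin_neBot.1 hp
  have hle : ‖g p‖ ≤ ‖φ p‖ * C := by
    refine le_of_tendsto_of_tendsto (hg.norm.tendsto.mono_left nhdsWithin_le_nhds)
      ((hφ.norm.tendsto.mul_const C).mono_left (nhdsWithin_le_nhds (s := D))) ?_
    filter_upwards [self_mem_nhdsWithin, mem_nhdsWithin_of_mem_nhds hU] with q hqD hqU
    rw [hgf q hqD, norm_mul]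
    exact mul_le_mul_of_nonneg_left (hC q ⟨hqU, hqD⟩) (norm_nonneg _)
  rw [hφp, norm_zero, zero_mul] at hle
  exact hgp (norm_le_zero_iff.1 hle)

theorem not_isIntLeOne_of_im_ne_zero {z : ℂ} (hz : z.im ≠ 0) : ¬ IsIntLeOne z := by
  rintro ⟨n, -, rfl⟩
  exact hz (Complex.intCast_im n)

theorem gamma_inv_ne_zero_of_im_ne_zero {z : ℂ} (hz : z.im ≠ 0) : (Complex.Gamma z)⁻¹ ≠ 0 :=
  inv_ne_zero (Complex.Gamma_ne_zero fun n hn => hz (by simp [hn]))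

theorem gNum_ne_zero (p : ℂ × ℂ × ℂ) : gNum p ≠ 0 :=
  mul_ne_zero (Complex.exp_ne_zero _) (Complex.cpow_ne_zero_iff.2 (Or.inl complex_two_pi_ne_zero))

theorem two_cpow_ne_zero (z : ℂ) : (2 : ℂ) ^ z ≠ 0 :=
  Complex.cpow_ne_zero_iff.2 (Or.inl two_ne_zero)

theorem etaGamma_ne_zero {k : ℕ} {u : ℂ} (hre : u.re ≤ k) (him : u.im ≠ 0) :
    etaGamma k u ≠ 0 := by
  have hne : ∀ m : ℕ, (m : ℂ) ≠ u := fun m hm => him (by simp [← hm])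
  rw [← etaBase_mul_gamma_inv (by simpa using (hne 0).symm),
    ← choose_mul_zeta_eq_etaBase (hne k).symm, choose_sub_eq_prod]
  have hprod : ∏ j ∈ Finset.range k, ((j + 1 : ℂ) - u) ≠ 0 :=
    Finset.prod_ne_zero_iff.2 fun j _ => sub_ne_zero.2 (by simpa using hne (j + 1))
  have hzeta : riemannZeta (k + 1 - u) ≠ 0 :=
    riemannZeta_ne_zero_of_one_le_re (by simpa using by linarith)
  exact mul_ne_zero (mul_ne_zero (div_ne_zero hprod (mod_cast k.factorial_ne_zero)) hzeta)
    (gamma_inv_ne_zero_of_im_ne_zero him)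

theorem differentiable_singleNum {a : ℂ} (ha : ‖a‖ = 2) (n : ℕ) :
    Differentiable ℂ (singleNum a n) :=
  differentiableOn_univ.1 ((rapidFamily_singleNum ha).differentiableOn n)

theorem exists_mem_domT_singleNum_ne_zero {a : ℂ} (ha : a ≠ 0) (k : ℕ) :
    ∃ q ∈ domT, q.1 + q.2.1 = 1 - k ∧ singleNum a k q ≠ 0 := by
  refine ⟨(Complex.I, 1 - k - Complex.I, -k + 2 * Complex.I), ⟨?_, ?_, ?_⟩, by simp, ?_⟩
  · exact not_isIntLeOne_of_im_ne_zero (by norm_num)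
  · exact not_isIntLeOne_of_im_ne_zero (by norm_num)
  · exact fun h => by simpa using congrArg Complex.im h
  · exact mul_ne_zero (mul_ne_zero (mul_ne_zero (mul_ne_zero (gNum_ne_zero _)
      (two_cpow_ne_zero _)) (gamma_inv_ne_zero_of_im_ne_zero (by simp)))
      (gamma_inv_ne_zero_of_im_ne_zero (by simp)))
      (mul_ne_zero (zpow_ne_zero _ ha) (etaGamma_ne_zero (by simp) (by simp)))

theorem exists_mem_singleNum_ne_zero {a : ℂ} (ha : ‖a‖ = 2) {p : ℂ × ℂ × ℂ} {k : ℕ}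
    (hp : p.1 + p.2.1 = 1 - k) {U : Set (ℂ × ℂ × ℂ)} (hU : U ∈ 𝓝 p) :
    ∃ q ∈ U, q ∈ domT ∧ q.1 + q.2.1 = 1 - k ∧ singleNum a k q ≠ 0 := by
  obtain ⟨q, hqT, hq, hne⟩ :=
    exists_mem_domT_singleNum_ne_zero (norm_ne_zero_iff.1 (ha.trans_ne two_ne_zero)) k
  obtain ⟨q', hqU, ⟨hneq, hqT'⟩, hq'⟩ := mem_closure_iff_nhds.1
    (((lineCocountable_ne_zero (differentiable_singleNum ha k)).inter
      lineCocountable_domT).mem_closure_inter_preimage (coordS + coordT) (p := p) ⟨hne, hqT⟩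
      (hq.trans hp.symm)) U hU
  exact ⟨q', hqU, hqT', hq'.trans hp, hneq⟩

theorem gammaST_eq_zero {p : ℂ × ℂ × ℂ} {k : ℕ} (hp : p.1 + p.2.1 = 1 - k) : gammaST p = 0 := by
  rw [gammaST, hp, show (1 - k - 1 : ℂ) = -k by ring, Complex.Gamma_neg_nat_eq_zero, inv_zero]

theorem tsum_singleTermReg_of_add_eq {p : ℂ × ℂ × ℂ} {k : ℕ} (a : ℂ) (hp : p.1 + p.2.1 = 1 - k) :
    ∑' n, singleTermReg a n p = singleNum a k p * gammaInvDiv k (-k) := by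
  have hp' : p.1 + p.2.1 - 1 = -k := by linear_combination hp
  refine (tsum_eq_single k fun n hn => ?_).trans (by rw [singleTermReg, hp'])
  have hnk : (-k + n : ℂ) ≠ 0 := fun h =>
    hn (Nat.cast_injective (R := ℂ) (by linear_combination h))
  rw [singleTermReg, hp', gammaInvDiv_eq hnk, Complex.Gamma_neg_nat_eq_zero, inv_zero, zero_div,
    mul_zero]

/-- After division by `Γ(s + t - 1)` only one term of the single series survives on the hyperplane
`s + t = 1 - k`, and this term does not vanish identically there. -/
theorem exists_lt_norm_of_eq_add_tsum_singleTerm {a : ℂ} (ha : ‖a‖ = 2) {D : Set (ℂ × ℂ × ℂ)}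
    (hD : Dense D) (hD₁ : D ⊆ D₁) {f M : ℂ × ℂ × ℂ → ℂ} (hM : ContinuousOn M domT)
    (hf : ∀ p ∈ D, f p = M p + ∑' n, singleTerm a n p) {p : ℂ × ℂ × ℂ}
    (hp : IsIntLeOne (p.1 + p.2.1)) {U : Set (ℂ × ℂ × ℂ)} (hU : U ∈ 𝓝 p) (C : ℝ) :
    ∃ q ∈ U ∩ D, C < ‖f q‖ := by
  obtain ⟨k, hk⟩ := isIntLeOne_iff.1 hp
  obtain ⟨q, hqU, hqT, hq, hne⟩ := exists_mem_singleNum_ne_zero ha hk (interior_mem_nhds.2 hU)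
  have hγ : ContinuousAt gammaST q := differentiable_gammaST.continuous.continuousAt
  refine exists_lt_norm_of_eq_mul (g := fun p => gammaST p * M p + ∑' n, singleTermReg a n p)
    (φ := gammaST) (hD q) ((hγ.mul (hM.continuousAt (isOpen_domT.mem_nhds hqT))).add
      (differentiable_tsum_singleTermReg ha).continuous.continuousAt) hγ
    (gammaST_eq_zero hq) ?_ (fun r hr => ?_) (mem_interior_iff_mem_nhds.1 hqU) C
  · simpa only [gammaST_eq_zero hq, zero_mul, zero_add, tsum_singleTermReg_of_add_eq a hq] using
      mul_ne_zero hne (gammaInvDiv_neg_ne_zero k)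
  · rw [hf r hr, tsum_singleTermReg_eq a (hD₁ hr), mul_add]

theorem exists_lt_norm_S₂_of_isIntLeOne_add {p : ℂ × ℂ × ℂ} (hp : IsIntLeOne (p.1 + p.2.1))
    {U : Set (ℂ × ℂ × ℂ)} (hU : U ∈ 𝓝 p) (C : ℝ) : ∃ q ∈ U ∩ D₂, C < ‖S₂ q.1 q.2.1 q.2.2‖ :=
  exists_lt_norm_of_eq_add_tsum_singleTerm (f := fun q => S₂ q.1 q.2.1 q.2.2) norm_neg_two dense_D₂
    D₂_subset_D₁ differentiableOn_expansion₂Main.continuousOn (fun _ hq => S₂_eq_expansion₂ hq)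
    hp hU C

theorem exists_mem_polarNum_ne_zero {p : ℂ × ℂ × ℂ} (hp : p.1 + p.2.1 + p.2.2 = 2)
    {U : Set (ℂ × ℂ × ℂ)} (hU : U ∈ 𝓝 p) :
    ∃ q ∈ U, q ∈ coreDomain ∩ D₁ ∧ q.1 + q.2.1 + q.2.2 = 2 ∧ polarNum q ≠ 0 := by
  have hcountable : LineCocountable ({p | polarNum p ≠ 0} ∩ (coreDomain ∩ D₁)) :=
    (lineCocountable_ne_zero differentiable_polarNum).inter
      (((lineCocountable_not_isIntLeOne (coordT + coordU)).inter
        (lineCocountable_not_isIntLeOne (coordU + coordS))).inter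
        (lineCocountable_not_isIntLeOne (coordS + coordT)))
  have hmem : (Complex.I, Complex.I, 2 - 2 * Complex.I) ∈
      {p | polarNum p ≠ 0} ∩ (coreDomain ∩ D₁) := by
    refine ⟨?_, ⟨not_isIntLeOne_of_im_ne_zero (by norm_num),
      not_isIntLeOne_of_im_ne_zero (by norm_num)⟩, not_isIntLeOne_of_im_ne_zero (by norm_num)⟩
    rw [mem_ofPred_eq, polarNum, G_eq]
    exact mul_ne_zero (mul_ne_zero (mul_ne_zero (mul_ne_zero (gNum_ne_zero _)
      (gamma_inv_ne_zero_of_im_ne_zero (by simp))) (gamma_inv_ne_zero_of_im_ne_zero (by simp)))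
      (gamma_inv_ne_zero_of_im_ne_zero (by simp))) (two_cpow_ne_zero _)
  have hsum : (coordS + coordT + coordU) (Complex.I, Complex.I, 2 - 2 * Complex.I) =
      (coordS + coordT + coordU) p := by
    refine Eq.trans ?_ hp.symm
    change Complex.I + Complex.I + (2 - 2 * Complex.I) = 2
    ring
  obtain ⟨q, hqU, ⟨hne, hqD⟩, hq⟩ := mem_closure_iff_nhds.1
    (hcountable.mem_closure_inter_preimage _ hmem hsum) U hU
  exact ⟨q, hqU, hqD, hq.trans hp, hne⟩

theorem exists_lt_norm_S₂_of_add_add_eq_two {p : ℂ × ℂ × ℂ} (hp : p.1 + p.2.1 + p.2.2 = 2)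
    {U : Set (ℂ × ℂ × ℂ)} (hU : U ∈ 𝓝 p) (C : ℝ) :
    ∃ q ∈ U ∩ D₂, C < ‖S₂ q.1 q.2.1 q.2.2‖ := by
  obtain ⟨q, hqU, ⟨hqcore, hq₁⟩, hq, hne⟩ := exists_mem_polarNum_ne_zero hp
    (interior_mem_nhds.2 hU)
  have hφ : ContinuousAt (fun p : ℂ × ℂ × ℂ => p.1 + p.2.1 + p.2.2 - 2) q := by fun_prop
  have hrest : ContinuousAt (fun p => expansion₂Core p + ∑' n, singleTerm (-2) n p) q :=
    (differentiableOn_expansion₂Core.continuousOn.continuousAt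
      (isOpen_coreDomain.mem_nhds hqcore)).add
    ((differentiableOn_tsum_singleTerm norm_neg_two).continuousOn.continuousAt
      (isOpen_D₁.mem_nhds hq₁))
  refine exists_lt_norm_of_eq_mul (g := fun p => polarNum p + (p.1 + p.2.1 + p.2.2 - 2) *
      (expansion₂Core p + ∑' n, singleTerm (-2) n p)) (dense_D₂ q)
    (differentiable_polarNum.continuous.continuousAt.add (hφ.mul hrest)) hφ
    (sub_eq_zero.2 hq) ?_ (fun r hr => ?_) (mem_interior_iff_mem_nhds.1 hqU) C
  · simpa only [sub_eq_zero.2 hq, zero_mul, add_zero] using hne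
  · have hr₂ : r.1 + r.2.1 + r.2.2 - 2 ≠ 0 := sub_ne_zero.2 hr.2.2.2
    rw [S₂_eq_expansion₂ hr, expansion₂, expansion₂Main]
    field_simp
    ring

theorem singularOff_S₁ : SingularOff D₁ S₁ := by
  intro p hp U hU C
  obtain ⟨q, hq, hC⟩ := exists_lt_norm_of_eq_add_tsum_singleTerm norm_two dense_D₁ subset_rfl
    differentiable_expansion₁Entire.continuous.continuousOn
    (fun _ hq => S₁_eq_expansion₁ hq) (not_not.1 hp) hU C
  exact ⟨_, _, _, hq, hC⟩

theorem singularOff_S₂ : SingularOff D₂ S₂ := by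
  rintro ⟨s, t, u⟩ hp U hU C
  by_cases hst : IsIntLeOne (s + t)
  · obtain ⟨q, hq, hC⟩ := exists_lt_norm_S₂_of_isIntLeOne_add hst hU C
    exact ⟨_, _, _, hq, hC⟩
  by_cases htu : IsIntLeOne (t + u)
  · obtain ⟨⟨t', u', s'⟩, hq, hC⟩ := exists_lt_norm_S₂_of_isIntLeOne_add (p := (t, u, s)) htu
      (differentiable_rotate'.continuous.continuousAt.preimage_mem_nhds hU) C
    exact ⟨s', t', u', ⟨hq.1, rotate_mem_D₂ (rotate_mem_D₂ hq.2)⟩, by rwa [← S₂_rotate]⟩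
  by_cases hus : IsIntLeOne (u + s)
  · obtain ⟨⟨u', s', t'⟩, hq, hC⟩ := exists_lt_norm_S₂_of_isIntLeOne_add (p := (u, s, t)) hus
      (differentiable_rotate.continuous.continuousAt.preimage_mem_nhds hU) C
    exact ⟨s', t', u', ⟨hq.1, rotate_mem_D₂ hq.2⟩, by rwa [S₂_rotate]⟩
  have hstu : s + t + u = 2 := by
    by_contra hstu
    exact hp ⟨hst, htu, hus, hstu⟩
  obtain ⟨q, hq, hC⟩ := exists_lt_norm_S₂_of_add_add_eq_two (p := (s, t, u)) hstu hU C
  exact ⟨_, _, _, hq, hC⟩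

end Singularities

section ExpansionFormulas

/-- On `D`, the series with general term `a`, multiplied by `G`, converges rapidly and has the
sum `f`. -/
structure IsExpansion {ι : Type} (D : Set (ℂ × ℂ × ℂ)) (deg : ι → ℕ) (a : ℂ → ℂ → ℂ → ι → ℂ)
    (f : ℂ × ℂ × ℂ → ℂ) : Prop where
  rapidOn : RapidOn D deg a
  sumG_eq : ∀ {s t u}, (s, t, u) ∈ D → sumG a s t u = f (s, t, u)
  mul_tsum_eq : ∀ {s t u}, (s, t, u) ∈ D → (s, t, u) ∈ regularPoints →
    G s t u * ∑' i, a s t u i = f (s, t, u)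

theorem RapidFamily.isExpansion {ι : Type} {D : Set (ℂ × ℂ × ℂ)} {deg : ι → ℕ}
    {h : ι → ℂ × ℂ × ℂ → ℂ} {a : ℂ → ℂ → ℂ → ι → ℂ} (hh : RapidFamily D deg h) (hD : IsOpen D)
    (hdeg : Summable fun i => (3 / 4 : ℝ) ^ deg i)
    (ha : ∀ i s t u, (s, t, u) ∈ D → (s, t, u) ∈ regularPoints →
      G s t u * a s t u i = h i (s, t, u)) : IsExpansion D deg a fun p => ∑' i, h i p where
  rapidOn := hh.rapidOn hD hdeg ha
  sumG_eq := hh.sumG_eq hD ha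
  mul_tsum_eq := G_mul_tsum_eq ha

theorem G_swap (s t u : ℂ) : G t s u = G s t u := by
  rw [G_eq, G_eq, gNum_swap₁₂]
  ring

theorem G_rotate (s t u : ℂ) : G u s t = G s t u := by
  rw [G_eq, G_eq, gNum_rotate]
  ring

theorem swap_mem_regularPoints {s t u : ℂ} (h : (s, t, u) ∈ regularPoints) :
    (t, s, u) ∈ regularPoints := fun n => ⟨(h n).2.1, (h n).1, (h n).2.2⟩

theorem rotate_mem_regularPoints {s t u : ℂ} (h : (s, t, u) ∈ regularPoints) :
    (u, s, t) ∈ regularPoints := fun n => ⟨(h n).2.2, (h n).1, (h n).2.1⟩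

variable {a b c : ℂ} {D : Set (ℂ × ℂ × ℂ)}

theorem isExpansion_triple (ha : ‖a‖ = 2) (hb : ‖b‖ = 2) (hc : ‖c‖ = 2) (hD : IsOpen D) :
    IsExpansion D deg₃ (fun s t u => triple (eta a) (eta b) (eta c) s t u)
      fun p => ∑' i, tripleTerm a b c i p :=
  ((rapidFamily_tripleTerm ha hb hc).mono (subset_univ D)).isExpansion hD summable_pow_deg₃
    fun i _ _ _ _ hr => G_mul_triple a b c i hr

theorem isExpansion_double (ha : ‖a‖ = 2) (hb : ‖b‖ = 2) (hD : IsOpen D) :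
    IsExpansion D deg₂ (fun s t u => double (eta a) (eta b) s t u)
      fun p => ∑' i, doubleTerm a b i p :=
  ((rapidFamily_doubleTerm ha hb).mono (subset_univ D)).isExpansion hD summable_pow_deg₂
    fun i _ _ _ _ hr => G_mul_double a b i hr

theorem isExpansion_double_swap (ha : ‖a‖ = 2) (hb : ‖b‖ = 2) (hD : IsOpen D) :
    IsExpansion D deg₂ (fun s t u => double (eta a) (eta b) t s u)
      fun p => ∑' i, doubleTerm a b i (p.2.1, p.1, p.2.2) :=
  ((rapidFamily_doubleTerm ha hb).comp differentiable_swap (mapsTo_univ _ D)).isExpansion hD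
    summable_pow_deg₂ fun i s t u _ hr => by
      rw [← G_swap]
      exact G_mul_double a b i (swap_mem_regularPoints hr)

theorem isExpansion_double_rotate (ha : ‖a‖ = 2) (hb : ‖b‖ = 2) (hD : IsOpen D) :
    IsExpansion D deg₂ (fun s t u => double (eta a) (eta b) t u s)
      fun p => ∑' i, doubleTerm a b i (p.2.1, p.2.2, p.1) :=
  ((rapidFamily_doubleTerm ha hb).comp differentiable_rotate (mapsTo_univ _ D)).isExpansion hD
    summable_pow_deg₂ fun i s t u _ hr => by
      rw [G_rotate t u s]
      exact G_mul_double a b i (rotate_mem_regularPoints (rotate_mem_regularPoints hr))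

theorem isExpansion_double_rotate' (ha : ‖a‖ = 2) (hb : ‖b‖ = 2) (hD : IsOpen D) :
    IsExpansion D deg₂ (fun s t u => double (eta a) (eta b) u s t)
      fun p => ∑' i, doubleTerm a b i (p.2.2, p.1, p.2.1) :=
  ((rapidFamily_doubleTerm ha hb).comp differentiable_rotate' (mapsTo_univ _ D)).isExpansion hD
    summable_pow_deg₂ fun i s t u _ hr => by
      rw [← G_rotate]
      exact G_mul_double a b i (rotate_mem_regularPoints hr)

theorem isExpansion_single (ha : ‖a‖ = 2) (hD : IsOpen D) (hD₁ : D ⊆ D₁) :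
    IsExpansion D id (fun s t u => single (eta a) s t u) fun p => ∑' n, singleTerm a n p :=
  ((rapidFamily_singleTerm ha).mono hD₁).isExpansion hD summable_pow_id
    fun n _ _ _ _ hr => G_mul_single a n hr

theorem isExpansion_single_rotate (ha : ‖a‖ = 2) :
    IsExpansion D₂ id (fun s t u => single (eta a) t u s)
      fun p => ∑' n, singleTerm a n (p.2.1, p.2.2, p.1) :=
  ((rapidFamily_singleTerm ha).comp differentiable_rotate fun _ hp =>
      D₂_subset_D₁ (rotate_mem_D₂ hp)).isExpansion isOpen_D₂
    summable_pow_id fun n s t u _ hr => by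
      rw [G_rotate t u s]
      exact G_mul_single a n (rotate_mem_regularPoints (rotate_mem_regularPoints hr))

theorem isExpansion_single_rotate' (ha : ‖a‖ = 2) :
    IsExpansion D₂ id (fun s t u => single (eta a) u s t)
      fun p => ∑' n, singleTerm a n (p.2.2, p.1, p.2.1) :=
  ((rapidFamily_singleTerm ha).comp differentiable_rotate' fun _ hp =>
      D₂_subset_D₁ (rotate_mem_D₂ (rotate_mem_D₂ hp))).isExpansion isOpen_D₂
    summable_pow_id fun n s t u _ hr => by
      rw [← G_rotate]
      exact G_mul_single a n (rotate_mem_regularPoints hr)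

theorem differentiableOn_S₁ : DifferentiableOn ℂ (fun p : ℂ × ℂ × ℂ => S₁ p.1 p.2.1 p.2.2) D₁ :=
  differentiableOn_expansion₁.congr fun _ hp => S₁_eq_expansion₁ hp

theorem S₁_eq_comb₁ {s t u : ℂ} (hp : (s, t, u) ∈ D₂) : S₁ s t u = comb₁ s t u :=
  (S₁_eq_expansion₁ (D₂_subset_D₁ hp)).trans (comb₁_eq_expansion₁ hp).symm

variable {s t u : ℂ}

theorem S₁_eq_G_mul_add_tsum (hp : (s, t, u) ∈ D₁) (hr : (s, t, u) ∈ regularPoints) :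
    S₁ s t u = G s t u * (∑' i, triple (eta 2) (eta 2) (eta (-2)) s t u i
      + ∑' n, single (eta 2) s t u n + ∑' i, double (eta (-2)) (eta 2) s t u i
      + ∑' i, double (eta (-2)) (eta 2) t s u i + ∑' i, double (eta 2) (eta 2) u s t i) := by
  simp only [mul_add]
  rw [(isExpansion_triple norm_two norm_two norm_neg_two isOpen_D₁).mul_tsum_eq hp hr,
    (isExpansion_single norm_two isOpen_D₁ subset_rfl).mul_tsum_eq hp hr,
    (isExpansion_double norm_neg_two norm_two isOpen_D₁).mul_tsum_eq hp hr,
    (isExpansion_double_swap norm_neg_two norm_two isOpen_D₁).mul_tsum_eq hp hr,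
    (isExpansion_double_rotate' norm_two norm_two isOpen_D₁).mul_tsum_eq hp hr,
    S₁_eq_expansion₁ hp, expansion₁, expansion₁Entire]
  ring

theorem S₁_eq_add_sumG (hp : (s, t, u) ∈ D₁) :
    S₁ s t u = sumG (triple (eta 2) (eta 2) (eta (-2))) s t u + sumG (single (eta 2)) s t u
      + sumG (double (eta (-2)) (eta 2)) s t u
      + sumG (fun s t u => double (eta (-2)) (eta 2) t s u) s t u
      + sumG (fun s t u => double (eta 2) (eta 2) u s t) s t u := by
  rw [(isExpansion_triple norm_two norm_two norm_neg_two isOpen_D₁).sumG_eq hp,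
    (isExpansion_single norm_two isOpen_D₁ subset_rfl).sumG_eq hp,
    (isExpansion_double norm_neg_two norm_two isOpen_D₁).sumG_eq hp,
    (isExpansion_double_swap norm_neg_two norm_two isOpen_D₁).sumG_eq hp,
    (isExpansion_double_rotate' norm_two norm_two isOpen_D₁).sumG_eq hp,
    S₁_eq_expansion₁ hp, expansion₁, expansion₁Entire]
  ring

theorem S₂_eq_G_mul_add_tsum (hp : (s, t, u) ∈ D₂) (hr : (s, t, u) ∈ regularPoints) :
    S₂ s t u = G s t u * ((2 : ℂ) ^ (2 - s - t - u) / (s + t + u - 2)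
      + ∑' i, triple (eta 2) (eta 2) (eta 2) s t u i
      + ∑' i, double (eta (-2)) (eta (-2)) u s t i + ∑' i, double (eta (-2)) (eta (-2)) s t u i
      + ∑' i, double (eta (-2)) (eta (-2)) t u s i + ∑' l, single (eta (-2)) t u s l
      + ∑' m, single (eta (-2)) u s t m + ∑' n, single (eta (-2)) s t u n) := by
  simp only [mul_add]
  rw [(isExpansion_triple norm_two norm_two norm_two isOpen_D₂).mul_tsum_eq hp hr,
    (isExpansion_double_rotate' norm_neg_two norm_neg_two isOpen_D₂).mul_tsum_eq hp hr,
    (isExpansion_double norm_neg_two norm_neg_two isOpen_D₂).mul_tsum_eq hp hr,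
    (isExpansion_double_rotate norm_neg_two norm_neg_two isOpen_D₂).mul_tsum_eq hp hr,
    (isExpansion_single_rotate norm_neg_two).mul_tsum_eq hp hr,
    (isExpansion_single_rotate' norm_neg_two).mul_tsum_eq hp hr,
    (isExpansion_single norm_neg_two isOpen_D₂ D₂_subset_D₁).mul_tsum_eq hp hr,
    S₂_eq_expansion₂ hp, expansion₂, expansion₂Main, expansion₂Core, polarNum]
  ring

theorem S₂_eq_add_sumG (hp : (s, t, u) ∈ D₂) :
    S₂ s t u = G s t u * ((2 : ℂ) ^ (2 - s - t - u) / (s + t + u - 2))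
      + sumG (triple (eta 2) (eta 2) (eta 2)) s t u
      + sumG (fun s t u => double (eta (-2)) (eta (-2)) u s t) s t u
      + sumG (double (eta (-2)) (eta (-2))) s t u
      + sumG (fun s t u => double (eta (-2)) (eta (-2)) t u s) s t u
      + sumG (fun s t u => single (eta (-2)) t u s) s t u
      + sumG (fun s t u => single (eta (-2)) u s t) s t u + sumG (single (eta (-2))) s t u := by
  rw [(isExpansion_triple norm_two norm_two norm_two isOpen_D₂).sumG_eq hp,
    (isExpansion_double_rotate' norm_neg_two norm_neg_two isOpen_D₂).sumG_eq hp,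
    (isExpansion_double norm_neg_two norm_neg_two isOpen_D₂).sumG_eq hp,
    (isExpansion_double_rotate norm_neg_two norm_neg_two isOpen_D₂).sumG_eq hp,
    (isExpansion_single_rotate norm_neg_two).sumG_eq hp,
    (isExpansion_single_rotate' norm_neg_two).sumG_eq hp,
    (isExpansion_single norm_neg_two isOpen_D₂ D₂_subset_D₁).sumG_eq hp,
    S₂_eq_expansion₂ hp, expansion₂, expansion₂Main, expansion₂Core, polarNum]
  ring

end ExpansionFormulas

end Tornheim

end

theorem theorem1 :
    -- the Tornheim series has its continuation `T`
    Tornheim.IsContinuation (fun (s, t, u) => Tornheim.T s t u) ∧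
    -- `S₁`: domain and true singularities
    (∀ s t u, (s, t, u) ∈ Tornheim.D₂ → Tornheim.S₁ s t u = Tornheim.comb₁ s t u) ∧
    DifferentiableOn ℂ (fun (s, t, u) => Tornheim.S₁ s t u) Tornheim.D₁ ∧
    Tornheim.SingularOff Tornheim.D₁ Tornheim.S₁ ∧
    -- `S₁`: convergence of the five series
    Tornheim.RapidOn Tornheim.D₁ Tornheim.deg₃
      (fun s t u => Tornheim.triple Tornheim.etaP Tornheim.etaP Tornheim.etaM s t u) ∧
    Tornheim.RapidOn Tornheim.D₁ id
      (fun s t u => Tornheim.single Tornheim.etaP s t u) ∧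
    Tornheim.RapidOn Tornheim.D₁ Tornheim.deg₂
      (fun s t u => Tornheim.double Tornheim.etaM Tornheim.etaP s t u) ∧
    Tornheim.RapidOn Tornheim.D₁ Tornheim.deg₂
      (fun s t u => Tornheim.double Tornheim.etaM Tornheim.etaP t s u) ∧
    Tornheim.RapidOn Tornheim.D₁ Tornheim.deg₂
      (fun s t u => Tornheim.double Tornheim.etaP Tornheim.etaP u s t) ∧
    -- `S₁`: the expansion where the braces are finite
    (∀ s t u, (s, t, u) ∈ Tornheim.D₁ → (s, t, u) ∈ Tornheim.regularPoints →
      Tornheim.S₁ s t u = Tornheim.G s t u *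
        (∑' i, Tornheim.triple Tornheim.etaP Tornheim.etaP Tornheim.etaM s t u i
          + ∑' n, Tornheim.single Tornheim.etaP s t u n
          + ∑' i, Tornheim.double Tornheim.etaM Tornheim.etaP s t u i
          + ∑' i, Tornheim.double Tornheim.etaM Tornheim.etaP t s u i
          + ∑' i, Tornheim.double Tornheim.etaP Tornheim.etaP u s t i)) ∧
    -- `S₁`: the expansion on the whole domain
    (∀ s t u, (s, t, u) ∈ Tornheim.D₁ →
      Tornheim.S₁ s t u =
        Tornheim.sumG
            (fun s t u => Tornheim.triple Tornheim.etaP Tornheim.etaP Tornheim.etaM s t u) s t u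
          + Tornheim.sumG (fun s t u => Tornheim.single Tornheim.etaP s t u) s t u
          + Tornheim.sumG
            (fun s t u => Tornheim.double Tornheim.etaM Tornheim.etaP s t u) s t u
          + Tornheim.sumG
            (fun s t u => Tornheim.double Tornheim.etaM Tornheim.etaP t s u) s t u
          + Tornheim.sumG
            (fun s t u => Tornheim.double Tornheim.etaP Tornheim.etaP u s t) s t u) ∧
    -- `S₂`: domain and true singularities
    DifferentiableOn ℂ (fun (s, t, u) => Tornheim.S₂ s t u) Tornheim.D₂ ∧
    Tornheim.SingularOff Tornheim.D₂ Tornheim.S₂ ∧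
    -- `S₂`: convergence of the seven series
    Tornheim.RapidOn Tornheim.D₂ Tornheim.deg₃
      (fun s t u => Tornheim.triple Tornheim.etaP Tornheim.etaP Tornheim.etaP s t u) ∧
    Tornheim.RapidOn Tornheim.D₂ Tornheim.deg₂
      (fun s t u => Tornheim.double Tornheim.etaM Tornheim.etaM u s t) ∧
    Tornheim.RapidOn Tornheim.D₂ Tornheim.deg₂
      (fun s t u => Tornheim.double Tornheim.etaM Tornheim.etaM s t u) ∧
    Tornheim.RapidOn Tornheim.D₂ Tornheim.deg₂
      (fun s t u => Tornheim.double Tornheim.etaM Tornheim.etaM t u s) ∧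
    Tornheim.RapidOn Tornheim.D₂ id
      (fun s t u => Tornheim.single Tornheim.etaM t u s) ∧
    Tornheim.RapidOn Tornheim.D₂ id
      (fun s t u => Tornheim.single Tornheim.etaM u s t) ∧
    Tornheim.RapidOn Tornheim.D₂ id
      (fun s t u => Tornheim.single Tornheim.etaM s t u) ∧
    -- `S₂`: the expansion where the braces are finite
    (∀ s t u, (s, t, u) ∈ Tornheim.D₂ → (s, t, u) ∈ Tornheim.regularPoints →
      Tornheim.S₂ s t u = Tornheim.G s t u *
        ((2 : ℂ) ^ (2 - s - t - u) / (s + t + u - 2)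
          + ∑' i, Tornheim.triple Tornheim.etaP Tornheim.etaP Tornheim.etaP s t u i
          + ∑' i, Tornheim.double Tornheim.etaM Tornheim.etaM u s t i
          + ∑' i, Tornheim.double Tornheim.etaM Tornheim.etaM s t u i
          + ∑' i, Tornheim.double Tornheim.etaM Tornheim.etaM t u s i
          + ∑' l, Tornheim.single Tornheim.etaM t u s l
          + ∑' m, Tornheim.single Tornheim.etaM u s t m
          + ∑' n, Tornheim.single Tornheim.etaM s t u n)) ∧
    -- `S₂`: the expansion on the whole domain
    (∀ s t u, (s, t, u) ∈ Tornheim.D₂ →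
      Tornheim.S₂ s t u =
        Tornheim.G s t u * ((2 : ℂ) ^ (2 - s - t - u) / (s + t + u - 2))
          + Tornheim.sumG
            (fun s t u => Tornheim.triple Tornheim.etaP Tornheim.etaP Tornheim.etaP s t u) s t u
          + Tornheim.sumG
            (fun s t u => Tornheim.double Tornheim.etaM Tornheim.etaM u s t) s t u
          + Tornheim.sumG
            (fun s t u => Tornheim.double Tornheim.etaM Tornheim.etaM s t u) s t u
          + Tornheim.sumG
            (fun s t u => Tornheim.double Tornheim.etaM Tornheim.etaM t u s) s t u
          + Tornheim.sumG (fun s t u => Tornheim.single Tornheim.etaM t u s) s t u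
          + Tornheim.sumG (fun s t u => Tornheim.single Tornheim.etaM u s t) s t u
          + Tornheim.sumG (fun s t u => Tornheim.single Tornheim.etaM s t u) s t u) := by
  open Tornheim in
  refine ⟨isContinuation_T, fun _ _ _ => S₁_eq_comb₁, differentiableOn_S₁, singularOff_S₁,
    (isExpansion_triple norm_two norm_two norm_neg_two isOpen_D₁).rapidOn,
    (isExpansion_single norm_two isOpen_D₁ subset_rfl).rapidOn,
    (isExpansion_double norm_neg_two norm_two isOpen_D₁).rapidOn,
    (isExpansion_double_swap norm_neg_two norm_two isOpen_D₁).rapidOn,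
    (isExpansion_double_rotate' norm_two norm_two isOpen_D₁).rapidOn,
    fun _ _ _ => S₁_eq_G_mul_add_tsum, fun _ _ _ => S₁_eq_add_sumG,
    differentiableOn_S₂, singularOff_S₂,
    (isExpansion_triple norm_two norm_two norm_two isOpen_D₂).rapidOn,
    (isExpansion_double_rotate' norm_neg_two norm_neg_two isOpen_D₂).rapidOn,
    (isExpansion_double norm_neg_two norm_neg_two isOpen_D₂).rapidOn,
    (isExpansion_double_rotate norm_neg_two norm_neg_two isOpen_D₂).rapidOn,
    (isExpansion_single_rotate norm_neg_two).rapidOn,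
    (isExpansion_single_rotate' norm_neg_two).rapidOn,
    (isExpansion_single norm_neg_two isOpen_D₂ D₂_subset_D₁).rapidOn,
    fun _ _ _ => S₂_eq_G_mul_add_tsum, fun _ _ _ => S₂_eq_add_sumG⟩
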